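/- Setting. Let $d\ge 1$, let $h=(h(i))_{i\in\mathbb N}\in(\mathbb R^d)^{\mathbb N}$ be a deterministic external field, and let $\beta>0$. The finite-volume Gibbs state $\mu_n=\mu_n^{\beta,h}$ is the probability measure $$\mu_n[f]=\frac{\int_{\mathbb S^{nd-1}}d\Omega\,e^{-\beta H_n(\sqrt n\,\Omega)}f(\sqrt n\,\Omega)}{\int_{\mathbb S^{nd-1}}d\Omega\,e^{-\beta H_n(\sqrt n\,\Omega)}},\qquad H_n(\phi)=-\frac1{2n}\sum_{i,j=1}^n\langle\phi(i),\phi(j)\rangle-\sum_{i=1}^n\langle h(i),\phi(i)\rangle ,$$ where $d\Omega$ is the surface measure; a configuration $(\phi(1),\dots,\phi(n))$ is continued by $0$ at the remaining sites, so that $\mu_n$ is a probability measure on $(\mathbb R^d)^{\mathbb N}$. On $(\mathbb R^d)^{\mathbb N}$ use the metric $C(d)^{-1}\sum_{i\ge 1,\,1\le j\le d}2^{-(i+j)}\min\{|\phi_j(i)-\phi'_j(i)|,1\}$ with $C(d)=\sum_{i\ge 1,\,1\le j\le d}2^{-(i+j)}$, and let $d_{\mathrm{BL}_1}(\mu,\nu)=\sup_f|\mu[f]-\nu[f]|$,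 the supremum being over all functions $f$ with $|f|\le 1$ that are $1$-Lipschitz for this metric. Let $$m_n=\frac1n\sum_{i=1}^n h(i),\qquad (s_n)_j=\sqrt{\frac1n\sum_{i=1}^n h_j(i)^2-((m_n)_j)^2}\,.$$ Assume that $$\lim_{n\to\infty}m_n=0,\quad \lim_{n\to\infty}s_n=s\in(0,\infty)^d,\quad \sum_{i\ge 1,\,1\le j\le d}\frac{|h_j(i)|}{2^{i+j}}<\infty,\quad \|s\|<1,\quad \beta>\frac{d}{1-\|s\|^2},$$ and put $r^*=\sqrt{1-\frac d\beta-\|s\|^2}$. For $\Omega\in\mathbb S^{d-1}$ let $\nu^{r^*\Omega,s,h}$ be the product measure on $(\mathbb R^d)^{\mathbb N}$ whose marginal at site $i$ and component $j$ is the law of $$\sqrt{\frac{1-\|r^*\Omega\|^2-\|s\|^2}{d}}\,G_j(i)+r^*\Omega_j+s_j\,\frac{h_j(i)}{s_j},\qquad\text{that is, of}\quad \frac1{\sqrt\beta}G_j(i)+r^*\Omega_j+h_j(i),$$ with $G_j(i)$ a standard Gaussian, and for $z\in\mathbb R^d$ let $$\overline\nu^{z}=\overline\nu^{z,r^*,s,h}=\frac{\int_{\mathbb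 S^{d-1}}d\Omega\,e^{\beta r^*\langle\Omega,z\rangle}\,\nu^{r^*\Omega,s,h}}{\int_{\mathbb S^{d-1}}d\Omega\,e^{\beta r^*\langle\Omega,z\rangle}} ,$$ where $d\Omega$ is the surface measure on $\mathbb S^{d-1}$ (the counting measure on $\{-1,1\}$ if $d=1$). Theorem. Under these assumptions: 1. If $\lim_{n\to\infty}n\,m_n=z\in\mathbb R^d$, then $\lim_{n\to\infty}d_{\mathrm{BL}_1}(\mu_n,\overline\nu^{z})=0$. 2. If $\lim_{n\to\infty}n\|m_n\|=\infty$, then $\lim_{n\to\infty}d_{\mathrm{BL}_1}(\mu_n,\nu^{r^*\widehat m_n,s,h})=0$, where $\widehat m_n=m_n/\|m_n\|$. 3. Every cluster point of $(\mu_n)$, that is, every probability measure $\mu$ on $(\mathbb R^d)^{\mathbb N}$ for which $\lim_{k\to\infty}d_{\mathrm{BL}_1}(\mu_{n_k},\mu)=0$ along some subsequence $(n_k)$, is either a tilted mixture or a pure state: $$\operatorname{clust}(\mu_n)\subset\{\overline\nu^{z}:z\in\mathbb R^d\}\cup\{\nu^{r^*\Omega,s,h}:\Omega\in\mathbb S^{d-1}\}.$$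 -/

import Mathlib

open MeasureTheory ProbabilityTheory Filter Topology

noncomputable section

/-- The local spin space `ℝ^d` with its Euclidean inner product. -/
abbrev SpinVec (d : ℕ) : Type := EuclideanSpace ℝ (Fin d)

/-- The configuration space `(ℝ^d)^ℕ`, with the product topology and the product (= Borel)
`σ`-algebra. Sites are numbered from `0`, so the finite volume of size `n` is `{0, …, n - 1}`. -/
abbrev SpinConfig (d : ℕ) : Type := ℕ → SpinVec d

/-- The weight `2^{-(i+j)}` of the component `j` at the site `i` (both counted from `1` here). -/
def spinWeight {d : ℕ} (p : ℕ × Fin d) : ℝ := 1 / 2 ^ ((p.1 + 1) + ((p.2 : ℕ) + 1))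

/-- The metric on `(ℝ^d)^ℕ`,
`d(φ, φ') = C(d)⁻¹ ∑_{i,j} min(|φ_j(i) - φ'_j(i)|, 1) / 2^{i+j}` with `C(d) = ∑_{i,j} 1 / 2^{i+j}`. -/
def spinDist {d : ℕ} (φ φ' : SpinConfig d) : ℝ :=
  (1 / ∑' p : ℕ × Fin d, spinWeight p) *
    ∑' p : ℕ × Fin d, min |φ p.1 p.2 - φ' p.1 p.2| 1 * spinWeight p

/-- The `1`-bounded functions that are `1`-Lipschitz with respect to `spinDist`. -/
def boundedLipschitz (d : ℕ) : Set (SpinConfig d → ℝ) :=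
  {f | (∀ φ, |f φ| ≤ 1) ∧ ∀ φ φ', |f φ - f φ'| ≤ spinDist φ φ'}

/-- The bounded Lipschitz metric `sup_f |μ[f] - ν[f]|`. -/
def distBL {d : ℕ} (μ ν : Measure (SpinConfig d)) : ℝ :=
  sSup ((fun f : SpinConfig d → ℝ => |∫ φ, f φ ∂μ - ∫ φ, f φ ∂ν|) '' boundedLipschitz d)

/-- The cluster points of a sequence: the probability measures that are limits of a
subsequence with respect to the bounded Lipschitz metric. -/
def clusterStates {d : ℕ} (μ : ℕ → Measure (SpinConfig d)) : Set (Measure (SpinConfig d)) :=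
  {ν | IsProbabilityMeasure ν ∧
    ∃ k : ℕ → ℕ, StrictMono k ∧ Tendsto (fun l => distBL (μ (k l)) ν) atTop (𝓝 0)}

/-- The Hamiltonian
`H_n^h(φ) = -(1/2n) ∑_{i,j} ⟨φ(i), φ(j)⟩ - ∑_i ⟨h(i), φ(i)⟩` in the volume of size `n`. -/
def spinEnergy {d : ℕ} (n : ℕ) (h φ : SpinConfig d) : ℝ :=
  -(1 / (2 * (n : ℝ))) * ∑ i ∈ Finset.range n, ∑ j ∈ Finset.range n, inner ℝ (φ i) (φ j)
    - ∑ i ∈ Finset.range n, inner ℝ (h i) (φ i)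

/-- The configuration `φ_j(i) = √n Ω_j(i)` in the volume of size `n`, continued by `0`. -/
def scaledConfig {d : ℕ} (n : ℕ) (Ω : EuclideanSpace ℝ (Fin n × Fin d)) : SpinConfig d :=
  fun i => if hi : i < n then WithLp.toLp 2 (fun j => √(n : ℝ) * Ω (⟨i, hi⟩, j)) else 0

/-- The finite-volume Gibbs state at inverse temperature `β`: the probability measure
`μ[f] = Z⁻¹ ∫_{S^{nd-1}} dΩ exp(-β H_n^h(√n Ω)) f(√n Ω)`, where `dΩ` is the surface measure. -/
def gibbsState {d : ℕ} (β : ℝ) (h : SpinConfig d) (n : ℕ) : Measure (SpinConfig d) :=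
  (((volume : Measure (EuclideanSpace ℝ (Fin n × Fin d))).toSphere).tilted
    (fun Ω => -β * spinEnergy n h (scaledConfig n Ω.1))).map (fun Ω => scaledConfig n Ω.1)

/-- The sample mean `m_n = (1/n) ∑_{i ≤ n} h(i)`. -/
def sampleMean {d : ℕ} (h : SpinConfig d) (n : ℕ) : SpinVec d :=
  (1 / (n : ℝ)) • ∑ i ∈ Finset.range n, h i

/-- The componentwise sample standard deviation
`(s_n)_j = √((1/n) ∑_{i ≤ n} h_j(i)² - (m_n)_j²)`. -/
def sampleStd {d : ℕ} (h : SpinConfig d) (n : ℕ) : SpinVec d :=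
  WithLp.toLp 2 fun j =>
    √((1 / (n : ℝ)) * ∑ i ∈ Finset.range n, (h i j) ^ 2 - (sampleMean h n j) ^ 2)

/-- The configuration with components
`√((1 - ‖x‖² - ‖y‖²)/d) G_j(i) + x_j + y_j (h_j(i) - m_j) / s_j`. -/
def productConfig {d : ℕ} (m s : SpinVec d) (h : SpinConfig d) (x y : SpinVec d)
    (G : ℕ × Fin d → ℝ) : SpinConfig d :=
  fun i => WithLp.toLp 2 fun j =>
    √((1 - ‖x‖ ^ 2 - ‖y‖ ^ 2) / d) * G (i, j) + x j + y j * ((h i j - m j) / s j)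

/-- The product measure `ν^{x,y,h}`: the law of `productConfig` when the `G_j(i)` are
independent standard Gaussians. -/
def productState {d : ℕ} (m s : SpinVec d) (h : SpinConfig d) (x y : SpinVec d) :
    Measure (SpinConfig d) :=
  (Measure.infinitePi fun _ : ℕ × Fin d => gaussianReal 0 1).map (productConfig m s h x y)

/-- The tilted mixture
`(∫_{S^{d-1}} dΩ e^{β r ⟨Ω, z⟩})⁻¹ ∫_{S^{d-1}} dΩ e^{β r ⟨Ω, z⟩} ν^{rΩ,y,h}`,
where `dΩ` is the surface measure. -/
def tiltedMixture {d : ℕ} (β : ℝ) (m s : SpinVec d) (h : SpinConfig d) (z : SpinVec d) (r : ℝ)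
    (y : SpinVec d) : Measure (SpinConfig d) :=
  (((volume : Measure (SpinVec d)).toSphere).tilted
    (fun Ω => β * r * inner ℝ Ω.1 z)).bind (fun Ω => productState m s h (r • Ω.1) y)

theorem measurable_scaledConfig {d : ℕ} (n : ℕ) :
    Measurable (scaledConfig n : EuclideanSpace ℝ (Fin n × Fin d) → SpinConfig d) := by
  refine measurable_pi_lambda _ fun i => ?_
  unfold scaledConfig
  split_ifs <;> fun_prop

theorem continuous_scaledConfig {d : ℕ} (n : ℕ) :
    Continuous (scaledConfig n : EuclideanSpace ℝ (Fin n × Fin d) → SpinConfig d) := by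
  refine continuous_pi fun i => ?_
  unfold scaledConfig
  split_ifs <;> fun_prop

theorem isProbabilityMeasure_tilted_toSphere {ι : Type*} [Fintype ι] [Nonempty ι]
    {g : Metric.sphere (0 : EuclideanSpace ℝ ι) 1 → ℝ} (hg : Continuous g) :
    IsProbabilityMeasure
      (((volume : Measure (EuclideanSpace ℝ ι)).toSphere).tilted g) := by
  have : NeZero ((volume : Measure (EuclideanSpace ℝ ι)).toSphere) :=
    ⟨Measure.toSphere_ne_zero _⟩
  refine isProbabilityMeasure_tilted ?_
  exact (Real.continuous_exp.comp hg).integrable_of_hasCompactSupport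
    (HasCompactSupport.of_compactSpace _)

instance isProbabilityMeasure_gibbsState {d n : ℕ} [NeZero d] [NeZero n] (β : ℝ) (h : SpinConfig d) :
    IsProbabilityMeasure (gibbsState β h n) := by
  have hc : Continuous fun Ω : Metric.sphere (0 : EuclideanSpace ℝ (Fin n × Fin d)) 1 =>
      -β * spinEnergy n h (scaledConfig n Ω.1) := by
    have h1 := (continuous_scaledConfig (d := d) n).comp
      (continuous_subtype_val (p := (· ∈ Metric.sphere (0 : EuclideanSpace ℝ (Fin n × Fin d)) 1)))
    have h2 : ∀ i, Continuous fun Ω : Metric.sphere (0 : EuclideanSpace ℝ (Fin n × Fin d)) 1 =>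
      scaledConfig n Ω.1 i := fun i => (continuous_apply i).comp h1
    unfold spinEnergy
    fun_prop
  have := isProbabilityMeasure_tilted_toSphere hc
  exact Measure.isProbabilityMeasure_map
    ((measurable_scaledConfig n).comp measurable_subtype_coe).aemeasurable

theorem measurable_productConfig {d : ℕ} (m s : SpinVec d) (h : SpinConfig d) (y : SpinVec d) :
    Measurable fun p : SpinVec d × (ℕ × Fin d → ℝ) => productConfig m s h p.1 y p.2 := by
  unfold productConfig
  fun_prop

instance isProbabilityMeasure_productState {d : ℕ} (m s : SpinVec d) (h : SpinConfig d) (x y : SpinVec d) :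
    IsProbabilityMeasure (productState m s h x y) :=
  Measure.isProbabilityMeasure_map
    ((measurable_productConfig m s h y).comp measurable_prodMk_left).aemeasurable

theorem measurable_map_prodMk {α γ δ : Type*} [MeasurableSpace α] [MeasurableSpace γ]
    [MeasurableSpace δ] (μ : Measure γ) [SFinite μ] {T : α → γ → δ}
    (hT : Measurable fun p : α × γ => T p.1 p.2) : Measurable fun a => μ.map (T a) := by
  refine Measure.measurable_of_measurable_coe _ fun S hS => ?_
  have h1 : ∀ a, μ.map (T a) S = μ (Prod.mk a ⁻¹' ((fun p : α × γ => T p.1 p.2) ⁻¹' S)) :=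
    fun a => Measure.map_apply (hT.comp measurable_prodMk_left) hS
  simp_rw [h1]
  exact measurable_measure_prodMk_left (hT hS)

theorem measurable_productState {d : ℕ} (m s : SpinVec d) (h : SpinConfig d) (y : SpinVec d) :
    Measurable fun x => productState m s h x y :=
  measurable_map_prodMk _ (measurable_productConfig m s h y)

instance isProbabilityMeasure_tiltedMixture {d : ℕ} [NeZero d] (β : ℝ) (m s : SpinVec d) (h : SpinConfig d) (z : SpinVec d) (r : ℝ)
    (y : SpinVec d) : IsProbabilityMeasure (tiltedMixture β m s h z r y) := by
  have hc : Continuous fun Ω : Metric.sphere (0 : SpinVec d) 1 => β * r * inner ℝ Ω.1 z := by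
    fun_prop
  have := isProbabilityMeasure_tilted_toSphere hc
  refine isProbabilityMeasure_bind ?_ (Eventually.of_forall fun _ => inferInstance)
  exact ((measurable_productState m s h y).comp
    (measurable_subtype_coe.const_smul r)).aemeasurable

end

open scoped ENNReal NNReal

/-! Split ℝ^{nd} into the (d+1)-dimensional space W spanned by the constant configurations and the
centred external field, and its orthogonal complement. The energy depends on the W-part only. Write
a point of the sphere as Ω = ρ(w)(w + ĝ), with ρ(w) = (1 + |w|²)^{-1/2} and ĝ the direction of a
Gaussian vector in W^⊥. The surface measure then becomes ρ^{nd} dw times the law of ĝ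
(`exists_lintegral_toSphere_eq`). So w = (w₁, w₂) has Gibbs density proportional to exp(n(E_n(w) + d
log ρ)), and given w the spin at site i is ρw₁ + (ρw₂/‖s_n‖)(h(i) − m_n) + ρ√n ĝ(i)
(`integral_gibbsState`).

The directions ĝ of all volumes are built from one infinite Gaussian field G, and √n ĝ(i) → G(i)/√d
almost surely (`ae_tendsto_transverseDirection`). Driving the limit state by the same G reduces
closeness of states to closeness of the coordinates w, uniformly over test functions
(`abs_transverseMean_sub_pureMean_le`).

Put σ = ‖s‖. Since |ρw₁|² + (ρw₂)² + ρ² = 1, the rate with m_n dropped is β/2 (1 + σ² − (ρw₂ − σ)² −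
ρ²) + d log ρ. It is maximal where ρw₂ = σ and ρ² = d/β, hence ‖ρw₁‖ = r; there the limiting spin is
G/√β + rΩ + h(i). Everything at a fixed gap below the maximum is exponentially negligible
(`tendsto_fieldDensity_rateGap`).

The rate does not select the direction of w₁. On a sphere ‖w₁‖ = t with w₂ fixed, the exact density
is a constant times exp⟨βa n m_n, Ω⟩ with a = ρt close to r. No expansion of the Laplace integral is
therefore needed: averages are compared on each such sphere and then integrated over the other
coordinates (`abs_integral_le_of_sphere`, `eventually_abs_gibbsState_sub_le`). If n m_n → z, the
tilt tends to βrz and the mixture appears; if n‖m_n‖ → ∞, the tilt concentrates at the direction of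
m_n.

For cluster points, pass to an ultrafilter finer than the subsequence. Along it either n‖m_n‖ → ∞
and the directions converge, or n m_n stays bounded and converges. The integrals of bounded
Lipschitz functions are then known, and they determine the measure (`ext_of_boundedLipschitz`). -/

noncomputable section

/-! ### Polar coordinates -/

section Polar

variable {E : Type*} [NormedAddCommGroup E] [NormedSpace ℝ E] [MeasurableSpace E] [BorelSpace E]
  [FiniteDimensional ℝ E]

theorem lintegral_comp_smul_haar (μ : Measure E) [μ.IsAddHaarMeasure] {F : E → ℝ≥0∞}
    (hF : Measurable F) {r : ℝ} (hr : 0 < r) :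
    ∫⁻ x, F x ∂μ = ENNReal.ofReal (r ^ Module.finrank ℝ E) * ∫⁻ x, F (r • x) ∂μ := by
  have h1 := Measure.map_addHaar_smul μ hr.ne'
  have h2 : ∫⁻ x, F (r • x) ∂μ = ∫⁻ x, F x ∂(μ.map (r • ·)) :=
    (lintegral_map hF (measurable_const_smul r)).symm
  rw [h2, h1, lintegral_smul_measure, smul_eq_mul, ← mul_assoc, ← ENNReal.ofReal_mul (by positivity),
    abs_of_nonneg (by positivity), mul_inv_cancel₀ (by positivity)]
  simp

variable [Nontrivial E]

/-- Polar coordinates: the product of the surface measure and the radial measure is carried to the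
Haar measure by `(Ω, r) ↦ r Ω`. -/
theorem measurePreserving_smul_sphere (μ : Measure E) [μ.IsAddHaarMeasure] :
    MeasurePreserving
      (fun p : Metric.sphere (0 : E) 1 × Set.Ioi (0 : ℝ) => (p.2 : ℝ) • (p.1 : E))
      (μ.toSphere.prod (Measure.volumeIoiPow (Module.finrank ℝ E - 1))) μ := by
  have h1 := (μ.measurePreserving_homeomorphUnitSphereProd).symm
    (homeomorphUnitSphereProd E).toMeasurableEquiv
  have h2 : MeasurePreserving ((↑) : ({0}ᶜ : Set E) → E) (μ.comap (↑)) (μ.restrict {0}ᶜ) :=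
    ⟨measurable_subtype_coe, map_comap_subtype_coe (measurableSet_singleton _).compl μ⟩
  have h3 : μ.restrict ({0}ᶜ : Set E) = μ := by
    rw [Measure.restrict_eq_self_of_ae_mem]
    simp [ae_iff]
  rw [h3] at h2
  have h4 := h2.comp h1
  exact h4

/-- The integrand separates in polar coordinates. Leaving the radial profile Ψ free allows the
surface integral to be computed from whichever weight suits the other coordinate system. -/
theorem lintegral_polar (μ : Measure E) [μ.IsAddHaarMeasure] {F : E → ℝ≥0∞} (hF : Measurable F)
    {Ψ : ℝ → ℝ≥0∞} (hΨ : Measurable Ψ) :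
    ∫⁻ x, F (‖x‖⁻¹ • x) * Ψ ‖x‖ ∂μ =
      (∫⁻ Ω, F (Ω : E) ∂μ.toSphere) *
        ∫⁻ r, Ψ (r : ℝ) ∂Measure.volumeIoiPow (Module.finrank ℝ E - 1) := by
  rw [← (measurePreserving_smul_sphere μ).lintegral_comp (by fun_prop),
    ← lintegral_prod_mul (by fun_prop) (by fun_prop)]
  refine lintegral_congr fun p => ?_
  have hp : (0 : ℝ) < p.2 := p.2.2
  have : ‖(p.2 : ℝ) • (p.1 : E)‖ = p.2 := by
    rw [norm_smul]; simp [abs_of_pos hp]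
  rw [this, smul_smul, inv_mul_cancel₀ hp.ne', one_smul]

end Polar

/-! ### Gnomonic coordinates -/

section Gnomonic

variable {A B : Type*} [NormedAddCommGroup A] [NormedSpace ℝ A] [MeasurableSpace A] [BorelSpace A]
  [FiniteDimensional ℝ A] [NormedAddCommGroup B] [NormedSpace ℝ B]
  [MeasurableSpace B] [BorelSpace B] [FiniteDimensional ℝ B] [Nontrivial B]

/-- Gnomonic coordinates: integrating a function that is homogeneous of degree `0` in the pair
`(v, g)` factorizes into an integral over `w = v / ‖g‖` with density `(1 + q w)^{-(k + m)/2}` and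
a Gaussian integral over the direction of `g`. -/
theorem lintegral_gnomonic (μ : Measure A) [μ.IsAddHaarMeasure] (ν : Measure B)
    [ν.IsAddHaarMeasure] {q : A → ℝ} (hq : Measurable q) (hq0 : ∀ v, 0 ≤ q v)
    (hqs : ∀ (c : ℝ) v, q (c • v) = c ^ 2 * q v) {F : A × B → ℝ≥0∞} (hF : Measurable F) :
    ∫⁻ p : A × B, F ((√(q p.1 + ‖p.2‖ ^ 2))⁻¹ • p) *
        ENNReal.ofReal (((√(q p.1 + ‖p.2‖ ^ 2)) ^ Module.finrank ℝ A)⁻¹ *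
          Real.exp (-(q p.1 + ‖p.2‖ ^ 2) / 2)) ∂(μ.prod ν) =
      ∫⁻ w, ENNReal.ofReal (((√(1 + q w)) ^ (Module.finrank ℝ A + Module.finrank ℝ B))⁻¹) *
        ∫⁻ g, F ((√(1 + q w))⁻¹ • (w, ‖g‖⁻¹ • g)) * ENNReal.ofReal (Real.exp (-‖g‖ ^ 2 / 2)) ∂ν
        ∂μ := by
  set k := Module.finrank ℝ A
  set m := Module.finrank ℝ B
  have hg0 : ∀ᵐ g ∂ν, g ≠ 0 := by
    simp [ae_iff]
  rw [lintegral_prod_symm _ (by fun_prop)]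
  have step1 : ∀ᵐ g ∂ν, (∫⁻ v, F ((√(q v + ‖g‖ ^ 2))⁻¹ • (v, g)) *
        ENNReal.ofReal (((√(q v + ‖g‖ ^ 2)) ^ k)⁻¹ * Real.exp (-(q v + ‖g‖ ^ 2) / 2)) ∂μ) =
      ∫⁻ w, F ((√(1 + q w))⁻¹ • (w, ‖g‖⁻¹ • g)) *
        ENNReal.ofReal (((√(1 + q w)) ^ k)⁻¹ * Real.exp (-((1 + q w) * ‖g‖ ^ 2) / 2)) ∂μ := by
    filter_upwards [hg0] with g hg
    have hg' : 0 < ‖g‖ := norm_pos_iff.2 hg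
    -- Substitute v = ‖g‖ w. The Jacobian ‖g‖^k cancels against the weight of degree −k, which
    -- leaves (1 + q w)^{-k/2}.
    rw [lintegral_comp_smul_haar μ (by fun_prop) hg', ← lintegral_const_mul _ (by fun_prop)]
    refine lintegral_congr fun w => ?_
    have e1 : q (‖g‖ • w) + ‖g‖ ^ 2 = (1 + q w) * ‖g‖ ^ 2 := by rw [hqs]; ring
    have hw : 0 < 1 + q w := by linarith [hq0 w]
    have e2 : √((1 + q w) * ‖g‖ ^ 2) = √(1 + q w) * ‖g‖ := by
      rw [Real.sqrt_mul hw.le, Real.sqrt_sq hg'.le]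
    have e3 : (√(1 + q w) * ‖g‖)⁻¹ • ((‖g‖ • w, g) : A × B) =
        (√(1 + q w))⁻¹ • ((w, ‖g‖⁻¹ • g) : A × B) := by
      ext
      · simp only [Prod.smul_fst, smul_smul]; congr 1; field_simp
      · simp only [Prod.smul_snd, smul_smul]; congr 1; field_simp
    rw [e1, e2, e3, mul_left_comm, ← ENNReal.ofReal_mul (by positivity)]
    congr 2
    have := Real.sqrt_pos.2 hw
    field_simp
    rw [mul_pow, mul_comm]
  rw [lintegral_congr_ae step1, lintegral_lintegral_swap (by fun_prop)]
  refine lintegral_congr fun w => ?_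
  have hw : 0 < 1 + q w := by linarith [hq0 w]
  have hs := Real.sqrt_pos.2 hw
  -- Shrinking g by (1 + q w)^{-1/2} restores the standard Gaussian weight and supplies the
  -- remaining power m.
  rw [lintegral_comp_smul_haar ν (r := (√(1 + q w))⁻¹) (by fun_prop) (by positivity),
    ← lintegral_const_mul _ (by fun_prop), ← lintegral_const_mul _ (by fun_prop)]
  refine lintegral_congr fun g => ?_
  have e1 : ‖(√(1 + q w))⁻¹ • g‖ = (√(1 + q w))⁻¹ * ‖g‖ := by
    rw [norm_smul, Real.norm_of_nonneg (by positivity)]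
  have e2 : ((√(1 + q w))⁻¹ * ‖g‖)⁻¹ • (√(1 + q w))⁻¹ • g = ‖g‖⁻¹ • g := by
    rw [smul_smul]; congr 1; field_simp
  rw [e1, e2, mul_left_comm, mul_left_comm (ENNReal.ofReal _) (F _), ← ENNReal.ofReal_mul (by positivity),
    ← ENNReal.ofReal_mul (by positivity)]
  congr 2
  rw [pow_add, mul_inv, ← mul_assoc, inv_pow, mul_comm (√(1 + q w) ^ m)⁻¹]
  congr 2
  rw [mul_pow, inv_pow, Real.sq_sqrt hw.le]
  field_simp

end Gnomonic

/-! ### The density of the standard Gaussian measure -/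

section GaussianDensity

variable {B : Type*} [NormedAddCommGroup B] [InnerProductSpace ℝ B] [FiniteDimensional ℝ B]
  [MeasurableSpace B] [BorelSpace B]

theorem integrable_exp_neg_norm_sq_half :
    Integrable (fun x : B => Real.exp (-‖x‖ ^ 2 / 2)) := by
  have h := (GaussianFourier.integrable_cexp_neg_mul_sq_norm_add (V := B) (b := 1 / 2)
    (by norm_num) 0 0).norm
  refine h.congr (Eventually.of_forall fun x => ?_)
  simp only [Complex.norm_exp]
  congr 1
  simp [← Complex.ofReal_pow]
  norm_cast
  ring_nf

/-- The normalized density has a characteristic function proportional to exp(−‖t‖²/2), by the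
Fourier transform of the Gaussian. The value at t = 0 fixes the factor, so the normalizing constant
is never computed. -/
theorem exists_stdGaussian_eq_withDensity :
    ∃ c : ℝ≥0∞, c ≠ 0 ∧ c ≠ ∞ ∧ stdGaussian B =
      c • (volume : Measure B).withDensity fun x => ENNReal.ofReal (Real.exp (-‖x‖ ^ 2 / 2)) := by
  set ν := (volume : Measure B).withDensity fun x => ENNReal.ofReal (Real.exp (-‖x‖ ^ 2 / 2))
    with hν
  have hfin : ν Set.univ ≠ ∞ := by
    rw [hν, withDensity_apply _ MeasurableSet.univ, Measure.restrict_univ]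
    exact (integrable_exp_neg_norm_sq_half (B := B)).lintegral_lt_top.ne
  have hpos : ν Set.univ ≠ 0 := by
    rw [hν, withDensity_apply _ MeasurableSet.univ, Measure.restrict_univ,
      ne_eq, lintegral_eq_zero_iff (by fun_prop)]
    intro h
    have h2 : ∀ᵐ x : B, False := by
      filter_upwards [h] with x hx
      simp only [Pi.zero_apply, ENNReal.ofReal_eq_zero] at hx
      exact absurd hx (not_le.2 (Real.exp_pos _))
    rw [eventually_false_iff_eq_bot, ae_eq_bot] at h2
    exact NeZero.ne _ h2
  have : IsProbabilityMeasure ((ν Set.univ)⁻¹ • ν) :=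
    ⟨by simp [ENNReal.inv_mul_cancel hpos hfin]⟩
  refine ⟨(ν Set.univ)⁻¹, ENNReal.inv_ne_zero.2 hfin, ENNReal.inv_ne_top.2 hpos, ?_⟩
  have key : ∀ t : B, charFun ((ν Set.univ)⁻¹ • ν) t =
      (((ν Set.univ)⁻¹.toReal : ℂ) * (2 * Real.pi) ^ (Module.finrank ℝ B / 2 : ℂ)) *
        Complex.exp (-‖t‖ ^ 2 / 2) := by
    intro t
    rw [charFun_apply, integral_smul_measure, hν,
      integral_withDensity_eq_integral_toReal_smul (by fun_prop) (by simp)]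
    have h := GaussianFourier.integral_cexp_neg_mul_sq_norm_add (V := B) (b := 1 / 2)
      (by norm_num) Complex.I t
    have e : ∀ x : B, (ENNReal.ofReal (Real.exp (-‖x‖ ^ 2 / 2))).toReal •
        Complex.exp (inner ℝ x t * Complex.I) =
        Complex.exp (-(1 / 2 : ℂ) * ‖x‖ ^ 2 + Complex.I * inner ℝ t x) := by
      intro x
      rw [ENNReal.toReal_ofReal (Real.exp_pos _).le, Complex.real_smul, Complex.ofReal_exp,
        ← Complex.exp_add, real_inner_comm]
      congr 1
      push_cast
      ring
    simp_rw [e]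
    rw [h, Complex.I_sq, Complex.real_smul, mul_assoc]
    congr 2
    · congr 1; ring
    · congr 1; ring
  have h0 := key 0
  rw [charFun_zero, probReal_univ, norm_zero] at h0
  simp only [Complex.ofReal_one, Complex.ofReal_zero, ne_eq, OfNat.ofNat_ne_zero,
    not_false_eq_true, zero_pow, neg_zero, zero_div, Complex.exp_zero, mul_one] at h0
  symm
  apply Measure.ext_of_charFun
  ext t
  rw [key, charFun_stdGaussian]
  rw [← h0, one_mul]

end GaussianDensity

/-! ### The surface measure along a subspace and its complement -/

section SphereDecomposition

variable {A E : Type*} [NormedAddCommGroup A] [NormedSpace ℝ A] [NormedAddCommGroup E]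
  [InnerProductSpace ℝ E] [FiniteDimensional ℝ E]

/-- The linear coordinates `(w, g) ↦ T w + g` adapted to a subspace and its complement. -/
def orthogonalCoordinates (W : Submodule ℝ E) (T : A ≃L[ℝ] W) : (A × Wᗮ) ≃L[ℝ] E :=
  (T.prodCongr (ContinuousLinearEquiv.refl ℝ Wᗮ)).trans
    (Submodule.prodEquivOfIsCompl W Wᗮ W.isCompl_orthogonal).toContinuousLinearEquiv

theorem orthogonalCoordinates_apply (W : Submodule ℝ E) (T : A ≃L[ℝ] W) (p : A × Wᗮ) :
    orthogonalCoordinates W T p = (T p.1 : E) + (p.2 : E) := rfl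

theorem norm_orthogonalCoordinates (W : Submodule ℝ E) (T : A ≃L[ℝ] W) (p : A × Wᗮ) :
    ‖orthogonalCoordinates W T p‖ = √(‖T p.1‖ ^ 2 + ‖p.2‖ ^ 2) := by
  rw [orthogonalCoordinates_apply, ← Real.sqrt_sq (norm_nonneg _)]
  congr 1
  have := norm_add_sq_eq_norm_sq_add_norm_sq_of_inner_eq_zero (T p.1 : E) (p.2 : E)
    (Submodule.inner_right_of_mem_orthogonal (T p.1).2 p.2.2)
  simp only [sq, this, Submodule.coe_norm]

variable [MeasurableSpace A] [BorelSpace A] [FiniteDimensional ℝ A] [MeasurableSpace E]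
  [BorelSpace E] [Nontrivial E]

/-- The surface measure of the unit sphere in the coordinates `Ω = (T w + ĝ) / √(1 + ‖T w‖²)`, with
`ĝ` the direction of a standard Gaussian vector on the orthogonal complement. -/
theorem exists_lintegral_toSphere_eq (W : Submodule ℝ E) [Nontrivial Wᗮ] (T : A ≃L[ℝ] W)
    (μ : Measure A) [μ.IsAddHaarMeasure]
    (hfin : ∫⁻ w, ENNReal.ofReal ((√(1 + ‖T w‖ ^ 2) ^ Module.finrank ℝ E)⁻¹) ∂μ ≠ ∞) :
    ∃ c : ℝ≥0∞, c ≠ 0 ∧ c ≠ ∞ ∧ ∀ F : E → ℝ≥0∞, Measurable F →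
      ∫⁻ Ω, F (Ω : E) ∂(volume : Measure E).toSphere =
        c * ∫⁻ w, ENNReal.ofReal ((√(1 + ‖T w‖ ^ 2) ^ Module.finrank ℝ E)⁻¹) *
          ∫⁻ g, F ((√(1 + ‖T w‖ ^ 2))⁻¹ • ((T w : E) + ‖g‖⁻¹ • (g : E))) ∂stdGaussian Wᗮ ∂μ := by
  set e := orthogonalCoordinates W T with he
  obtain ⟨c₁, hc₁, hc₁', hvol⟩ : ∃ c : ℝ≥0∞, c ≠ 0 ∧ c ≠ ∞ ∧
      (volume : Measure E) = c • (μ.prod (volume : Measure Wᗮ)).map e := by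
    set ν := (μ.prod (volume : Measure Wᗮ)).map e
    have : ν.IsAddHaarMeasure := ContinuousLinearEquiv.isAddHaarMeasure_map e _
    refine ⟨Measure.addHaarScalarFactor (volume : Measure E) ν, ?_, by simp, ?_⟩
    · simpa using (Measure.addHaarScalarFactor_pos_of_isAddHaarMeasure (volume : Measure E) ν).ne'
    · exact Measure.isAddLeftInvariant_eq_smul (volume : Measure E) ν
  obtain ⟨c₂, hc₂, hc₂', hG⟩ := exists_stdGaussian_eq_withDensity (B := Wᗮ)
  -- The radial weight of `lintegral_gnomonic`, so that both coordinate systems compute the same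
  -- integral.
  set Ψ : ℝ → ℝ≥0∞ := fun s =>
    ENNReal.ofReal ((s ^ Module.finrank ℝ A)⁻¹ * Real.exp (-s ^ 2 / 2)) with hΨ
  set C := ∫⁻ r, Ψ (r : ℝ) ∂Measure.volumeIoiPow (Module.finrank ℝ E - 1)
  have hdim : Module.finrank ℝ A + Module.finrank ℝ Wᗮ = Module.finrank ℝ E := by
    rw [T.toLinearEquiv.finrank_eq, W.finrank_add_finrank_orthogonal]
  have main : ∀ F : E → ℝ≥0∞, Measurable F →
      (∫⁻ Ω, F (Ω : E) ∂(volume : Measure E).toSphere) * C =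
        c₁ * (c₂⁻¹ * ∫⁻ w, ENNReal.ofReal ((√(1 + ‖T w‖ ^ 2) ^ Module.finrank ℝ E)⁻¹) *
          ∫⁻ g, F ((√(1 + ‖T w‖ ^ 2))⁻¹ • ((T w : E) + ‖g‖⁻¹ • (g : E))) ∂stdGaussian Wᗮ ∂μ) := by
    intro F hF
    have hΨm : Measurable Ψ := by fun_prop
    rw [← lintegral_polar volume hF hΨm]
    conv_lhs => rw [hvol]
    rw [lintegral_smul_measure, lintegral_map (by fun_prop) (by fun_prop), smul_eq_mul]
    congr 1
    have hgn := lintegral_gnomonic μ (volume : Measure Wᗮ) (q := fun w => ‖T w‖ ^ 2) (by fun_prop)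
      (fun v => by positivity) (fun c v => by rw [map_smul, norm_smul, mul_pow, Real.norm_eq_abs,
        sq_abs]) (F := fun p => F (e p)) (by fun_prop)
    have e1 : ∀ p : A × Wᗮ, F (‖e p‖⁻¹ • e p) * Ψ ‖e p‖ =
        F (e ((√(‖T p.1‖ ^ 2 + ‖p.2‖ ^ 2))⁻¹ • p)) *
        ENNReal.ofReal (((√(‖T p.1‖ ^ 2 + ‖p.2‖ ^ 2)) ^ Module.finrank ℝ A)⁻¹ *
          Real.exp (-(‖T p.1‖ ^ 2 + ‖p.2‖ ^ 2) / 2)) := by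
      intro p
      rw [norm_orthogonalCoordinates, map_smul, hΨ]
      simp only
      rw [Real.sq_sqrt (by positivity)]
    simp_rw [e1]
    rw [hgn, hdim, ← lintegral_const_mul]
    · refine lintegral_congr fun w => ?_
      rw [mul_left_comm]
      congr 1
      rw [hG, lintegral_smul_measure, smul_eq_mul, ← mul_assoc, ENNReal.inv_mul_cancel hc₂ hc₂',
        one_mul, lintegral_withDensity_eq_lintegral_mul _ (by fun_prop) (by fun_prop)]
      refine lintegral_congr fun g => ?_
      rw [Pi.mul_apply, mul_comm, map_smul]
      rfl
    · fun_prop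
  -- Testing with F = 1 shows that the radial constant C is neither 0 nor ∞: the mass of the sphere
  -- and the integral in `hfin` are both positive and finite.
  have h1 := main (fun _ => 1) measurable_const
  simp only [lintegral_const, measure_univ, one_mul, mul_one] at h1
  have hIpos : ∫⁻ w, ENNReal.ofReal ((√(1 + ‖T w‖ ^ 2) ^ Module.finrank ℝ E)⁻¹) ∂μ ≠ 0 := by
    rw [ne_eq, lintegral_eq_zero_iff (by fun_prop)]
    intro h
    have h2 : ∀ᵐ x ∂μ, False := by
      filter_upwards [h] with x hx
      simp only [Pi.zero_apply, ENNReal.ofReal_eq_zero] at hx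
      exact absurd hx (not_le.2 (by positivity))
    rw [eventually_false_iff_eq_bot, ae_eq_bot] at h2
    exact NeZero.ne _ h2
  have hS : (volume : Measure E).toSphere Set.univ ≠ 0 := by
    exact fun h => Measure.toSphere_ne_zero (volume : Measure E) (Measure.measure_univ_eq_zero.1 h)
  have hC0 : C ≠ 0 := by
    intro h
    rw [h, mul_zero] at h1
    exact mul_ne_zero hc₁ (mul_ne_zero (ENNReal.inv_ne_zero.2 hc₂') hIpos) h1.symm
  have hCt : C ≠ ∞ := by
    intro h
    rw [h, ENNReal.mul_top hS] at h1
    exact ENNReal.mul_ne_top hc₁' (ENNReal.mul_ne_top (ENNReal.inv_ne_top.2 hc₂) hfin) h1.symm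
  refine ⟨C⁻¹ * (c₁ * c₂⁻¹), mul_ne_zero (ENNReal.inv_ne_zero.2 hCt)
    (mul_ne_zero hc₁ (ENNReal.inv_ne_zero.2 hc₂')), ENNReal.mul_ne_top (ENNReal.inv_ne_top.2 hC0)
    (ENNReal.mul_ne_top hc₁' (ENNReal.inv_ne_top.2 hc₂)), fun F hF => ?_⟩
  rw [mul_assoc, mul_assoc, ← main F hF, mul_comm, mul_assoc, ENNReal.mul_inv_cancel hC0 hCt,
    mul_one]

end SphereDecomposition

/-! ### Coordinates along the constants and the centred external field -/

section FieldCoordinates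

variable {d : ℕ}

/-- The square norm of the coordinates `w = (w₁, w₂)` of a configuration along the constant
configurations and along the centred external field. -/
def fieldSq (w : SpinVec d × ℝ) : ℝ := ‖w.1‖ ^ 2 + w.2 ^ 2

theorem fieldSq_nonneg (w : SpinVec d × ℝ) : 0 ≤ fieldSq w := by unfold fieldSq; positivity

theorem continuous_fieldSq : Continuous (fieldSq (d := d)) := by unfold fieldSq; fun_prop

/-- The radial factor `(1 + |w|²)^{-1/2}` of the gnomonic coordinates. -/
def radialFactor (w : SpinVec d × ℝ) : ℝ := (√(1 + fieldSq w))⁻¹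

theorem radialFactor_pos (w : SpinVec d × ℝ) : 0 < radialFactor w := by
  have := fieldSq_nonneg w
  unfold radialFactor; positivity

theorem continuous_radialFactor : Continuous (radialFactor (d := d)) := by
  unfold radialFactor
  refine Continuous.inv₀ (by have := continuous_fieldSq (d := d); fun_prop) fun w => ?_
  have := fieldSq_nonneg w
  positivity

@[fun_prop]
theorem measurable_radialFactor : Measurable (radialFactor (d := d)) :=
  continuous_radialFactor.measurable

theorem radialFactor_sq (w : SpinVec d × ℝ) : radialFactor w ^ 2 * (1 + fieldSq w) = 1 := by
  have := fieldSq_nonneg w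
  rw [radialFactor, inv_pow, Real.sq_sqrt (by linarith), inv_mul_cancel₀ (by linarith)]

theorem radialFactor_le_one (w : SpinVec d × ℝ) : radialFactor w ≤ 1 := by
  have := fieldSq_nonneg w
  exact inv_le_one_of_one_le₀ (Real.one_le_sqrt.2 (by linarith))

instance isAddHaarMeasure_volume_prod :
    (volume : Measure (SpinVec d × ℝ)).IsAddHaarMeasure :=
  inferInstanceAs ((volume : Measure (SpinVec d)).prod (volume : Measure ℝ)).IsAddHaarMeasure

/-- The function decays like |w|^{-N} on a space of dimension d + 1. The product carries the sup
norm, whose square is at most `fieldSq`; this is the direction the comparison needs. -/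
theorem integrable_radialFactor_pow {N : ℕ} (hN : d + 1 < N) :
    Integrable (fun w : SpinVec d × ℝ => radialFactor w ^ N) := by
  have hr : (Module.finrank ℝ (SpinVec d × ℝ) : ℝ) < (N : ℝ) := by
    simp; exact_mod_cast hN
  refine (integrable_rpow_neg_one_add_norm_sq (μ := volume) hr).mono'
    (by fun_prop) (Eventually.of_forall fun w => ?_)
  have h0 : ‖w‖ ^ 2 ≤ fieldSq w := by
    unfold fieldSq
    rcases max_choice ‖w.1‖ ‖w.2‖ with h | h <;> rw [Prod.norm_def, h]
    · nlinarith [sq_nonneg w.2]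
    · rw [Real.norm_eq_abs, sq_abs]; nlinarith [sq_nonneg ‖w.1‖]
  have h1 := fieldSq_nonneg w
  rw [Real.norm_of_nonneg (pow_nonneg (radialFactor_pos w).le _), radialFactor, inv_pow,
    Real.sqrt_eq_rpow, ← Real.rpow_natCast, ← Real.rpow_mul (by positivity),
    ← Real.rpow_neg (by positivity)]
  rw [show (-(1 / 2 * (N : ℝ))) = -(N : ℝ) / 2 by ring]
  exact Real.rpow_le_rpow_of_nonpos (by positivity) (by linarith) (by
    have : (0 : ℝ) ≤ N := by positivity
    linarith)

variable {n : ℕ} (h : SpinConfig d)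

theorem sampleMean_apply (n : ℕ) (j : Fin d) :
    sampleMean h n j = (1 / (n : ℝ)) * ∑ i ∈ Finset.range n, h i j := by
  simp [sampleMean]

theorem sum_sub_sampleMean (hn : n ≠ 0) (j : Fin d) :
    ∑ i : Fin n, (h i j - sampleMean h n j) = 0 := by
  rw [Finset.sum_sub_distrib, sampleMean_apply, Finset.sum_range]
  simp
  field_simp
  simp

theorem sampleStd_sq (hn : n ≠ 0) (j : Fin d) :
    n * (sampleStd h n j) ^ 2 = ∑ i : Fin n, (h i j - sampleMean h n j) ^ 2 := by
  have hn' : (n : ℝ) ≠ 0 := by exact_mod_cast hn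
  have key : (1 / (n : ℝ)) * ∑ i ∈ Finset.range n, (h i j) ^ 2 - (sampleMean h n j) ^ 2 =
      (1 / (n : ℝ)) * ∑ i : Fin n, (h i j - sampleMean h n j) ^ 2 := by
    have e : ∑ i : Fin n, (h i j - sampleMean h n j) ^ 2 =
        ∑ i : Fin n, (h i j) ^ 2 - n * (sampleMean h n j) ^ 2 := by
      have : ∀ i : Fin n, (h i j - sampleMean h n j) ^ 2 =
          (h i j) ^ 2 - sampleMean h n j ^ 2 - 2 * sampleMean h n j * (h i j - sampleMean h n j) :=
        fun i => by ring
      simp_rw [this, Finset.sum_sub_distrib, ← Finset.mul_sum, sum_sub_sampleMean h hn]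
      simp
    rw [e, Finset.sum_range]
    field_simp
  have h1 : sampleStd h n j =
      √((1 / (n : ℝ)) * ∑ i ∈ Finset.range n, (h i j) ^ 2 - (sampleMean h n j) ^ 2) := rfl
  rw [h1, key, Real.sq_sqrt (mul_nonneg (by positivity) (Finset.sum_nonneg fun i _ => sq_nonneg _))]
  field_simp

theorem norm_sampleStd_sq (hn : n ≠ 0) :
    n * ‖sampleStd h n‖ ^ 2 = ∑ i : Fin n, ∑ j, (h i j - sampleMean h n j) ^ 2 := by
  rw [EuclideanSpace.real_norm_sq_eq, Finset.mul_sum, Finset.sum_comm]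
  exact Finset.sum_congr rfl fun j _ => sampleStd_sq h hn j

/-- The configuration on the sphere with coordinates `w` along the constant configurations and the
centred external field. -/
def fieldMap (n : ℕ) : SpinVec d × ℝ →ₗ[ℝ] EuclideanSpace ℝ (Fin n × Fin d) where
  toFun w := WithLp.toLp 2 fun p =>
    (w.1 p.2 + w.2 * ((h p.1 p.2 - sampleMean h n p.2) / ‖sampleStd h n‖)) / √n
  map_add' v w := by ext p; simp; ring
  map_smul' c w := by ext p; simp; ring

theorem fieldMap_apply (w : SpinVec d × ℝ) (p : Fin n × Fin d) : fieldMap h n w p =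
    (w.1 p.2 + w.2 * ((h p.1 p.2 - sampleMean h n p.2) / ‖sampleStd h n‖)) / √n := rfl

theorem sum_fieldMap (hn : n ≠ 0) (w : SpinVec d × ℝ) (j : Fin d) :
    ∑ i : Fin n, fieldMap h n w (i, j) = √n * w.1 j := by
  have hn' : (0 : ℝ) < n := by positivity
  simp_rw [fieldMap_apply, ← Finset.sum_div, Finset.sum_add_distrib, ← Finset.mul_sum,
    ← Finset.sum_div, sum_sub_sampleMean h hn]
  simp
  rw [mul_div_right_comm, Real.div_sqrt]

theorem sum_fieldMap_mul (hn : n ≠ 0) (hσ : 0 < ‖sampleStd h n‖) (w : SpinVec d × ℝ) :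
    ∑ p : Fin n × Fin d, fieldMap h n w p * (h p.1 p.2 - sampleMean h n p.2) =
      √n * (w.2 * ‖sampleStd h n‖) := by
  have hn' : (0 : ℝ) < n := by positivity
  have e : ∀ p : Fin n × Fin d, fieldMap h n w p * (h p.1 p.2 - sampleMean h n p.2) =
      w.1 p.2 * (h p.1 p.2 - sampleMean h n p.2) / √n +
        w.2 / ‖sampleStd h n‖ / √n * (h p.1 p.2 - sampleMean h n p.2) ^ 2 := by
    intro p; rw [fieldMap_apply]; field_simp
  simp_rw [e, Finset.sum_add_distrib, ← Finset.mul_sum, ← Finset.sum_div]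
  have h1 : ∑ p : Fin n × Fin d, w.1 p.2 * (h p.1 p.2 - sampleMean h n p.2) = 0 := by
    rw [Fintype.sum_prod_type_right]
    refine Finset.sum_eq_zero fun j _ => ?_
    change ∑ i : Fin n, w.1 j * (h i j - sampleMean h n j) = 0
    rw [← Finset.mul_sum, sum_sub_sampleMean h hn, mul_zero]
  rw [h1, Fintype.sum_prod_type, ← norm_sampleStd_sq h hn, zero_div, zero_add]
  have : (n : ℝ) = √n * √n := (Real.mul_self_sqrt hn'.le).symm
  have := Real.sqrt_pos.2 hn'
  field_simp
  rw [Real.sq_sqrt hn'.le]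

theorem inner_fieldMap (w : SpinVec d × ℝ) (g : EuclideanSpace ℝ (Fin n × Fin d)) :
    inner ℝ (fieldMap h n w) g = (∑ j, w.1 j * ∑ i, g (i, j) +
      w.2 / ‖sampleStd h n‖ * ∑ p : Fin n × Fin d, g p * (h p.1 p.2 - sampleMean h n p.2)) / √n := by
  have e : ∀ p : Fin n × Fin d, inner ℝ (fieldMap h n w p) (g p) =
     (w.1 p.2 * g p + w.2 / ‖sampleStd h n‖ * (g p * (h p.1 p.2 - sampleMean h n p.2))) / √n := by
    intro p
    rw [fieldMap_apply]
    simp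
    ring
  rw [PiLp.inner_apply]
  simp_rw [e]
  rw [← Finset.sum_div, Finset.sum_add_distrib, ← Finset.mul_sum, Fintype.sum_prod_type_right]
  simp_rw [Finset.mul_sum]

/-- Constants are orthogonal to the centred field, and the factors 1/√n and 1/‖s_n‖ normalize both,
so `fieldMap` is isometric for the Euclidean structure on the coordinates. -/
theorem norm_fieldMap_sq (hn : n ≠ 0) (hσ : 0 < ‖sampleStd h n‖) (w : SpinVec d × ℝ) :
    ‖fieldMap h n w‖ ^ 2 = fieldSq w := by
  have hn' : (0 : ℝ) < n := by positivity
  have := Real.sqrt_pos.2 hn'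
  rw [← real_inner_self_eq_norm_sq, inner_fieldMap]
  simp_rw [sum_fieldMap h hn, sum_fieldMap_mul h hn hσ]
  rw [fieldSq, EuclideanSpace.real_norm_sq_eq]
  have : ∑ j, w.1 j * (√n * w.1 j) = √n * ∑ j, w.1 j ^ 2 := by
    rw [Finset.mul_sum]; exact Finset.sum_congr rfl fun j _ => by ring
  rw [this]
  field_simp

theorem fieldMap_injective (hn : n ≠ 0) (hσ : 0 < ‖sampleStd h n‖) :
    Function.Injective (fieldMap h n) := by
  rw [injective_iff_map_eq_zero]
  intro w hw
  have h1 := norm_fieldMap_sq h hn hσ w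
  rw [hw, norm_zero, fieldSq] at h1
  have h2 : ‖w.1‖ = 0 := by nlinarith [sq_nonneg ‖w.1‖, sq_nonneg w.2]
  have h3 : w.2 = 0 := by nlinarith [sq_nonneg ‖w.1‖, sq_nonneg w.2]
  exact Prod.ext (norm_eq_zero.1 h2) h3

/-- The span of the constant configurations and the centred external field. -/
def fieldSpan (n : ℕ) : Submodule ℝ (EuclideanSpace ℝ (Fin n × Fin d)) :=
  LinearMap.range (fieldMap h n)

/-- The coordinates `w` of the subspace `fieldSpan`. -/
def fieldEquiv (hn : n ≠ 0) (hσ : 0 < ‖sampleStd h n‖) : (SpinVec d × ℝ) ≃L[ℝ] fieldSpan h n :=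
  (LinearEquiv.ofInjective (fieldMap h n) (fieldMap_injective h hn hσ)).toContinuousLinearEquiv

theorem coe_fieldEquiv (hn : n ≠ 0) (hσ : 0 < ‖sampleStd h n‖) (w : SpinVec d × ℝ) :
    (fieldEquiv h hn hσ w : EuclideanSpace ℝ (Fin n × Fin d)) = fieldMap h n w := rfl

theorem inner_fieldMap_of_mem_orthogonal (w : SpinVec d × ℝ)
    {g : EuclideanSpace ℝ (Fin n × Fin d)} (hg : g ∈ (fieldSpan h n)ᗮ) :
    inner ℝ (fieldMap h n w) g = 0 :=
  Submodule.inner_right_of_mem_orthogonal (LinearMap.mem_range_self _ w) hg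

theorem sum_eq_zero_of_mem_orthogonal (hn : n ≠ 0) {g : EuclideanSpace ℝ (Fin n × Fin d)}
    (hg : g ∈ (fieldSpan h n)ᗮ) (j : Fin d) : ∑ i, g (i, j) = 0 := by
  have h1 := inner_fieldMap_of_mem_orthogonal h (EuclideanSpace.single j 1, 0) hg
  have hn' : (√n : ℝ) ≠ 0 := by positivity
  rw [inner_fieldMap, div_eq_zero_iff] at h1
  simpa [hn'] using h1

theorem sum_mul_eq_zero_of_mem_orthogonal (hn : n ≠ 0) (hσ : 0 < ‖sampleStd h n‖)
    {g : EuclideanSpace ℝ (Fin n × Fin d)} (hg : g ∈ (fieldSpan h n)ᗮ) :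
    ∑ p : Fin n × Fin d, g p * (h p.1 p.2 - sampleMean h n p.2) = 0 := by
  have h1 := inner_fieldMap_of_mem_orthogonal h (0, 1) hg
  have hn' : (√n : ℝ) ≠ 0 := by positivity
  rw [inner_fieldMap, div_eq_zero_iff] at h1
  simp only [hn', or_false] at h1
  simpa [hσ.ne'] using h1

theorem nontrivial_fieldSpan_orthogonal (hn : n ≠ 0) (hσ : 0 < ‖sampleStd h n‖)
    (hnd : d + 1 < n * d) : Nontrivial (fieldSpan h n)ᗮ := by
  have h1 := (fieldSpan h n).finrank_add_finrank_orthogonal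
  rw [← (fieldEquiv h hn hσ).toLinearEquiv.finrank_eq] at h1
  simp at h1
  exact Module.nontrivial_of_finrank_pos (R := ℝ) (by omega)

end FieldCoordinates

/-! ### The energy as a function of the field coordinates -/

section Energy

variable {d n : ℕ} (h : SpinConfig d)

theorem spinEnergy_eq (φ : SpinConfig d) :
    spinEnergy n h φ = -(1 / (2 * (n : ℝ))) * ∑ j, (∑ i : Fin n, φ i j) ^ 2 -
      ∑ p : Fin n × Fin d, h p.1 p.2 * φ p.1 p.2 := by
  unfold spinEnergy
  congr 1
  · congr 1
    have : ∑ i ∈ Finset.range n, ∑ j ∈ Finset.range n, inner ℝ (φ i) (φ j) =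
        ‖∑ i ∈ Finset.range n, φ i‖ ^ 2 := by
      rw [← real_inner_self_eq_norm_sq, sum_inner]
      simp_rw [inner_sum]
    rw [this, EuclideanSpace.real_norm_sq_eq]
    simp [Finset.sum_range]
  · rw [Finset.sum_range, Fintype.sum_prod_type]
    refine Finset.sum_congr rfl fun i _ => ?_
    rw [PiLp.inner_apply]
    exact Finset.sum_congr rfl fun j _ => by simp [mul_comm]

theorem scaledConfig_apply (Ω : EuclideanSpace ℝ (Fin n × Fin d)) (i : Fin n) (j : Fin d) :
    scaledConfig n Ω i j = √n * Ω (i, j) := by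
  simp [scaledConfig]

/-- The energy density of the sites in the coordinates `w`. -/
def fieldEnergy (β : ℝ) (m : SpinVec d) (σ : ℝ) (w : SpinVec d × ℝ) : ℝ :=
  β * (‖radialFactor w • w.1‖ ^ 2 / 2 + inner ℝ m (radialFactor w • w.1) +
    σ * (radialFactor w * w.2))

/-- The interaction sees only the total spin. The external field is its mean plus its centred part.
A vector orthogonal to the constants and to the centred field contributes to neither, so g drops
out. -/
theorem spinEnergy_scaledConfig (hn : n ≠ 0) (hσ : 0 < ‖sampleStd h n‖) (β : ℝ)
    (w : SpinVec d × ℝ) {g : EuclideanSpace ℝ (Fin n × Fin d)} (hg : g ∈ (fieldSpan h n)ᗮ) :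
    -β * spinEnergy n h (scaledConfig n (radialFactor w • (fieldMap h n w + g))) =
      n * fieldEnergy β (sampleMean h n) ‖sampleStd h n‖ w := by
  have hn' : (0 : ℝ) < n := by positivity
  have hsq : √(n : ℝ) ^ 2 = n := Real.sq_sqrt hn'.le
  rw [spinEnergy_eq h]
  simp_rw [scaledConfig_apply]
  set ρ := radialFactor w
  have h1 : ∀ j, ∑ i : Fin n, √n * (ρ • (fieldMap h n w + g)) (i, j) = n * (ρ * w.1 j) := by
    intro j
    rw [← Finset.mul_sum]
    simp only [PiLp.smul_apply, PiLp.add_apply, smul_eq_mul]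
    rw [← Finset.mul_sum, Finset.sum_add_distrib, sum_fieldMap h hn,
      sum_eq_zero_of_mem_orthogonal h hn hg]
    linear_combination (ρ * w.1 j) * hsq
  have h2 : ∑ p : Fin n × Fin d, h p.1 p.2 * (√n * (ρ • (fieldMap h n w + g)) (p.1, p.2)) =
      n * (∑ j, sampleMean h n j * (ρ * w.1 j)) + n * (‖sampleStd h n‖ * (ρ * w.2)) := by
    have e : ∀ p : Fin n × Fin d, h p.1 p.2 * (√n * (ρ • (fieldMap h n w + g)) (p.1, p.2)) =
        sampleMean h n p.2 * (√n * (ρ • (fieldMap h n w + g)) (p.1, p.2)) +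
        √n * ρ * (fieldMap h n w p * (h p.1 p.2 - sampleMean h n p.2)) +
        √n * ρ * (g p * (h p.1 p.2 - sampleMean h n p.2)) := by
      intro p
      simp only [PiLp.smul_apply, PiLp.add_apply, smul_eq_mul]
      ring
    simp_rw [e, Finset.sum_add_distrib, ← Finset.mul_sum, sum_fieldMap_mul h hn hσ,
      sum_mul_eq_zero_of_mem_orthogonal h hn hσ hg]
    have h3 : ∑ p : Fin n × Fin d, sampleMean h n p.2 *
        (√n * (ρ • (fieldMap h n w + g)) (p.1, p.2)) =
        n * ∑ j, sampleMean h n j * (ρ * w.1 j) := by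
      rw [Fintype.sum_prod_type_right, Finset.mul_sum]
      refine Finset.sum_congr rfl fun j _ => ?_
      change ∑ i : Fin n, sampleMean h n j * (√n * (ρ • (fieldMap h n w + g)) (i, j)) = _
      rw [← Finset.mul_sum, h1]
      ring
    rw [h3]
    linear_combination (‖sampleStd h n‖ * (ρ * w.2)) * hsq
  simp_rw [h1, h2]
  unfold fieldEnergy
  rw [EuclideanSpace.real_norm_sq_eq, PiLp.inner_apply]
  simp only [PiLp.smul_apply, smul_eq_mul, mul_pow, ← Finset.mul_sum]
  have : ∑ j, inner ℝ (sampleMean h n j) (ρ * w.1 j) = ∑ j, sampleMean h n j * (ρ * w.1 j) :=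
    Finset.sum_congr rfl fun j _ => by simp [mul_comm]
  rw [this]
  field_simp
  ring

end Energy

/-! ### One Gaussian field for all volumes -/

section GaussianField

/-- Pairing the projection with t ∈ K is pairing the vector itself with t, so the characteristic
functions agree. This realizes the transverse Gaussians of every volume on one probability space. -/
theorem map_orthogonalProjectionOnto_stdGaussian {E : Type*} [NormedAddCommGroup E]
    [InnerProductSpace ℝ E] [FiniteDimensional ℝ E] [MeasurableSpace E] [BorelSpace E]
    (K : Submodule ℝ E) :
    (stdGaussian E).map K.orthogonalProjectionOnto = stdGaussian K := by
  have hm : Measurable K.orthogonalProjectionOnto := K.orthogonalProjectionOnto.continuous.measurable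
  have : IsFiniteMeasure ((stdGaussian E).map K.orthogonalProjectionOnto) := inferInstance
  apply Measure.ext_of_charFun
  ext t
  rw [charFun_stdGaussian, charFun_apply, integral_map hm.aemeasurable (by fun_prop)]
  simp_rw [Submodule.inner_orthogonalProjectionOnto_eq_of_mem_right]
  rw [← charFun_apply, charFun_stdGaussian, Submodule.coe_norm]

variable {d : ℕ}

/-- The law of independent standard Gaussians indexed by sites and components. -/
abbrev gaussianField (d : ℕ) : Measure (ℕ × Fin d → ℝ) :=
  Measure.infinitePi fun _ : ℕ × Fin d => gaussianReal 0 1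

/-- The restriction of a field to the first `n` sites. -/
def restrictField (n : ℕ) (G : ℕ × Fin d → ℝ) : EuclideanSpace ℝ (Fin n × Fin d) :=
  WithLp.toLp 2 fun p => G (p.1, p.2)

@[fun_prop]
theorem measurable_restrictField (n : ℕ) : Measurable (restrictField (d := d) n) := by
  unfold restrictField
  fun_prop

theorem iIndepFun_gaussianField :
    iIndepFun (fun (p : ℕ × Fin d) (G : ℕ × Fin d → ℝ) => G p) (gaussianField d) :=
  iIndepFun_infinitePi (P := fun _ : ℕ × Fin d => gaussianReal 0 1) (X := fun _ x => x)
    (fun _ => measurable_id)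

theorem map_eval_gaussianField (p : ℕ × Fin d) :
    (gaussianField d).map (fun G => G p) = gaussianReal 0 1 :=
  (measurePreserving_eval_infinitePi (fun _ : ℕ × Fin d => gaussianReal 0 1) p).map_eq

theorem map_restrictField (n : ℕ) :
    (gaussianField d).map (restrictField n) = stdGaussian (EuclideanSpace ℝ (Fin n × Fin d)) := by
  have hinj : Function.Injective (fun p : Fin n × Fin d => ((p.1 : ℕ), p.2)) := by
    rintro ⟨i, j⟩ ⟨i', j'⟩ h
    simp only [Prod.mk.injEq] at h
    exact Prod.ext (Fin.ext h.1) h.2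
  have h1 := (iIndepFun_gaussianField (d := d)).precomp hinj
  rw [iIndepFun_iff_map_fun_eq_pi_map (fun p => (measurable_pi_apply _).aemeasurable)] at h1
  simp_rw [map_eval_gaussianField] at h1
  rw [← map_pi_eq_stdGaussian, ← h1, Measure.map_map (by fun_prop) (by fun_prop)]
  rfl

end GaussianField

/-! ### The Gibbs state in field coordinates -/

section Representation

variable {d n : ℕ} (h : SpinConfig d)

/-- The direction of the component of a field orthogonal to the constant configurations and the
external field. -/
def transverseDirection (n : ℕ) (G : ℕ × Fin d → ℝ) : EuclideanSpace ℝ (Fin n × Fin d) :=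
  ‖(fieldSpan h n)ᗮ.orthogonalProjectionOnto (restrictField n G)‖⁻¹ •
    ((fieldSpan h n)ᗮ.orthogonalProjectionOnto (restrictField n G) : EuclideanSpace ℝ (Fin n × Fin d))

theorem transverseDirection_mem (n : ℕ) (G : ℕ × Fin d → ℝ) :
    transverseDirection h n G ∈ (fieldSpan h n)ᗮ :=
  Submodule.smul_mem _ _ (Subtype.mem _)

@[fun_prop]
theorem measurable_transverseDirection (n : ℕ) : Measurable (transverseDirection h n) := by
  have := ((fieldSpan h n)ᗮ.orthogonalProjectionOnto).continuous.measurable.comp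
    (measurable_restrictField (d := d) n)
  exact (this.norm.inv).smul (measurable_subtype_coe.comp this)

/-- The point of the unit sphere with field coordinates `w` and transverse direction from `G`. -/
def sphereMap (n : ℕ) (p : (SpinVec d × ℝ) × (ℕ × Fin d → ℝ)) :
    EuclideanSpace ℝ (Fin n × Fin d) :=
  radialFactor p.1 • (fieldMap h n p.1 + transverseDirection h n p.2)

@[fun_prop]
theorem measurable_sphereMap (n : ℕ) : Measurable (sphereMap h n) := by
  unfold sphereMap
  fun_prop

/-- The a priori measure of the field coordinates. -/
def fieldMeasure (d N : ℕ) : Measure (SpinVec d × ℝ) :=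
  (volume : Measure (SpinVec d × ℝ)).withDensity fun w => ENNReal.ofReal (radialFactor w ^ N)

theorem isFiniteMeasure_fieldMeasure {N : ℕ} (hN : d + 1 < N) :
    IsFiniteMeasure (fieldMeasure d N) :=
  isFiniteMeasure_withDensity (integrable_radialFactor_pow hN).lintegral_lt_top.ne

/-- `exists_lintegral_toSphere_eq` for W = `fieldSpan h n`. The condition `hnd` makes the complement
nonzero and ρ^{nd} integrable. -/
theorem exists_map_toSphere_eq (hn : n ≠ 0) (hσ : 0 < ‖sampleStd h n‖) (hnd : d + 1 < n * d) :
    ∃ c : ℝ≥0∞, c ≠ 0 ∧ c ≠ ∞ ∧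
      ((volume : Measure (EuclideanSpace ℝ (Fin n × Fin d))).toSphere).map (↑) =
        c • ((fieldMeasure d (n * d)).prod (gaussianField d)).map (sphereMap h n) := by
  have := nontrivial_fieldSpan_orthogonal h hn hσ hnd
  have hE : Nontrivial (EuclideanSpace ℝ (Fin n × Fin d)) :=
    Module.nontrivial_of_finrank_pos (R := ℝ) (by
      rw [finrank_euclideanSpace, Fintype.card_prod, Fintype.card_fin, Fintype.card_fin]
      omega)
  have := isFiniteMeasure_fieldMeasure hnd
  have hq : ∀ w, ‖fieldEquiv h hn hσ w‖ ^ 2 = fieldSq w := fun w => by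
    rw [Submodule.coe_norm, coe_fieldEquiv, norm_fieldMap_sq h hn hσ]
  have hd : ∀ w : SpinVec d × ℝ, (√(1 + fieldSq w) ^ Module.finrank ℝ (EuclideanSpace ℝ (Fin n × Fin d)))⁻¹ =
      radialFactor w ^ (n * d) := fun w => by simp [radialFactor]
  obtain ⟨c, hc, hc', hF⟩ := exists_lintegral_toSphere_eq (fieldSpan h n) (fieldEquiv h hn hσ)
    (volume : Measure (SpinVec d × ℝ)) (by
      simp_rw [hq, hd]
      exact (integrable_radialFactor_pow hnd).lintegral_lt_top.ne)
  simp_rw [hq, hd] at hF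
  refine ⟨c, hc, hc', Measure.ext_of_lintegral _ fun F hFm => ?_⟩
  rw [lintegral_map hFm measurable_subtype_coe, hF F hFm, lintegral_smul_measure,
    lintegral_map hFm (by fun_prop), lintegral_prod _ (by fun_prop), fieldMeasure,
    lintegral_withDensity_eq_lintegral_mul _ (by fun_prop) (by fun_prop), smul_eq_mul]
  congr 1
  refine lintegral_congr fun w => ?_
  rw [Pi.mul_apply]
  congr 1
  rw [← map_orthogonalProjectionOnto_stdGaussian, ← map_restrictField,
    Measure.map_map (by fun_prop) (by fun_prop), lintegral_map (by fun_prop) (by fun_prop)]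
  rfl

/-- The expectation of `f` with respect to the transverse directions, at given coordinates `w`. -/
def transverseMean (n : ℕ) (f : SpinConfig d → ℝ) (w : SpinVec d × ℝ) : ℝ :=
  ∫ G, f (scaledConfig n (sphereMap h n (w, G))) ∂gaussianField d

/-- The unnormalized density of the field coordinates under the Gibbs state. -/
def fieldDensity (β : ℝ) (n : ℕ) (w : SpinVec d × ℝ) : ℝ :=
  radialFactor w ^ (n * d) * Real.exp (n * fieldEnergy β (sampleMean h n) ‖sampleStd h n‖ w)

theorem norm_radialFactor_smul_le (w : SpinVec d × ℝ) : ‖radialFactor w • w.1‖ ≤ 1 := by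
  have h1 := radialFactor_sq w
  have h2 := radialFactor_pos w
  rw [norm_smul, Real.norm_of_nonneg h2.le, ← abs_of_nonneg (mul_nonneg h2.le (norm_nonneg w.1)),
    ← sq_le_one_iff_abs_le_one]
  unfold fieldSq at h1
  nlinarith [mul_nonneg (sq_nonneg (radialFactor w)) (sq_nonneg w.2), sq_nonneg (radialFactor w)]

theorem abs_radialFactor_mul_le (w : SpinVec d × ℝ) : |radialFactor w * w.2| ≤ 1 := by
  have h1 := radialFactor_sq w
  rw [← sq_le_one_iff_abs_le_one]
  unfold fieldSq at h1
  nlinarith [mul_nonneg (sq_nonneg (radialFactor w)) (sq_nonneg ‖w.1‖), sq_nonneg (radialFactor w)]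

theorem continuous_fieldEnergy (β : ℝ) (m : SpinVec d) (σ : ℝ) :
    Continuous (fieldEnergy β m σ) := by
  have := continuous_radialFactor (d := d)
  unfold fieldEnergy
  fun_prop

theorem abs_fieldEnergy_le (β : ℝ) (m : SpinVec d) (σ : ℝ) (w : SpinVec d × ℝ) :
    |fieldEnergy β m σ w| ≤ |β| * (1 / 2 + ‖m‖ + |σ|) := by
  have h1 := norm_radialFactor_smul_le w
  have h2 := abs_radialFactor_mul_le w
  have h3 := abs_real_inner_le_norm m (radialFactor w • w.1)
  rw [fieldEnergy, abs_mul]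
  refine mul_le_mul_of_nonneg_left ?_ (abs_nonneg β)
  refine (abs_add_le _ _).trans (add_le_add ((abs_add_le _ _).trans (add_le_add ?_ ?_)) ?_)
  · rw [abs_of_nonneg (by positivity)]
    nlinarith [norm_nonneg (radialFactor w • w.1)]
  · exact h3.trans (mul_le_of_le_one_right (norm_nonneg m) h1)
  · rw [abs_mul]
    exact mul_le_of_le_one_right (abs_nonneg σ) h2

theorem fieldDensity_pos (β : ℝ) (n : ℕ) (w : SpinVec d × ℝ) : 0 < fieldDensity h β n w :=
  mul_pos (pow_pos (radialFactor_pos w) _) (Real.exp_pos _)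

theorem continuous_fieldDensity (β : ℝ) (n : ℕ) : Continuous (fieldDensity h β n) := by
  have h1 := continuous_radialFactor (d := d)
  have h2 := continuous_fieldEnergy β (sampleMean h n) ‖sampleStd h n‖
  unfold fieldDensity
  fun_prop

theorem integrable_fieldDensity (β : ℝ) (hnd : d + 1 < n * d) :
    Integrable (fieldDensity h β n) := by
  refine ((integrable_radialFactor_pow hnd).mul_const
    (Real.exp (n * (|β| * (1 / 2 + ‖sampleMean h n‖ + |‖sampleStd h n‖|))))).mono'
    (continuous_fieldDensity h β n).aestronglyMeasurable (Eventually.of_forall fun w => ?_)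
  rw [Real.norm_of_nonneg (fieldDensity_pos h β n w).le, fieldDensity]
  have := pow_pos (radialFactor_pos w) (n * d)
  gcongr
  exact (le_abs_self _).trans (abs_fieldEnergy_le _ _ _ _)

theorem integral_fieldDensity_pos (β : ℝ) (hnd : d + 1 < n * d) :
    0 < ∫ w, fieldDensity h β n w := by
  rw [integral_pos_iff_support_of_nonneg (fun w => (fieldDensity_pos h β n w).le)
    (integrable_fieldDensity h β hnd)]
  have : Function.support (fieldDensity h β n) = Set.univ :=
    Set.eq_univ_of_forall fun w => (fieldDensity_pos h β n w).ne'
  rw [this]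
  exact Measure.measure_univ_pos.2 (NeZero.ne _)

/-- The Boltzmann factor depends on w alone and leaves the integral over G; the constant of the
surface measure cancels between numerator and denominator. -/
theorem integral_gibbsState (β : ℝ) (hn : n ≠ 0) (hσ : 0 < ‖sampleStd h n‖)
    (hnd : d + 1 < n * d) {f : SpinConfig d → ℝ} (hf : Continuous f) (hf1 : ∀ φ, |f φ| ≤ 1) :
    ∫ φ, f φ ∂gibbsState β h n =
      (∫ w, fieldDensity h β n w * transverseMean h n f w) / ∫ w, fieldDensity h β n w := by
  obtain ⟨c, hc, hc', hmap⟩ := exists_map_toSphere_eq h hn hσ hnd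
  have := isFiniteMeasure_fieldMeasure hnd
  have hfm : Measurable f := hf.measurable
  have hsc := measurable_scaledConfig (d := d) n
  have hSM : Measurable fun Ω : Metric.sphere (0 : EuclideanSpace ℝ (Fin n × Fin d)) 1 =>
    scaledConfig n Ω.1 := hsc.comp measurable_subtype_coe
  have hE : Measurable fun x : EuclideanSpace ℝ (Fin n × Fin d) =>
      -β * spinEnergy n h (scaledConfig n x) := by
    unfold spinEnergy
    have : ∀ i, Measurable fun x : EuclideanSpace ℝ (Fin n × Fin d) => scaledConfig n x i :=
      fun i => (measurable_pi_apply i).comp hsc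
    fun_prop
  have key : ∀ F : EuclideanSpace ℝ (Fin n × Fin d) → ℝ, Measurable F →
      ∫ Ω, F Ω.1 ∂(volume : Measure (EuclideanSpace ℝ (Fin n × Fin d))).toSphere =
        c.toReal * ∫ p, F (sphereMap h n p) ∂((fieldMeasure d (n * d)).prod (gaussianField d)) := by
    intro F hF
    rw [← integral_map (φ := ((↑) : Metric.sphere (0 : EuclideanSpace ℝ (Fin n × Fin d)) 1 → _))
      measurable_subtype_coe.aemeasurable hF.aestronglyMeasurable, hmap, integral_smul_measure,
      integral_map (by fun_prop) hF.aestronglyMeasurable, smul_eq_mul]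
  have key2 : ∀ F : SpinConfig d → ℝ, Measurable F → (∀ φ, |F φ| ≤ 1) →
      ∫ Ω, Real.exp (-β * spinEnergy n h (scaledConfig n Ω.1)) *
        F (scaledConfig n Ω.1) ∂(volume : Measure (EuclideanSpace ℝ (Fin n × Fin d))).toSphere =
      c.toReal * ∫ w, fieldDensity h β n w * transverseMean h n F w := by
    intro F hF hF1
    rw [key (fun x => Real.exp (-β * spinEnergy n h (scaledConfig n x)) * F (scaledConfig n x))
      (by fun_prop)]
    congr 1
    have e : ∀ p : (SpinVec d × ℝ) × (ℕ × Fin d → ℝ),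
        Real.exp (-β * spinEnergy n h (scaledConfig n (sphereMap h n p))) =
        Real.exp (n * fieldEnergy β (sampleMean h n) ‖sampleStd h n‖ p.1) := fun p => by
      rw [sphereMap, spinEnergy_scaledConfig h hn hσ β p.1 (transverseDirection_mem h n p.2)]
    simp_rw [e]
    have hEm := (continuous_fieldEnergy β (sampleMean h n) ‖sampleStd h n‖).measurable
    rw [integral_prod]
    · simp_rw [integral_const_mul]
      rw [fieldMeasure, integral_withDensity_eq_integral_toReal_smul (by fun_prop) (by simp)]
      refine integral_congr_ae (Eventually.of_forall fun w => ?_)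
      simp only
      rw [ENNReal.toReal_ofReal (pow_nonneg (radialFactor_pos w).le _), smul_eq_mul, ← mul_assoc]
      rfl
    · refine Integrable.of_bound (Measurable.aestronglyMeasurable (by fun_prop))
        (Real.exp (n * (|β| * (1 / 2 + ‖sampleMean h n‖ + |‖sampleStd h n‖|))))
        (Eventually.of_forall fun p => ?_)
      rw [norm_mul, Real.norm_of_nonneg (Real.exp_pos _).le, Real.norm_eq_abs]
      refine (mul_le_of_le_one_right (Real.exp_pos _).le (hF1 _)).trans ?_
      gcongr
      exact (le_abs_self _).trans (abs_fieldEnergy_le _ _ _ _)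
  rw [gibbsState, integral_map hSM.aemeasurable hf.aestronglyMeasurable, integral_tilted]
  have e2 := key2 (fun _ => 1) measurable_const (by simp)
  simp only [transverseMean, integral_const, probReal_univ, smul_eq_mul, mul_one] at e2
  simp_rw [smul_eq_mul, div_mul_eq_mul_div, integral_div]
  rw [key2 f hfm hf1, e2]
  have : c.toReal ≠ 0 := (ENNReal.toReal_pos hc hc').ne'
  rw [mul_div_mul_left _ _ this]

end Representation

/-! ### The projection of the Gaussian field to the complement -/

section Projection

variable {d n : ℕ} (h : SpinConfig d)

/-- The coordinates of the projection of a field to the constant configurations and the centred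
external field. -/
def fieldCoeff (n : ℕ) (G : ℕ × Fin d → ℝ) : SpinVec d × ℝ :=
  (WithLp.toLp 2 fun j => (∑ i : Fin n, G (i, j)) / √n,
    (∑ p : Fin n × Fin d, G (p.1, p.2) * (h p.1 p.2 - sampleMean h n p.2)) /
      ‖sampleStd h n‖ / √n)

theorem inner_fieldMap_restrictField (G : ℕ × Fin d → ℝ) (w : SpinVec d × ℝ) :
    inner ℝ (fieldMap h n w) (restrictField n G) =
      ∑ j, w.1 j * (fieldCoeff h n G).1 j + w.2 * (fieldCoeff h n G).2 := by
  rw [inner_fieldMap]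
  simp only [restrictField, fieldCoeff, ← mul_div_assoc, ← Finset.sum_div]
  ring

theorem inner_fieldMap_fieldMap (hn : n ≠ 0) (hσ : 0 < ‖sampleStd h n‖) (w u : SpinVec d × ℝ) :
    inner ℝ (fieldMap h n w) (fieldMap h n u) = ∑ j, w.1 j * u.1 j + w.2 * u.2 := by
  have hn' : (0 : ℝ) < n := by positivity
  have := Real.sqrt_pos.2 hn'
  rw [inner_fieldMap]
  simp_rw [sum_fieldMap h hn, sum_fieldMap_mul h hn hσ]
  have : ∑ j, w.1 j * (√n * u.1 j) = √n * ∑ j, w.1 j * u.1 j := by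
    rw [Finset.mul_sum]; exact Finset.sum_congr rfl fun j _ => by ring
  rw [this]
  field_simp

/-- By isometry, the restricted field and its candidate projection have the same inner product with
every element of `fieldSpan h n`. -/
theorem coe_orthogonalProjectionOnto_restrictField (hn : n ≠ 0) (hσ : 0 < ‖sampleStd h n‖)
    (G : ℕ × Fin d → ℝ) :
    ((fieldSpan h n)ᗮ.orthogonalProjectionOnto (restrictField n G) :
      EuclideanSpace ℝ (Fin n × Fin d)) =
      restrictField n G - fieldMap h n (fieldCoeff h n G) := by
  have h1 : (fieldSpan h n).starProjection (restrictField n G) =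
      fieldMap h n (fieldCoeff h n G) := by
    refine Submodule.eq_starProjection_of_mem_orthogonal (LinearMap.mem_range_self _ _) ?_
    rw [Submodule.mem_orthogonal]
    rintro _ ⟨w, rfl⟩
    rw [inner_sub_right, inner_fieldMap_restrictField, inner_fieldMap_fieldMap h hn hσ, sub_self]
  rw [Submodule.orthogonalProjectionOnto_orthogonal, ← h1]

theorem norm_orthogonalProjectionOnto_restrictField_sq (hn : n ≠ 0) (hσ : 0 < ‖sampleStd h n‖)
    (G : ℕ × Fin d → ℝ) :
    ‖(fieldSpan h n)ᗮ.orthogonalProjectionOnto (restrictField n G)‖ ^ 2 =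
      ∑ j, ∑ i : Fin n, G (i, j) ^ 2 - fieldSq (fieldCoeff h n G) := by
  rw [Submodule.coe_norm, coe_orthogonalProjectionOnto_restrictField h hn hσ, norm_sub_sq_real,
    norm_fieldMap_sq h hn hσ, real_inner_comm, inner_fieldMap_restrictField,
    EuclideanSpace.real_norm_sq_eq, Fintype.sum_prod_type_right]
  have : ∑ j, (fieldCoeff h n G).1 j * (fieldCoeff h n G).1 j +
      (fieldCoeff h n G).2 * (fieldCoeff h n G).2 = fieldSq (fieldCoeff h n G) := by
    rw [fieldSq, EuclideanSpace.real_norm_sq_eq]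
    simp_rw [← sq]
  rw [this]
  simp only [restrictField]
  ring

end Projection

/-! ### Almost sure limit of the transverse direction -/

section GaussianLimits

variable {d : ℕ}

theorem integrable_pow_gaussianReal (k : ℕ) : Integrable (fun x : ℝ => x ^ k) (gaussianReal 0 1) := by
  by_cases hk : k = 0
  · simp [hk]
  · have h1 := (memLp_id_gaussianReal (μ := 0) (v := 1) (k : ℝ≥0)).integrable_norm_pow
    have h2 := h1 hk
    exact h2.mono' (by fun_prop) (Eventually.of_forall fun x => by simp)

theorem integral_sq_gaussianReal : ∫ x : ℝ, x ^ 2 ∂gaussianReal 0 1 = 1 := by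
  have h1 := variance_fun_id_gaussianReal (μ := 0) (v := 1)
  rw [variance_eq_integral measurable_id'.aemeasurable] at h1
  simpa using h1

theorem ae_tendsto_average_gaussianField {φ : ℝ → ℝ} (hφ : Measurable φ)
    (hi : Integrable φ (gaussianReal 0 1)) (j : Fin d) :
    ∀ᵐ G ∂gaussianField d, Tendsto (fun n : ℕ => (∑ i : Fin n, φ (G (i, j))) / n) atTop
      (𝓝 (∫ x, φ x ∂gaussianReal 0 1)) := by
  have hmp : ∀ i : ℕ, MeasurePreserving (fun G : ℕ × Fin d → ℝ => G (i, j)) (gaussianField d)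
      (gaussianReal 0 1) := fun i =>
    measurePreserving_eval_infinitePi (fun _ : ℕ × Fin d => gaussianReal 0 1) (i, j)
  have h1 := strong_law_ae_real (μ := gaussianField d) (fun i G => φ (G (i, j)))
    ((hmp 0).integrable_comp_of_integrable hi)
    (fun i i' hii' => by
      have := (iIndepFun_gaussianField (d := d)).indepFun (i := (i, j)) (j := (i', j))
        (by simpa using hii')
      exact this.comp hφ hφ)
    (fun i => by
      have : IdentDistrib (fun G : ℕ × Fin d → ℝ => G (i, j)) (fun G => G (0, j))
        (gaussianField d) (gaussianField d) :=
        ⟨(hmp i).aemeasurable, (hmp 0).aemeasurable, by rw [(hmp i).map_eq, (hmp 0).map_eq]⟩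
      exact this.comp hφ)
  have e : ∫ G, φ (G (0, j)) ∂gaussianField d = ∫ x, φ x ∂gaussianReal 0 1 := by
    rw [← (hmp 0).map_eq, integral_map (hmp 0).aemeasurable hφ.aestronglyMeasurable]
  rw [e] at h1
  filter_upwards [h1] with G hG
  simpa only [Finset.sum_range] using hG

variable (h : SpinConfig d)

/-- The coefficient is the inner product with the unit vector `fieldMap h n (0, 1)`. -/
theorem map_fieldCoeff_snd {n : ℕ} (hn : n ≠ 0) (hσ : 0 < ‖sampleStd h n‖) :
    (gaussianField d).map (fun G => (fieldCoeff h n G).2) = gaussianReal 0 1 := by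
  set v := fieldMap h n (0, 1)
  have hv : ‖v‖ = 1 := by
    have h1 := norm_fieldMap_sq h hn hσ (0, 1)
    simp only [fieldSq, norm_zero] at h1
    norm_num at h1
    rcases h1 with h1 | h1
    · exact h1
    · linarith [norm_nonneg v]
  have e : (fun G => (fieldCoeff h n G).2) = (innerSL ℝ v) ∘ (restrictField n) := by
    ext G
    have := inner_fieldMap_restrictField h (n := n) G (0, 1)
    simp only [PiLp.zero_apply, zero_mul, Finset.sum_const_zero, one_mul, zero_add] at this
    simp only [Function.comp_apply, innerSL_apply_apply]
    exact this.symm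
  rw [e, ← Measure.map_map (by fun_prop) (by fun_prop), map_restrictField,
    IsGaussian.map_eq_gaussianReal, integral_strongDual_stdGaussian, variance_dual_stdGaussian,
    innerSL_apply_norm, hv]
  simp

/-- The weights vary with n, so the strong law for averages does not apply directly. Each
coefficient is standard normal, so the fourth power of the quotient has mean M/n². This is summable,
whereas second moments would only give 1/n. Summability forces almost sure convergence. -/
theorem ae_tendsto_fieldCoeff_snd (hσ : ∀ᶠ n in atTop, 0 < ‖sampleStd h n‖) :
    ∀ᵐ G ∂gaussianField d, Tendsto (fun n : ℕ => (fieldCoeff h n G).2 / √n) atTop (𝓝 0) := by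
  classical
  set M := ∫ x : ℝ, x ^ 4 ∂gaussianReal 0 1
  have hM : 0 ≤ M := integral_nonneg fun x => by positivity
  -- The value 0 covers the finitely many n for which the coefficient may fail to be standard
  -- normal.
  let a : ℕ → (ℕ × Fin d → ℝ) → ℝ := fun n G =>
    if n ≠ 0 ∧ 0 < ‖sampleStd h n‖ then (fieldCoeff h n G).2 ^ 4 / n ^ 2 else 0
  have hm : ∀ n, Measurable fun G : ℕ × Fin d → ℝ => (fieldCoeff h n G).2 := fun n => by
    unfold fieldCoeff; fun_prop
  have ham : ∀ n, Measurable (a n) := fun n => by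
    have := hm n
    exact Measurable.ite (MeasurableSet.const _) (by fun_prop) measurable_const
  have ha : ∀ n, ∫⁻ G, ENNReal.ofReal (a n G) ∂gaussianField d ≤ ENNReal.ofReal (M / n ^ 2) := by
    intro n
    by_cases hc : n ≠ 0 ∧ 0 < ‖sampleStd h n‖
    · simp only [a, hc, ne_eq, not_false_eq_true, and_self, if_true]
      rw [← lintegral_map (μ := gaussianField d) (g := fun G => (fieldCoeff h n G).2)
        (f := fun x => ENNReal.ofReal (x ^ 4 / n ^ 2)) (by fun_prop) (hm n),
        map_fieldCoeff_snd h hc.1 hc.2,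
        ← ofReal_integral_eq_lintegral_ofReal ((integrable_pow_gaussianReal 4).div_const _)
          (Eventually.of_forall fun x => by positivity), integral_div]
    · simp only [a, if_neg hc, ENNReal.ofReal_zero, lintegral_const, zero_mul, zero_le]
  have hsum : ∫⁻ G, ∑' n, ENNReal.ofReal (a n G) ∂gaussianField d ≠ ∞ := by
    rw [lintegral_tsum fun n => (ham n).ennreal_ofReal.aemeasurable]
    refine ne_top_of_le_ne_top ?_ (ENNReal.tsum_le_tsum ha)
    have : Summable fun n : ℕ => M / (n : ℝ) ^ 2 := by
      simpa [div_eq_mul_inv] using (Real.summable_one_div_nat_pow.2 one_lt_two).mul_left M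
    rw [← ENNReal.ofReal_tsum_of_nonneg (fun n => by positivity) this]
    exact ENNReal.ofReal_ne_top
  have hae := ae_lt_top (Measurable.tsum fun n => (ham n).ennreal_ofReal) hsum
  filter_upwards [hae] with G hG
  have h1 := ENNReal.tendsto_atTop_zero_of_tsum_ne_top hG.ne
  have h2 : Tendsto (fun n => a n G) atTop (𝓝 0) := by
    have := (ENNReal.tendsto_toReal ENNReal.zero_ne_top).comp h1
    refine this.congr fun n => ?_
    simp only [Function.comp_apply]
    rw [ENNReal.toReal_ofReal]
    simp only [a]; split_ifs <;> positivity
  have h3 : Tendsto (fun n : ℕ => ((fieldCoeff h n G).2 / √n) ^ 4) atTop (𝓝 0) := by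
    refine h2.congr' ?_
    filter_upwards [hσ, eventually_ne_atTop 0] with n hn hn0
    simp only [a, hn, hn0, ne_eq, not_false_eq_true, and_self, if_true, div_pow]
    congr 1
    rw [show (√(n : ℝ)) ^ 4 = (√(n : ℝ) ^ 2) ^ 2 by ring, Real.sq_sqrt (Nat.cast_nonneg n)]
  rw [tendsto_zero_iff_abs_tendsto_zero]
  have h4 := h3.sqrt.sqrt
  simp only [Real.sqrt_zero] at h4
  refine h4.congr fun n => ?_
  simp only [Function.comp_apply]
  rw [show ((fieldCoeff h n G).2 / √n) ^ 4 = (((fieldCoeff h n G).2 / √n) ^ 2) ^ 2 by ring,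
    Real.sqrt_sq (sq_nonneg _), Real.sqrt_sq_eq_abs]

/-- By the strong law, the squared norm of the projected field over n tends to d, since only d + 1
directions are removed and their contribution is o(n). The same bounds make the correction at a
fixed site vanish. -/
theorem ae_tendsto_transverseDirection {s : SpinVec d} (hd : 1 ≤ d)
    (hm : Tendsto (fun n => sampleMean h n) atTop (𝓝 0))
    (hs : Tendsto (fun n => ‖sampleStd h n‖) atTop (𝓝 ‖s‖)) (hs0 : 0 < ‖s‖) :
    ∀ᵐ G ∂gaussianField d, ∀ (i : ℕ) (j : Fin d), Tendsto (fun n : ℕ =>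
      if hi : i < n then √n * transverseDirection h n G (⟨i, hi⟩, j) else 0) atTop
      (𝓝 (G (i, j) / √d)) := by
  have hσ : ∀ᶠ n in atTop, 0 < ‖sampleStd h n‖ := hs.eventually_const_lt hs0
  have hd' : (0 : ℝ) < d := by exact_mod_cast hd
  have a1 := ae_all_iff.2 fun j : Fin d => ae_tendsto_average_gaussianField (d := d)
    (φ := fun x => x) measurable_id' (by simpa using integrable_pow_gaussianReal 1) j
  have a2 := ae_all_iff.2 fun j : Fin d => ae_tendsto_average_gaussianField (d := d)
    (φ := fun x => x ^ 2) (by fun_prop) (integrable_pow_gaussianReal 2) j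
  rw [integral_sq_gaussianReal] at a2
  simp only [integral_id_gaussianReal] at a1
  filter_upwards [a1, a2, ae_tendsto_fieldCoeff_snd h hσ] with G h1 h2 h3 i j
  have hsq : ∀ n : ℕ, √(n : ℝ) * √(n : ℝ) = n := fun n => Real.mul_self_sqrt (Nat.cast_nonneg n)
  have h1' : ∀ j, Tendsto (fun n : ℕ => (fieldCoeff h n G).1 j / √n) atTop (𝓝 0) := by
    intro j
    refine (h1 j).congr fun n => ?_
    simp only [fieldCoeff]
    rw [div_div, hsq]
  have hnorm : Tendsto (fun n : ℕ =>
      ‖(fieldSpan h n)ᗮ.orthogonalProjectionOnto (restrictField n G)‖ ^ 2 / n) atTop (𝓝 d) := by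
    have l1 : Tendsto (fun n : ℕ => ∑ j, (∑ i : Fin n, G (i, j) ^ 2) / n) atTop
        (𝓝 (∑ _j : Fin d, (1 : ℝ))) := tendsto_finsetSum _ fun j _ => h2 j
    have l2 : Tendsto (fun n : ℕ => ∑ j, ((fieldCoeff h n G).1 j / √n) ^ 2) atTop
        (𝓝 (∑ _j : Fin d, (0 : ℝ) ^ 2)) := tendsto_finsetSum _ fun j _ => (h1' j).pow 2
    have l3 := (l1.sub (l2.add (h3.pow 2)))
    simp at l3
    refine l3.congr' ?_
    filter_upwards [hσ, eventually_ne_atTop 0] with n hn hn0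
    rw [norm_orthogonalProjectionOnto_restrictField_sq h hn0 hn, fieldSq,
      EuclideanSpace.real_norm_sq_eq]
    simp_rw [div_pow, Real.sq_sqrt (Nat.cast_nonneg n)]
    rw [← Finset.sum_div, ← Finset.sum_div, sub_div, add_div]
  have hnorm' : Tendsto (fun n : ℕ =>
      √n * ‖(fieldSpan h n)ᗮ.orthogonalProjectionOnto (restrictField n G)‖⁻¹) atTop
      (𝓝 (√d)⁻¹) := by
    have := ((Real.continuous_sqrt.tendsto _).comp hnorm).inv₀ (Real.sqrt_pos.2 hd').ne'
    refine this.congr fun n => ?_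
    simp only [Function.comp_apply]
    rw [Real.sqrt_div' _ (Nat.cast_nonneg n), Real.sqrt_sq (norm_nonneg _), inv_div, div_eq_mul_inv]
  have hcomp : Tendsto (fun n : ℕ => G (i, j) - ((fieldCoeff h n G).1 j / √n +
      (fieldCoeff h n G).2 / √n * ((h i j - sampleMean h n j) / ‖sampleStd h n‖))) atTop
      (𝓝 (G (i, j))) := by
    have hmj : Tendsto (fun n => sampleMean h n j) atTop (𝓝 0) := by
      have := ((EuclideanSpace.proj (𝕜 := ℝ) j).continuous.tendsto _).comp hm
      exact this
    have := (tendsto_const_nhds (x := G (i, j))).sub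
      ((h1' j).add (h3.mul (((tendsto_const_nhds (x := h i j)).sub hmj).div hs hs0.ne')))
    simpa using this
  have hfin := hnorm'.mul hcomp
  rw [inv_mul_eq_div] at hfin
  refine hfin.congr' ?_
  filter_upwards [hσ, eventually_gt_atTop i] with n hn hi
  have hn0 : n ≠ 0 := by omega
  rw [dif_pos hi, transverseDirection, coe_orthogonalProjectionOnto_restrictField h hn0 hn]
  simp only [PiLp.smul_apply, PiLp.sub_apply, fieldMap_apply, restrictField, smul_eq_mul]
  ring

end GaussianLimits

/-! ### The metric on configurations -/

section SpinDist

variable {d : ℕ}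

theorem spinWeight_pos (p : ℕ × Fin d) : 0 < spinWeight p := by unfold spinWeight; positivity

theorem summable_spinWeight : Summable (spinWeight (d := d)) := by
  have h1 : Summable fun i : ℕ => (1 / 2 : ℝ) ^ (i + 1) :=
    (summable_nat_add_iff 1).2 (summable_geometric_of_lt_one (by norm_num) (by norm_num))
  have h2 : Summable fun j : Fin d => (1 / 2 : ℝ) ^ ((j : ℕ) + 1) := Summable.of_finite
  refine (h1.mul_of_nonneg h2 (fun i => by positivity) fun j => by positivity).congr fun p => ?_
  rw [spinWeight, ← pow_add, div_pow, one_pow]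

/-- The normalization `C(d)` of the metric. -/
def spinTotal (d : ℕ) : ℝ := ∑' p : ℕ × Fin d, spinWeight p

theorem spinTotal_pos (hd : 1 ≤ d) : 0 < spinTotal d :=
  summable_spinWeight.tsum_pos (fun p => (spinWeight_pos p).le) (0, ⟨0, hd⟩) (spinWeight_pos _)

theorem min_abs_nonneg (a : ℝ) : 0 ≤ min |a| 1 := le_min (abs_nonneg a) zero_le_one

theorem summable_mul_spinWeight {a : ℕ × Fin d → ℝ} (h0 : ∀ p, 0 ≤ a p) (h1 : ∀ p, a p ≤ 1) :
    Summable fun p => a p * spinWeight p :=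
  summable_spinWeight.of_nonneg_of_le (fun p => mul_nonneg (h0 p) (spinWeight_pos p).le)
    fun p => mul_le_of_le_one_left (spinWeight_pos p).le (h1 p)

theorem spinDist_eq (φ φ' : SpinConfig d) : spinDist φ φ' =
    (1 / spinTotal d) * ∑' p : ℕ × Fin d, min |φ p.1 p.2 - φ' p.1 p.2| 1 * spinWeight p := rfl

theorem spinDist_nonneg (hd : 1 ≤ d) (φ φ' : SpinConfig d) : 0 ≤ spinDist φ φ' :=
  mul_nonneg (one_div_nonneg.2 (spinTotal_pos hd).le)
    (tsum_nonneg fun p => mul_nonneg (min_abs_nonneg _) (spinWeight_pos p).le)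

theorem spinDist_le_one (hd : 1 ≤ d) (φ φ' : SpinConfig d) : spinDist φ φ' ≤ 1 := by
  have hC := spinTotal_pos hd
  rw [spinDist_eq, one_div, inv_mul_le_one₀ hC]
  exact (summable_mul_spinWeight (fun p => min_abs_nonneg _) fun p => min_le_right _ _).tsum_le_tsum
    (fun p => mul_le_of_le_one_left (spinWeight_pos p).le (min_le_right _ _)) summable_spinWeight

theorem continuous_spinDist_left (φ' : SpinConfig d) : Continuous fun φ => spinDist φ φ' := by
  simp_rw [spinDist_eq]
  refine continuous_const.mul (continuous_tsum (u := spinWeight) (fun p => ?_) summable_spinWeight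
    fun p φ => ?_)
  · have : Continuous fun φ : SpinConfig d => φ p.1 p.2 :=
      (EuclideanSpace.proj (𝕜 := ℝ) p.2).continuous.comp (continuous_apply p.1)
    fun_prop
  · rw [Real.norm_of_nonneg (mul_nonneg (min_abs_nonneg _) (spinWeight_pos p).le)]
    exact mul_le_of_le_one_left (spinWeight_pos p).le (min_le_right _ _)

theorem continuous_of_mem_boundedLipschitz {f : SpinConfig d → ℝ} (hf : f ∈ boundedLipschitz d) :
    Continuous f := by
  rw [continuous_iff_continuousAt]
  intro φ
  have h1 : Tendsto (fun φ' => spinDist φ' φ) (𝓝 φ) (𝓝 0) := by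
    have := (continuous_spinDist_left φ).tendsto φ
    have e : spinDist φ φ = 0 := by simp [spinDist_eq]
    rwa [e] at this
  rw [ContinuousAt, tendsto_iff_norm_sub_tendsto_zero]
  exact squeeze_zero (fun _ => norm_nonneg _) (fun φ' => hf.2 φ' φ) h1

theorem integral_spinDist {Ω : Type*} [MeasurableSpace Ω] {P : Measure Ω} [IsProbabilityMeasure P]
    {X Y : Ω → SpinConfig d} (hX : Measurable X) (hY : Measurable Y) :
    ∫ x, spinDist (X x) (Y x) ∂P = (1 / spinTotal d) *
      ∑' p : ℕ × Fin d, (∫ x, min |X x p.1 p.2 - Y x p.1 p.2| 1 ∂P) * spinWeight p := by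
  simp_rw [spinDist_eq, integral_const_mul]
  congr 1
  have hm : ∀ p : ℕ × Fin d, Measurable fun x => min |X x p.1 p.2 - Y x p.1 p.2| 1 := fun p => by
    have h1 : Measurable fun x => X x p.1 p.2 :=
      (EuclideanSpace.proj (𝕜 := ℝ) p.2).continuous.measurable.comp
        ((measurable_pi_apply p.1).comp hX)
    have h2 : Measurable fun x => Y x p.1 p.2 :=
      (EuclideanSpace.proj (𝕜 := ℝ) p.2).continuous.measurable.comp
        ((measurable_pi_apply p.1).comp hY)
    exact (h1.sub h2).abs.min measurable_const
  have hi : ∀ p : ℕ × Fin d, Integrable (fun x => min |X x p.1 p.2 - Y x p.1 p.2| 1) P := fun p =>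
    Integrable.of_bound (hm p).aestronglyMeasurable 1 (Eventually.of_forall fun x => by
      rw [Real.norm_of_nonneg (min_abs_nonneg _)]; exact min_le_right _ _)
  have h1 := integral_tsum_of_summable_integral_norm (μ := P)
    (F := fun (p : ℕ × Fin d) x => min |X x p.1 p.2 - Y x p.1 p.2| 1 * spinWeight p)
    (fun p => (hi p).mul_const _) ?_
  · rw [← h1]
    simp_rw [integral_mul_const]
  · refine summable_spinWeight.of_nonneg_of_le (fun p => integral_nonneg fun x => norm_nonneg _)
      fun p => ?_
    have : ∀ x, ‖min |X x p.1 p.2 - Y x p.1 p.2| 1 * spinWeight p‖ ≤ spinWeight p := fun x => by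
      rw [Real.norm_of_nonneg (mul_nonneg (min_abs_nonneg _) (spinWeight_pos p).le)]
      exact mul_le_of_le_one_left (spinWeight_pos p).le (min_le_right _ _)
    refine (integral_mono ((hi p).mul_const _).norm (integrable_const _) this).trans ?_
    simp

end SpinDist

/-! ### Coupling of Gibbs and pure states through the same Gaussian field -/

section Coupling

variable {d : ℕ} (h : SpinConfig d)

/-- The configuration with components `G_j(i) / √β + x_j + h_j(i)`. -/
def pureConfig (β : ℝ) (x : SpinVec d) (G : ℕ × Fin d → ℝ) : SpinConfig d :=
  fun i => WithLp.toLp 2 fun j => G (i, j) / √β + x j + h i j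

theorem measurable_pureConfig (β : ℝ) :
    Measurable fun p : SpinVec d × (ℕ × Fin d → ℝ) => pureConfig h β p.1 p.2 := by
  unfold pureConfig
  fun_prop

/-- The expectation of `f` under the law of `pureConfig`. -/
def pureMean (β : ℝ) (f : SpinConfig d → ℝ) (x : SpinVec d) : ℝ :=
  ∫ G, f (pureConfig h β x G) ∂gaussianField d

/-- The deviation of a rescaled component of the transverse direction from the Gaussian. -/
def transverseDeviation (n : ℕ) (p : ℕ × Fin d) (G : ℕ × Fin d → ℝ) : ℝ :=
  if hi : p.1 < n then min |√n * transverseDirection h n G (⟨p.1, hi⟩, p.2) - G p / √d| 1 else 1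

theorem measurable_transverseDeviation (n : ℕ) (p : ℕ × Fin d) :
    Measurable (transverseDeviation h n p) := by
  unfold transverseDeviation
  have := measurable_transverseDirection h n
  split_ifs <;> fun_prop

theorem transverseDeviation_nonneg (n : ℕ) (p : ℕ × Fin d) (G : ℕ × Fin d → ℝ) :
    0 ≤ transverseDeviation h n p G := by
  unfold transverseDeviation
  split_ifs
  · exact min_abs_nonneg _
  · exact zero_le_one

theorem transverseDeviation_le_one (n : ℕ) (p : ℕ × Fin d) (G : ℕ × Fin d → ℝ) :
    transverseDeviation h n p G ≤ 1 := by
  unfold transverseDeviation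
  split_ifs
  · exact min_le_right _ _
  · exact le_rfl

theorem integrable_transverseDeviation (n : ℕ) (p : ℕ × Fin d) :
    Integrable (transverseDeviation h n p) (gaussianField d) :=
  Integrable.of_bound (measurable_transverseDeviation h n p).aestronglyMeasurable 1
    (Eventually.of_forall fun G => by
      rw [Real.norm_of_nonneg (transverseDeviation_nonneg h n p G)]
      exact transverseDeviation_le_one h n p G)

/-- The mean weighted deviation of the transverse direction from the Gaussian field. -/
def transverseError (n : ℕ) : ℝ :=
  (1 / spinTotal d) * ∑' p : ℕ × Fin d,
    (∫ G, transverseDeviation h n p G ∂gaussianField d) * spinWeight p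

/-- Dominated convergence is applied twice: in G, with bound 1, for each component, and then in the
sum over components, with bound `spinWeight`. -/
theorem tendsto_transverseError {s : SpinVec d} (hd : 1 ≤ d)
    (hm : Tendsto (fun n => sampleMean h n) atTop (𝓝 0))
    (hs : Tendsto (fun n => ‖sampleStd h n‖) atTop (𝓝 ‖s‖)) (hs0 : 0 < ‖s‖) :
    Tendsto (transverseError h) atTop (𝓝 0) := by
  have hI : ∀ p : ℕ × Fin d, Tendsto (fun n => ∫ G, transverseDeviation h n p G ∂gaussianField d)
      atTop (𝓝 0) := by
    intro p
    have := tendsto_integral_of_dominated_convergence (μ := gaussianField d)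
      (F := fun n => transverseDeviation h n p) (f := fun _ => 0) (fun _ => 1)
      (fun n => (measurable_transverseDeviation h n p).aestronglyMeasurable) (integrable_const _)
      (fun n => Eventually.of_forall fun G => by
        rw [Real.norm_of_nonneg (transverseDeviation_nonneg h n p G)]
        exact transverseDeviation_le_one h n p G) ?_
    · simpa using this
    · filter_upwards [ae_tendsto_transverseDirection h hd hm hs hs0] with G hG
      have h1 := (hG p.1 p.2).sub_const (G p / √d)
      rw [sub_self] at h1
      have h2 : Tendsto (fun x : ℝ => min |x| 1) (𝓝 0) (𝓝 (min |0| 1)) :=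
        (by fun_prop : Continuous fun x : ℝ => min |x| 1).tendsto 0
      have h3 := h2.comp h1
      simp only [abs_zero, zero_le_one, min_eq_left] at h3
      refine h3.congr' ?_
      filter_upwards [eventually_gt_atTop p.1] with n hn
      simp [transverseDeviation, hn]
  have h1 := tendsto_tsum_of_dominated_convergence (bound := spinWeight (d := d))
    (f := fun n p => (∫ G, transverseDeviation h n p G ∂gaussianField d) * spinWeight p)
    (g := fun _ => 0) (𝓕 := atTop) summable_spinWeight
    (fun p => by simpa using (hI p).mul_const (spinWeight p))
    (Eventually.of_forall fun n p => by
      have h0 : 0 ≤ ∫ G, transverseDeviation h n p G ∂gaussianField d :=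
        integral_nonneg fun G => transverseDeviation_nonneg h n p G
      rw [Real.norm_of_nonneg (mul_nonneg h0 (spinWeight_pos p).le)]
      refine mul_le_of_le_one_left (spinWeight_pos p).le ?_
      refine (integral_mono (integrable_transverseDeviation h n p) (integrable_const 1)
        fun G => transverseDeviation_le_one h n p G).trans ?_
      simp)
  have h2 := h1.const_mul (1 / spinTotal d)
  rw [tsum_zero, mul_zero] at h2
  exact h2

/-- The weighted mean of the external field. -/
def fieldTotal : ℝ := (1 / spinTotal d) * ∑' p : ℕ × Fin d, |h p.1 p.2| * spinWeight p

/-- The first absolute moment of the standard Gaussian. -/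
def gaussianAbs : ℝ := ∫ x : ℝ, |x| ∂gaussianReal 0 1

theorem integrable_abs_gaussianField (p : ℕ × Fin d) :
    Integrable (fun G : ℕ × Fin d → ℝ => |G p|) (gaussianField d) := by
  have h1 : Integrable (fun x : ℝ => |x|) (gaussianReal 0 1) := by
    simpa using (integrable_pow_gaussianReal 1).abs
  exact (measurePreserving_eval_infinitePi (fun _ : ℕ × Fin d => gaussianReal 0 1)
    p).integrable_comp_of_integrable h1

theorem integral_abs_gaussianField (p : ℕ × Fin d) :
    ∫ G, |G p| ∂gaussianField d = gaussianAbs := by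
  rw [gaussianAbs, ← map_eval_gaussianField p, integral_map (measurable_pi_apply p).aemeasurable (by fun_prop)]

/-- The difference of the two spins is split into five errors: in ρw₁, in the coefficient of h, from
the mean m_n, in the transverse direction, and in the Gaussian amplitude ρ/√d against 1/√β. Outside
the volume the deviation is 1 by definition and already dominates. -/
theorem min_abs_sub_le {n : ℕ} (hd : 1 ≤ d) {β : ℝ} (hβ : 0 < β) (hn : n ≠ 0) (w : SpinVec d × ℝ)
    (x : SpinVec d) (G : ℕ × Fin d → ℝ) (p : ℕ × Fin d) :
    min |scaledConfig n (sphereMap h n (w, G)) p.1 p.2 - pureConfig h β x G p.1 p.2| 1 ≤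
      ‖radialFactor w • w.1 - x‖ + |radialFactor w * w.2 / ‖sampleStd h n‖ - 1| * |h p.1 p.2| +
      |radialFactor w * w.2 / ‖sampleStd h n‖| * ‖sampleMean h n‖ + transverseDeviation h n p G +
      |radialFactor w - √(d / β)| * |G p| := by
  obtain ⟨i, j⟩ := p
  have hn' : (0 : ℝ) < n := by positivity
  have hd' : (1 : ℝ) ≤ d := by exact_mod_cast hd
  by_cases hi : i < n
  · set ρ := radialFactor w with hρ
    set y := ρ * w.2 / ‖sampleStd h n‖ with hy
    set t := √n * transverseDirection h n G (⟨i, hi⟩, j) with ht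
    have e1 : scaledConfig n (sphereMap h n (w, G)) i j =
        ρ * w.1 j + y * (h i j - sampleMean h n j) + ρ * t := by
      rw [show i = ((⟨i, hi⟩ : Fin n) : ℕ) from rfl, scaledConfig_apply]
      simp only [sphereMap, PiLp.smul_apply, PiLp.add_apply, smul_eq_mul, fieldMap_apply]
      have := Real.sqrt_pos.2 hn'
      rw [ht, hy]
      field_simp
      ring
    have e2 : scaledConfig n (sphereMap h n (w, G)) i j - pureConfig h β x G i j =
        (ρ • w.1 - x) j + (y - 1) * h i j - y * sampleMean h n j + ρ * (t - G (i, j) / √d) +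
          (ρ - √(d / β)) * (G (i, j) / √d) := by
      have h1 : √(d / β) * (G (i, j) / √d) = G (i, j) / √β := by
        rw [Real.sqrt_div (by positivity)]
        have : 0 < √(d : ℝ) := by positivity
        field_simp
      rw [e1]
      simp only [pureConfig, PiLp.smul_apply, PiLp.sub_apply, smul_eq_mul, sub_mul _ √(d / β), h1]
      ring
    have b1 : |(ρ • w.1 - x) j| ≤ ‖ρ • w.1 - x‖ := by
      rw [← Real.norm_eq_abs]; exact PiLp.norm_apply_le _ j
    have b2 : |sampleMean h n j| ≤ ‖sampleMean h n‖ := by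
      rw [← Real.norm_eq_abs]; exact PiLp.norm_apply_le _ j
    have b3 : |ρ| ≤ 1 := by
      rw [abs_of_pos (radialFactor_pos w)]; exact radialFactor_le_one w
    have b4 : |G (i, j) / √d| ≤ |G (i, j)| := by
      rw [abs_div, abs_of_nonneg (Real.sqrt_nonneg _)]
      exact div_le_self (abs_nonneg _) (Real.one_le_sqrt.2 hd')
    have e3 : transverseDeviation h n (i, j) G = min |t - G (i, j) / √d| 1 := by
      simp [transverseDeviation, hi, ht]
    have b5 : |(ρ • w.1 - x) j + (y - 1) * h i j - y * sampleMean h n j + ρ * (t - G (i, j) / √d) +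
          (ρ - √(d / β)) * (G (i, j) / √d)| ≤ ‖ρ • w.1 - x‖ + |y - 1| * |h i j| +
          |y| * ‖sampleMean h n‖ + |t - G (i, j) / √d| + |ρ - √(d / β)| * |G (i, j)| := by
      refine (abs_add_le _ _).trans (add_le_add ((abs_add_le _ _).trans (add_le_add
        ((abs_sub _ _).trans (add_le_add ((abs_add_le _ _).trans (add_le_add b1 ?_)) ?_)) ?_)) ?_)
      · rw [abs_mul]
      · rw [abs_mul]; gcongr
      · rw [abs_mul]; exact mul_le_of_le_one_left (abs_nonneg _) b3
      · rw [abs_mul]; gcongr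
    rw [e3, e2]
    have p1 := norm_nonneg (ρ • w.1 - x)
    have p2 : 0 ≤ |y - 1| * |h i j| := by positivity
    have p3 : 0 ≤ |y| * ‖sampleMean h n‖ := by positivity
    have p4 : 0 ≤ |ρ - √(d / β)| * |G (i, j)| := by positivity
    rcases le_total |t - G (i, j) / √d| 1 with hc | hc
    · rw [min_eq_left hc]
      exact (min_le_left _ _).trans b5
    · rw [min_eq_right hc]
      refine (min_le_right _ _).trans ?_
      linarith
  · refine (min_le_right _ _).trans ?_
    have e3 : transverseDeviation h n (i, j) G = 1 := by simp [transverseDeviation, hi]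
    rw [e3]
    have p1 := norm_nonneg (radialFactor w • w.1 - x)
    have p2 : 0 ≤ |radialFactor w * w.2 / ‖sampleStd h n‖ - 1| * |h i j| := by positivity
    have p3 : 0 ≤ |radialFactor w * w.2 / ‖sampleStd h n‖| * ‖sampleMean h n‖ := by positivity
    have p4 : 0 ≤ |radialFactor w - √(d / β)| * |G (i, j)| := by positivity
    linarith

/-- The distance of the field coordinates `w` in the volume of size `n` from those of the pure
state at `x`. -/
def couplingError (β : ℝ) (n : ℕ) (w : SpinVec d × ℝ) : ℝ :=
  |radialFactor w * w.2 / ‖sampleStd h n‖ - 1| * fieldTotal h +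
    |radialFactor w * w.2 / ‖sampleStd h n‖| * ‖sampleMean h n‖ + transverseError h n +
    |radialFactor w - √(d / β)| * gaussianAbs

/-- Both expectations run over the same G, so their difference is at most the mean distance of the
two configurations, whichever f is tested. Summability of the weighted field keeps the error in the
coefficient of h under control. -/
theorem abs_transverseMean_sub_pureMean_le {n : ℕ} (hd : 1 ≤ d) {β : ℝ} (hβ : 0 < β) (hn : n ≠ 0)
    (hh : Summable fun p : ℕ × Fin d => |h p.1 p.2| * spinWeight p)
    {f : SpinConfig d → ℝ} (hf : f ∈ boundedLipschitz d) (w : SpinVec d × ℝ) (x : SpinVec d) :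
    |transverseMean h n f w - pureMean h β f x| ≤
      ‖radialFactor w • w.1 - x‖ + couplingError h β n w := by
  have hfm := (continuous_of_mem_boundedLipschitz hf).measurable
  have hX : Measurable fun G : ℕ × Fin d → ℝ => scaledConfig n (sphereMap h n (w, G)) :=
    (measurable_scaledConfig n).comp ((measurable_sphereMap h n).comp measurable_prodMk_left)
  have hY : Measurable (pureConfig h β x) := (measurable_pureConfig h β).comp measurable_prodMk_left
  have hint : ∀ {X : (ℕ × Fin d → ℝ) → SpinConfig d}, Measurable X →
      Integrable (fun G => f (X G)) (gaussianField d) := fun hX =>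
    Integrable.of_bound (hfm.comp hX).aestronglyMeasurable 1 (Eventually.of_forall fun G => hf.1 _)
  have hC := spinTotal_pos hd
  rw [transverseMean, pureMean, ← integral_sub (hint hX) (hint hY)]
  set a := ‖radialFactor w • w.1 - x‖
  set b := |radialFactor w * w.2 / ‖sampleStd h n‖ - 1|
  set c := |radialFactor w * w.2 / ‖sampleStd h n‖| * ‖sampleMean h n‖
  set e := |radialFactor w - √(d / β)|
  have hsd : Integrable (fun G => spinDist (scaledConfig n (sphereMap h n (w, G)))
      (pureConfig h β x G)) (gaussianField d) := by
    refine Integrable.of_bound (by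
      have hm : ∀ p : ℕ × Fin d, Measurable fun G : ℕ × Fin d → ℝ =>
          min |scaledConfig n (sphereMap h n (w, G)) p.1 p.2 - pureConfig h β x G p.1 p.2| 1 *
            spinWeight p := fun p => by
        have h1 : Measurable fun G => scaledConfig n (sphereMap h n (w, G)) p.1 p.2 :=
          (EuclideanSpace.proj (𝕜 := ℝ) p.2).continuous.measurable.comp
            ((measurable_pi_apply p.1).comp hX)
        have h2 : Measurable fun G => pureConfig h β x G p.1 p.2 :=
          (EuclideanSpace.proj (𝕜 := ℝ) p.2).continuous.measurable.comp
            ((measurable_pi_apply p.1).comp hY)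
        exact ((h1.sub h2).abs.min measurable_const).mul_const _
      exact ((Measurable.tsum hm).const_mul _).aestronglyMeasurable) 1
      (Eventually.of_forall fun G => by
        rw [Real.norm_of_nonneg (spinDist_nonneg hd _ _)]
        exact spinDist_le_one hd _ _)
  refine (abs_integral_le_integral_abs).trans ((integral_mono ((hint hX).sub (hint hY)).abs hsd
    fun G => hf.2 _ _).trans ?_)
  rw [integral_spinDist hX hY]
  have hD := fun p => integrable_transverseDeviation h n p
  have hterm : ∀ p : ℕ × Fin d, (∫ G, min |scaledConfig n (sphereMap h n (w, G)) p.1 p.2 -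
      pureConfig h β x G p.1 p.2| 1 ∂gaussianField d) * spinWeight p ≤
      (a + c + e * gaussianAbs) * spinWeight p + b * (|h p.1 p.2| * spinWeight p) +
        (∫ G, transverseDeviation h n p G ∂gaussianField d) * spinWeight p := by
    intro p
    have hA : Integrable (fun G => (a + b * |h p.1 p.2| + c) + transverseDeviation h n p G)
        (gaussianField d) := (integrable_const _).add (hD p)
    have h1 : ∫ G, min |scaledConfig n (sphereMap h n (w, G)) p.1 p.2 -
        pureConfig h β x G p.1 p.2| 1 ∂gaussianField d ≤
        ∫ G, ((a + b * |h p.1 p.2| + c) + transverseDeviation h n p G + e * |G p|)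
          ∂gaussianField d := by
      refine integral_mono_of_nonneg (Eventually.of_forall fun G => min_abs_nonneg _)
        (hA.add ((integrable_abs_gaussianField p).const_mul e))
        (Eventually.of_forall fun G => min_abs_sub_le h hd hβ hn w x G p)
    rw [integral_add hA
      ((integrable_abs_gaussianField p).const_mul e), integral_add (integrable_const _) (hD p),
      integral_const_mul, integral_abs_gaussianField] at h1
    simp only [integral_const, probReal_univ, smul_eq_mul, one_mul] at h1
    have := mul_le_mul_of_nonneg_right h1 (spinWeight_pos p).le
    linarith
  have hs1 : Summable fun p : ℕ × Fin d =>
      (∫ G, transverseDeviation h n p G ∂gaussianField d) * spinWeight p :=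
    summable_mul_spinWeight (fun p => integral_nonneg fun G => transverseDeviation_nonneg h n p G)
      fun p => (integral_mono (hD p) (integrable_const 1)
        fun G => transverseDeviation_le_one h n p G).trans (by simp)
  have hs2 := (summable_spinWeight (d := d)).mul_left (a + c + e * gaussianAbs)
  have hs3 := (hs2.add (hh.mul_left b)).add hs1
  have hs0 : Summable fun p : ℕ × Fin d => (∫ G, min |scaledConfig n (sphereMap h n (w, G)) p.1 p.2 -
      pureConfig h β x G p.1 p.2| 1 ∂gaussianField d) * spinWeight p :=
    hs3.of_nonneg_of_le (fun p => mul_nonneg (integral_nonneg fun G => min_abs_nonneg _)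
      (spinWeight_pos p).le) hterm
  have htot := hs0.tsum_le_tsum hterm hs3
  rw [(hs2.add (hh.mul_left b)).tsum_add hs1, hs2.tsum_add (hh.mul_left b), tsum_mul_left,
    tsum_mul_left] at htot
  refine (mul_le_mul_of_nonneg_left htot (one_div_nonneg.2 hC.le)).trans (le_of_eq ?_)
  rw [couplingError, fieldTotal, transverseError]
  change 1 / spinTotal d * ((a + c + e * gaussianAbs) * spinTotal d + _ + _) = _
  field_simp
  ring

end Coupling

/-! ### Concentration of the field coordinates near the maximal rate -/

section Laplace

variable {d : ℕ}

/-- The exponential rate of the density of the field coordinates. -/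
def fieldRate (β σ : ℝ) (w : SpinVec d × ℝ) : ℝ :=
  fieldEnergy β 0 σ w + d * Real.log (radialFactor w)

/-- The difference between the maximal rate and the rate at `w`. -/
def rateGap (β σ : ℝ) (w : SpinVec d × ℝ) : ℝ :=
  β * (1 - d / β + σ ^ 2) / 2 + d * Real.log √(d / β) - fieldRate β σ w

theorem continuous_rateGap (β σ : ℝ) : Continuous (rateGap (d := d) β σ) := by
  have h1 := continuous_fieldEnergy (d := d) β 0 σ
  have h2 := (continuous_radialFactor (d := d)).log fun w => (radialFactor_pos w).ne'
  unfold rateGap fieldRate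
  fun_prop

/-- These are the squared lengths of the constant, field and transverse parts of a unit vector. -/
theorem norm_sq_add_sq_add_sq (w : SpinVec d × ℝ) :
    ‖radialFactor w • w.1‖ ^ 2 + (radialFactor w * w.2) ^ 2 + radialFactor w ^ 2 = 1 := by
  have h1 := radialFactor_sq w
  rw [norm_smul, Real.norm_of_nonneg (radialFactor_pos w).le]
  unfold fieldSq at h1
  linarith

/-- Eliminate ‖ρw₁‖² by the constraint on the sphere and complete the square in ρw₂. The direction
and the length of w₁ then enter only through ρ. -/
theorem rateGap_eq {β : ℝ} (hβ : 0 < β) (hd : 1 ≤ d) (σ : ℝ) (w : SpinVec d × ℝ) :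
    rateGap β σ w = β / 2 * (radialFactor w * w.2 - σ) ^ 2 +
      (β / 2 * (radialFactor w ^ 2 - d / β) - d * Real.log (radialFactor w / √(d / β))) := by
  have h1 := norm_sq_add_sq_add_sq w
  have h2 := radialFactor_pos w
  have hd' : (0 : ℝ) < d := by exact_mod_cast hd
  have h3 : 0 < √(d / β) := by positivity
  rw [Real.log_div h2.ne' h3.ne', rateGap, fieldRate, fieldEnergy, inner_zero_left]
  linear_combination (-β / 2) * h1

/-- Apply log x ≤ x − 1 at x = ρ/√(d/β); as d = β (d/β), what remains of the ρ-terms is a perfect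
square. -/
theorem rateGap_ge {β : ℝ} (hβ : 0 < β) (hd : 1 ≤ d) (σ : ℝ) (w : SpinVec d × ℝ) :
    β / 2 * ((radialFactor w * w.2 - σ) ^ 2 + (radialFactor w - √(d / β)) ^ 2) ≤
      rateGap β σ w := by
  have h2 := radialFactor_pos w
  have hd' : (0 : ℝ) < d := by exact_mod_cast hd
  have h3 : 0 < √(d / β) := by positivity
  have h4 : √(d / β) ^ 2 = d / β := Real.sq_sqrt (by positivity)
  have h5 := Real.log_le_sub_one_of_pos (div_pos h2 h3)
  have h6 : d * (radialFactor w / √(d / β)) = β * √(d / β) * radialFactor w := by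
    have : (d : ℝ) = β * √(d / β) ^ 2 := by rw [h4]; field_simp
    field_simp
    linear_combination this
  have h7 : β * (d / β) = d := by field_simp
  rw [rateGap_eq hβ hd]
  nlinarith [mul_le_mul_of_nonneg_left h5 hd'.le]

/-- Attaining the maximum makes the open set on which the normalizing integral is bounded below
nonempty. -/
theorem exists_rateGap_eq_zero {β σ r : ℝ} (hβ : 0 < β) (hd : 1 ≤ d)
    (hr : r ^ 2 = 1 - d / β - σ ^ 2) : ∃ w : SpinVec d × ℝ, rateGap β σ w = 0 := by
  have hd' : (0 : ℝ) < d := by exact_mod_cast hd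
  have h3 : 0 < √(d / β) := by positivity
  have h4 : √(d / β) ^ 2 = d / β := Real.sq_sqrt (by positivity)
  set w : SpinVec d × ℝ := ((r / √(d / β)) • EuclideanSpace.single ⟨0, hd⟩ 1, σ / √(d / β)) with hw
  have hq : 1 + fieldSq w = (√(d / β) ^ 2)⁻¹ := by
    simp only [fieldSq, hw, norm_smul, PiLp.norm_single, norm_one, mul_one,
      Real.norm_eq_abs, sq_abs, div_pow]
    rw [hr, h4]
    field_simp
    ring
  have hrf : radialFactor w = √(d / β) := by
    rw [radialFactor, hq, Real.sqrt_inv, inv_inv, Real.sqrt_sq h3.le]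
  refine ⟨w, ?_⟩
  rw [rateGap_eq hβ hd, hrf, div_self h3.ne', Real.log_one, h4]
  simp only [hw]
  field_simp
  ring

variable (h : SpinConfig d)

theorem fieldDensity_eq_exp (β : ℝ) (n : ℕ) (w : SpinVec d × ℝ) : fieldDensity h β n w =
    Real.exp (n * (fieldEnergy β (sampleMean h n) ‖sampleStd h n‖ w +
      d * Real.log (radialFactor w))) := by
  rw [fieldDensity, mul_add, Real.exp_add, mul_comm]
  congr 1
  rw [← mul_assoc, ← Nat.cast_mul, mul_comm _ (Real.log _), Real.exp_mul,
    Real.exp_log (radialFactor_pos w), Real.rpow_natCast]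

/-- Since m_n → 0 and ‖s_n‖ → σ, replacing the energy by its limit costs o(1) in the exponent per
site, uniformly in w. That suffices for localization; the tilt by n m_n is kept exactly elsewhere.
-/
theorem abs_fieldEnergy_sub_le {β : ℝ} (hβ : 0 < β) (m : SpinVec d) (σ σ' : ℝ)
    (w : SpinVec d × ℝ) :
    |fieldEnergy β m σ' w - fieldEnergy β 0 σ w| ≤ β * (‖m‖ + |σ' - σ|) := by
  have h1 := norm_radialFactor_smul_le w
  have h2 := abs_radialFactor_mul_le w
  have h3 := abs_real_inner_le_norm m (radialFactor w • w.1)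
  have e : fieldEnergy β m σ' w - fieldEnergy β 0 σ w =
      β * (inner ℝ m (radialFactor w • w.1) + (σ' - σ) * (radialFactor w * w.2)) := by
    unfold fieldEnergy
    rw [inner_zero_left]
    ring
  rw [e, abs_mul, abs_of_pos hβ]
  gcongr
  refine (abs_add_le _ _).trans (add_le_add (h3.trans (mul_le_of_le_one_right (norm_nonneg m) h1)) ?_)
  rw [abs_mul]
  exact mul_le_of_le_one_right (abs_nonneg _) h2

/-- The exponent 3 is the least integer k with kd > d + 1 for every d ≥ 1. Three sites provide
integrability, and the other n − 3 provide exponential decay. -/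
theorem integrable_exp_fieldRate (β σ : ℝ) (hd : 1 ≤ d) :
    Integrable fun w : SpinVec d × ℝ => Real.exp (3 * fieldRate β σ w) := by
  have h1 : ∀ w : SpinVec d × ℝ, Real.exp (3 * fieldRate β σ w) =
      radialFactor w ^ (3 * d) * Real.exp (3 * fieldEnergy β 0 σ w) := fun w => by
    rw [fieldRate, mul_add, Real.exp_add, mul_comm]
    congr 1
    rw [← mul_assoc, mul_comm _ (Real.log _), Real.exp_mul, Real.exp_log (radialFactor_pos w),
      ← Real.rpow_natCast]
    simp
  simp_rw [h1]
  have hc := continuous_fieldEnergy (d := d) β 0 σ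
  have hc' := continuous_radialFactor (d := d)
  refine ((integrable_radialFactor_pow (N := 3 * d) (by omega)).mul_const
    (Real.exp (3 * (|β| * (1 / 2 + ‖(0 : SpinVec d)‖ + |σ|))))).mono'
    (Continuous.aestronglyMeasurable (by fun_prop)) (Eventually.of_forall fun w => ?_)
  have h2 := pow_pos (radialFactor_pos w) (3 * d)
  rw [Real.norm_of_nonneg (mul_nonneg h2.le (Real.exp_pos _).le)]
  gcongr
  exact (le_abs_self _).trans (abs_fieldEnergy_le _ _ _ _)

/-- Crude Laplace bounds suffice: on the bad set the rate is at most M − δ, while an open set of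
rate above M − δ/4 bounds the normalization from below. -/
theorem tendsto_fieldDensity_rateGap {β σ r : ℝ} (hβ : 0 < β) (hd : 1 ≤ d)
    (hr : r ^ 2 = 1 - d / β - σ ^ 2)
    (hm : Tendsto (fun n => sampleMean h n) atTop (𝓝 0))
    (hs : Tendsto (fun n => ‖sampleStd h n‖) atTop (𝓝 σ)) {δ : ℝ} (hδ : 0 < δ) :
    Tendsto (fun n => (∫ w in {w | δ ≤ rateGap β σ w}, fieldDensity h β n w) /
      ∫ w, fieldDensity h β n w) atTop (𝓝 0) := by
  set M := β * (1 - d / β + σ ^ 2) / 2 + d * Real.log √(d / β) with hM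
  have hgap : ∀ w : SpinVec d × ℝ, fieldRate β σ w = M - rateGap β σ w := fun w => by
    simp [rateGap, hM]
  have hI := integrable_exp_fieldRate (d := d) β σ hd
  have hcont := continuous_rateGap (d := d) β σ
  set S : Set (SpinVec d × ℝ) := {w | rateGap β σ w < δ / 4} with hS
  have hSo : IsOpen S := isOpen_lt hcont continuous_const
  have hSn : S.Nonempty := by
    obtain ⟨w, hw⟩ := exists_rateGap_eq_zero (d := d) hβ hd hr
    exact ⟨w, by simp only [hS, Set.mem_ofPred_eq, hw]; positivity⟩
  have hDm : MeasurableSet {w : SpinVec d × ℝ | δ ≤ rateGap β σ w} :=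
    (isClosed_le continuous_const hcont).measurableSet
  set C₀ := ∫ w : SpinVec d × ℝ, Real.exp (3 * fieldRate β σ w) with hC₀
  set C₁ := ∫ w in S, Real.exp (3 * fieldRate β σ w) with hC₁
  have hC₁p : 0 < C₁ := by
    rw [hC₁, setIntegral_pos_iff_support_of_nonneg_ae
      (Eventually.of_forall fun w => (Real.exp_pos _).le) hI.integrableOn]
    have : Function.support (fun w : SpinVec d × ℝ => Real.exp (3 * fieldRate β σ w)) = Set.univ :=
      Set.eq_univ_of_forall fun w => (Real.exp_pos _).ne'
    rw [this, Set.univ_inter]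
    exact hSo.measure_pos _ hSn
  have hη : ∀ᶠ n in atTop, β * (‖sampleMean h n‖ + |‖sampleStd h n‖ - σ|) < δ / 8 := by
    have h1 : Tendsto (fun n => β * (‖sampleMean h n‖ + |‖sampleStd h n‖ - σ|)) atTop
        (𝓝 (β * (‖(0 : SpinVec d)‖ + |σ - σ|))) :=
      (hm.norm.add (hs.sub_const σ).abs).const_mul β
    simp only [norm_zero, sub_self, abs_zero, add_zero, mul_zero] at h1
    exact h1.eventually_lt_const (by positivity)
  -- The two errors nδ/8 against the gain (n − 3)·3δ/4 give the exponent 9δ/4 − nδ/2.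
  have hbound : ∀ᶠ n : ℕ in atTop, (∫ w in {w | δ ≤ rateGap β σ w}, fieldDensity h β n w) /
      (∫ w, fieldDensity h β n w) ≤
      C₀ / C₁ * Real.exp (9 * δ / 4) * Real.exp (-(n * (δ / 2))) := by
    filter_upwards [hη, eventually_ge_atTop 3] with n hn hn3
    have hnd : d + 1 < n * d := by nlinarith
    have hn3' : (0 : ℝ) ≤ n - 3 := by
      have : (3 : ℝ) ≤ n := by exact_mod_cast hn3
      linarith
    have hDI := integrable_fieldDensity h β hnd
    have hE : ∀ w, |fieldEnergy β (sampleMean h n) ‖sampleStd h n‖ w - fieldEnergy β 0 σ w| ≤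
      δ / 8 := fun w => (abs_fieldEnergy_sub_le hβ _ _ _ w).trans hn.le
    have hnum : ∫ w in {w | δ ≤ rateGap β σ w}, fieldDensity h β n w ≤
        Real.exp (n * (δ / 8) + (n - 3) * (M - δ)) * C₀ := by
      rw [hC₀, ← integral_const_mul]
      refine (setIntegral_mono_on hDI.integrableOn (hI.const_mul _).integrableOn hDm
        fun w hw => ?_).trans (setIntegral_le_integral (hI.const_mul _)
        (Eventually.of_forall fun w => by simp only [Pi.zero_apply]; positivity))
      rw [fieldDensity_eq_exp, ← Real.exp_add]
      refine Real.exp_le_exp.2 ?_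
      have h1 := (abs_le.1 (hE w)).2
      have h2 : fieldRate β σ w ≤ M - δ := by
        rw [hgap]; have : δ ≤ rateGap β σ w := hw; linarith
      have h3 : fieldEnergy β (sampleMean h n) ‖sampleStd h n‖ w + d * Real.log (radialFactor w) ≤
          δ / 8 + fieldRate β σ w := by rw [fieldRate]; linarith
      have h4 := mul_le_mul_of_nonneg_left h3 (Nat.cast_nonneg (α := ℝ) n)
      have h5 := mul_le_mul_of_nonneg_left h2 hn3'
      linarith
    have hden : Real.exp (-(n * (δ / 8)) + (n - 3) * (M - δ / 4)) * C₁ ≤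
        ∫ w, fieldDensity h β n w := by
      rw [hC₁, ← integral_const_mul]
      refine (setIntegral_mono_on (hI.const_mul _).integrableOn hDI.integrableOn
        hSo.measurableSet fun w hw => ?_).trans (setIntegral_le_integral hDI
        (Eventually.of_forall fun w => (fieldDensity_pos h β n w).le))
      rw [fieldDensity_eq_exp, ← Real.exp_add]
      refine Real.exp_le_exp.2 ?_
      have h1 := (abs_le.1 (hE w)).1
      have h2 : M - δ / 4 ≤ fieldRate β σ w := by
        rw [hgap]; have : rateGap β σ w < δ / 4 := hw; linarith
      have h3 : -(δ / 8) + fieldRate β σ w ≤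
          fieldEnergy β (sampleMean h n) ‖sampleStd h n‖ w + d * Real.log (radialFactor w) := by
        rw [fieldRate]; linarith
      have h4 := mul_le_mul_of_nonneg_left h3 (Nat.cast_nonneg (α := ℝ) n)
      have h5 := mul_le_mul_of_nonneg_left h2 hn3'
      linarith
    have hdp : 0 < Real.exp (-(n * (δ / 8)) + (n - 3) * (M - δ / 4)) * C₁ := by positivity
    refine (div_le_div₀ (by
      have : 0 ≤ C₀ := integral_nonneg fun w => (Real.exp_pos _).le
      positivity) hnum hdp hden).trans (le_of_eq ?_)
    rw [mul_div_mul_comm, ← Real.exp_sub, mul_comm, mul_assoc, ← Real.exp_add]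
    congr 2
    ring
  have hlim : Tendsto (fun n : ℕ => C₀ / C₁ * Real.exp (9 * δ / 4) * Real.exp (-(n * (δ / 2))))
      atTop (𝓝 0) := by
    have h1 : Tendsto (fun n : ℕ => -((n : ℝ) * (δ / 2))) atTop atBot :=
      tendsto_neg_atTop_atBot.comp (tendsto_natCast_atTop_atTop.atTop_mul_const (by positivity))
    simpa using (Real.tendsto_exp_atBot.comp h1).const_mul (C₀ / C₁ * Real.exp (9 * δ / 4))
  refine tendsto_of_tendsto_of_tendsto_of_le_of_le' tendsto_const_nhds hlim
    (Eventually.of_forall fun n => div_nonneg (setIntegral_nonneg hDm fun w _ =>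
      (fieldDensity_pos h β n w).le) (integral_nonneg fun w => (fieldDensity_pos h β n w).le)) hbound

end Laplace

/-! ### Integrating inequalities over spheres -/

section PolarBound

variable {d : ℕ} [NeZero d]

theorem measurePreserving_polar_prod : MeasurePreserving
    (fun p : Metric.sphere (0 : SpinVec d) 1 × (Set.Ioi (0 : ℝ) × ℝ) =>
      (((p.2.1 : ℝ) • (p.1 : SpinVec d), p.2.2) : SpinVec d × ℝ))
    ((volume : Measure (SpinVec d)).toSphere.prod
      ((Measure.volumeIoiPow (Module.finrank ℝ (SpinVec d) - 1)).prod volume)) volume := by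
  have h1 := (measurePreserving_smul_sphere (volume : Measure (SpinVec d))).prod
    (MeasurePreserving.id (volume : Measure ℝ))
  have h2 := (measurePreserving_prodAssoc (volume : Measure (SpinVec d)).toSphere
    (Measure.volumeIoiPow (Module.finrank ℝ (SpinVec d) - 1)) (volume : Measure ℝ)).symm
  exact h1.comp h2

/-- An inequality between the integrals over all spheres integrates to an inequality. -/
theorem abs_integral_le_of_sphere {f g : SpinVec d × ℝ → ℝ} (hf : Integrable f)
    (hg : Integrable g)
    (hfg : ∀ t : ℝ, 0 < t → ∀ y : ℝ,
      |∫ Ω, f (t • (Ω : SpinVec d), y) ∂(volume : Measure (SpinVec d)).toSphere| ≤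
        ∫ Ω, g (t • (Ω : SpinVec d), y) ∂(volume : Measure (SpinVec d)).toSphere) :
    |∫ w, f w| ≤ ∫ w, g w := by
  have hmp := measurePreserving_polar_prod (d := d)
  have hf' := hmp.integrable_comp_of_integrable hf
  have hg' := hmp.integrable_comp_of_integrable hg
  have ef : ∀ {k : SpinVec d × ℝ → ℝ}, Integrable k → ∫ w, k w =
      ∫ p, ∫ Ω, k ((p.1 : ℝ) • (Ω : SpinVec d), p.2) ∂(volume : Measure (SpinVec d)).toSphere
        ∂((Measure.volumeIoiPow (Module.finrank ℝ (SpinVec d) - 1)).prod volume) := by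
    intro k hk
    refine Eq.trans ?_ (integral_prod_symm _ (hmp.integrable_comp_of_integrable hk))
    conv_lhs => rw [← hmp.map_eq]
    rw [integral_map hmp.measurable.aemeasurable (by rw [hmp.map_eq]; exact hk.1)]
    rfl
  rw [ef hf, ef hg]
  exact abs_integral_le_integral_abs.trans (integral_mono hf'.integral_prod_right.abs
    hg'.integral_prod_right fun p => hfg p.1 p.1.2 p.2)

end PolarBound

/-! ### Exponentially tilted surface measures -/

section SphereTilt

variable {d : ℕ}

theorem integrable_sphere_of_continuous {g : Metric.sphere (0 : SpinVec d) 1 → ℝ}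
    (hg : Continuous g) : Integrable g (volume : Measure (SpinVec d)).toSphere :=
  hg.integrable_of_hasCompactSupport (HasCompactSupport.of_compactSpace _)

theorem integrable_exp_inner_mul {g : Metric.sphere (0 : SpinVec d) 1 → ℝ} (hg : Measurable g)
    {C : ℝ} (hg1 : ∀ Ω, |g Ω| ≤ C) (b : SpinVec d) :
    Integrable (fun Ω : Metric.sphere (0 : SpinVec d) 1 => Real.exp (inner ℝ b (Ω : SpinVec d)) * g Ω)
      (volume : Measure (SpinVec d)).toSphere := by
  refine (integrable_sphere_of_continuous (g := fun Ω => Real.exp (inner ℝ b (Ω : SpinVec d)) * C)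
    (by fun_prop)).mono' (by fun_prop) (Eventually.of_forall fun Ω => ?_)
  rw [norm_mul, Real.norm_of_nonneg (Real.exp_pos _).le]
  exact mul_le_mul_of_nonneg_left (hg1 Ω) (Real.exp_pos _).le

theorem integrable_exp_inner (b : SpinVec d) :
    Integrable (fun Ω : Metric.sphere (0 : SpinVec d) 1 => Real.exp (inner ℝ b (Ω : SpinVec d)))
      (volume : Measure (SpinVec d)).toSphere :=
  integrable_sphere_of_continuous (by fun_prop)

/-- The bound is relative to exp u. After integration it is a small multiple of the tilted mass,
however large the tilt is. -/
theorem abs_exp_sub_exp_le (u v : ℝ) :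
    |Real.exp u - Real.exp v| ≤ (Real.exp |v - u| - 1) * Real.exp u := by
  have h1 : Real.exp v = Real.exp (v - u) * Real.exp u := by rw [← Real.exp_add]; congr 1; ring
  have h2 : |1 - Real.exp (v - u)| ≤ Real.exp |v - u| - 1 := by
    rw [abs_le]
    constructor
    · linarith [Real.exp_le_exp.2 (le_abs_self (v - u))]
    · have h3 := Real.exp_le_exp.2 (neg_abs_le (v - u))
      have h4 := Real.add_one_le_exp |v - u|
      have h5 := Real.add_one_le_exp (-|v - u|)
      linarith
  rw [h1, ← one_sub_mul, abs_mul, abs_of_pos (Real.exp_pos u)]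
  exact mul_le_mul_of_nonneg_right h2 (Real.exp_pos u).le

/-- The mean of `g` under the tilted surface measure depends continuously on the tilt. -/
theorem abs_integral_exp_inner_sub_le [NeZero d] {g : Metric.sphere (0 : SpinVec d) 1 → ℝ}
    (hg : Measurable g) (hg1 : ∀ Ω, |g Ω| ≤ 1) (b b₀ : SpinVec d) {T : ℝ}
    (hT : T * ∫ Ω, Real.exp (inner ℝ b₀ (Ω : SpinVec d)) ∂(volume : Measure (SpinVec d)).toSphere =
      ∫ Ω, Real.exp (inner ℝ b₀ (Ω : SpinVec d)) * g Ω ∂(volume : Measure (SpinVec d)).toSphere)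
    (hT1 : |T| ≤ 1) :
    |∫ Ω, Real.exp (inner ℝ b (Ω : SpinVec d)) * (g Ω - T) ∂(volume : Measure (SpinVec d)).toSphere| ≤
      2 * (Real.exp ‖b - b₀‖ - 1) *
        ∫ Ω, Real.exp (inner ℝ b (Ω : SpinVec d)) ∂(volume : Measure (SpinVec d)).toSphere := by
  have hgT : ∀ Ω, |g Ω - T| ≤ 2 := fun Ω => by
    have := abs_sub (g Ω) T
    linarith [hg1 Ω]
  have hmT : Measurable fun Ω => g Ω - T := hg.sub_const T
  have hi := integrable_exp_inner_mul hmT hgT b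
  have hi₀ := integrable_exp_inner_mul hmT hgT b₀
  -- T is the mean of g under the tilt b₀, so centring by T leaves only the difference of the two
  -- weights.
  have h0 : ∫ Ω, Real.exp (inner ℝ b₀ (Ω : SpinVec d)) * (g Ω - T)
      ∂(volume : Measure (SpinVec d)).toSphere = 0 := by
    simp_rw [mul_sub]
    rw [integral_sub (integrable_exp_inner_mul hg hg1 b₀) ((integrable_exp_inner b₀).mul_const T),
      integral_mul_const, ← hT]
    ring
  rw [← sub_zero (∫ Ω : Metric.sphere (0 : SpinVec d) 1, Real.exp (inner ℝ b (Ω : SpinVec d)) * (g Ω - T) ∂_), ← h0,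
    ← integral_sub hi hi₀, ← integral_const_mul]
  refine abs_integral_le_integral_abs.trans (integral_mono (hi.sub hi₀).abs
    ((integrable_exp_inner b).const_mul _) fun Ω => ?_)
  have hκ : |inner ℝ b₀ (Ω : SpinVec d) - inner ℝ b (Ω : SpinVec d)| ≤ ‖b - b₀‖ := by
    rw [← inner_sub_left, norm_sub_rev]
    refine (abs_real_inner_le_norm _ _).trans ?_
    simp
  have h1 := abs_exp_sub_exp_le (inner ℝ b (Ω : SpinVec d)) (inner ℝ b₀ (Ω : SpinVec d))
  have h2 := Real.exp_le_exp.2 hκ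
  have h3 := mul_le_mul_of_nonneg_right (sub_le_sub_right h2 1)
    (Real.exp_pos (inner ℝ b (Ω : SpinVec d))).le
  simp only [← sub_mul, abs_mul]
  have h4 := mul_le_mul (h1.trans h3) (hgT Ω) (abs_nonneg _)
    (mul_nonneg (sub_nonneg.2 (Real.one_le_exp (norm_nonneg _))) (Real.exp_pos _).le)
  linarith

/-- A strong tilt in the direction `e` concentrates the surface measure at `e`, uniformly in `e`. -/
theorem exists_integral_exp_norm_sub_le [NeZero d] {ε : ℝ} (hε : 0 < ε) :
    ∃ R : ℝ, ∀ l : ℝ, R ≤ l → ∀ e : SpinVec d, ‖e‖ = 1 →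
      ∫ Ω, Real.exp (inner ℝ (l • e) (Ω : SpinVec d)) * ‖(Ω : SpinVec d) - e‖
        ∂(volume : Measure (SpinVec d)).toSphere ≤
      ε * ∫ Ω, Real.exp (inner ℝ (l • e) (Ω : SpinVec d))
        ∂(volume : Measure (SpinVec d)).toSphere := by
  set τ := (volume : Measure (SpinVec d)).toSphere with hτ
  -- A lower bound for the mass of a cap of radius ε/4, valid for every centre; this makes R
  -- independent of e.
  set c : ℝ := Measure.toSphereBallBound (Module.finrank ℝ (SpinVec d)) (ε / 4) *
    (volume : Measure (SpinVec d)).real (Metric.ball 0 1) with hc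
  have hcpos : 0 < c := by
    have h1 := Measure.toSphereBallBound_pos (Module.finrank ℝ (SpinVec d)) (ε / 4)
    have h2 : 0 < (volume : Measure (SpinVec d)).real (Metric.ball 0 1) :=
      ENNReal.toReal_pos (Metric.measure_ball_pos _ _ one_pos).ne' measure_ball_lt_top.ne
    exact mul_pos (NNReal.coe_pos.2 h1) h2
  set K := τ.real Set.univ
  -- The exponent is at least l(1 − ε²/32) on the cap of radius ε/4 and at most l(1 − ε²/8) beyond
  -- distance ε/2; the two differ by 3lε²/32.
  have hlim : Tendsto (fun l : ℝ => 2 * K * Real.exp (-(l * (3 * ε ^ 2 / 32)))) atTop (𝓝 0) := by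
    have h1 : Tendsto (fun l : ℝ => -(l * (3 * ε ^ 2 / 32))) atTop atBot :=
      tendsto_neg_atTop_atBot.comp (tendsto_id.atTop_mul_const (by positivity))
    simpa using (Real.tendsto_exp_atBot.comp h1).const_mul (2 * K)
  obtain ⟨R, hR⟩ := eventually_atTop.1
    ((hlim.eventually_lt_const (show 0 < ε / 2 * c by positivity)).and (eventually_ge_atTop 0))
  refine ⟨R, fun l hl e he => ?_⟩
  obtain ⟨hl1, hl0⟩ := hR l hl
  have hin : ∀ Ω : Metric.sphere (0 : SpinVec d) 1, inner ℝ (l • e) (Ω : SpinVec d) =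
      l * (1 - ‖(Ω : SpinVec d) - e‖ ^ 2 / 2) := by
    intro Ω
    have h1 := norm_sub_sq_real (Ω : SpinVec d) e
    have h2 : ‖(Ω : SpinVec d)‖ = 1 := by simp
    rw [h2, he, real_inner_comm] at h1
    rw [inner_smul_left, RCLike.conj_to_real]
    congr 1
    linarith
  set I := ∫ Ω, Real.exp (inner ℝ (l • e) (Ω : SpinVec d)) ∂τ with hI
  have hIint := integrable_exp_inner (d := d) (l • e)
  have hlow : Real.exp (l * (1 - ε ^ 2 / 32)) * c ≤ I := by
    set B : Set (Metric.sphere (0 : SpinVec d) 1) := Metric.ball ⟨e, by simp [he]⟩ (ε / 4)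
    have hB : c ≤ τ.real B :=
      Measure.toSphereBallBound_mul_measureReal_unitBall_le_toSphere_ball volume (by positivity) _
    calc Real.exp (l * (1 - ε ^ 2 / 32)) * c ≤ Real.exp (l * (1 - ε ^ 2 / 32)) * τ.real B := by
          gcongr
      _ = ∫ _Ω in B, Real.exp (l * (1 - ε ^ 2 / 32)) ∂τ := by
          rw [setIntegral_const, smul_eq_mul, mul_comm]
      _ ≤ ∫ Ω in B, Real.exp (inner ℝ (l • e) (Ω : SpinVec d)) ∂τ := by
          refine setIntegral_mono_on (integrable_const _).integrableOn hIint.integrableOn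
            Metric.isOpen_ball.measurableSet fun Ω hΩ => ?_
          rw [hin]
          have h1 : ‖(Ω : SpinVec d) - e‖ < ε / 4 := by
            rw [← dist_eq_norm]; exact hΩ
          refine Real.exp_le_exp.2 (mul_le_mul_of_nonneg_left ?_ hl0)
          nlinarith [norm_nonneg ((Ω : SpinVec d) - e)]
      _ ≤ I := setIntegral_le_integral hIint (Eventually.of_forall fun Ω => (Real.exp_pos _).le)
  have hup : ∫ Ω, Real.exp (inner ℝ (l • e) (Ω : SpinVec d)) * ‖(Ω : SpinVec d) - e‖ ∂τ ≤
      ε / 2 * I + 2 * K * Real.exp (l * (1 - ε ^ 2 / 8)) := by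
    have h1 : ∀ Ω : Metric.sphere (0 : SpinVec d) 1,
        Real.exp (inner ℝ (l • e) (Ω : SpinVec d)) * ‖(Ω : SpinVec d) - e‖ ≤
        ε / 2 * Real.exp (inner ℝ (l • e) (Ω : SpinVec d)) +
          2 * Real.exp (l * (1 - ε ^ 2 / 8)) := by
      intro Ω
      have h2 : ‖(Ω : SpinVec d) - e‖ ≤ 2 := by
        have := norm_sub_le (Ω : SpinVec d) e
        rw [he] at this
        have h2 : ‖(Ω : SpinVec d)‖ = 1 := by simp
        linarith
      have hp := Real.exp_pos (inner ℝ (l • e) (Ω : SpinVec d))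
      have hp2 := Real.exp_pos (l * (1 - ε ^ 2 / 8))
      rcases le_total ‖(Ω : SpinVec d) - e‖ (ε / 2) with h3 | h3
      · nlinarith
      · have h4 : Real.exp (inner ℝ (l • e) (Ω : SpinVec d)) ≤ Real.exp (l * (1 - ε ^ 2 / 8)) := by
          rw [hin]
          refine Real.exp_le_exp.2 (mul_le_mul_of_nonneg_left ?_ hl0)
          nlinarith
        nlinarith [norm_nonneg ((Ω : SpinVec d) - e)]
    refine (integral_mono (integrable_sphere_of_continuous (by fun_prop))
      ((hIint.const_mul _).add (integrable_const _)) h1).trans (le_of_eq ?_)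
    rw [integral_add' (hIint.const_mul _) (integrable_const _), integral_const_mul, integral_const,
      smul_eq_mul]
    ring
  refine hup.trans ?_
  have h5 : 2 * K * Real.exp (l * (1 - ε ^ 2 / 8)) ≤ ε / 2 * I := by
    have h6 : Real.exp (l * (1 - ε ^ 2 / 8)) =
        Real.exp (-(l * (3 * ε ^ 2 / 32))) * Real.exp (l * (1 - ε ^ 2 / 32)) := by
      rw [← Real.exp_add]; congr 1; ring
    rw [h6, ← mul_assoc]
    calc 2 * K * Real.exp (-(l * (3 * ε ^ 2 / 32))) * Real.exp (l * (1 - ε ^ 2 / 32)) ≤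
        ε / 2 * c * Real.exp (l * (1 - ε ^ 2 / 32)) := by gcongr
      _ = ε / 2 * (Real.exp (l * (1 - ε ^ 2 / 32)) * c) := by ring
      _ ≤ ε / 2 * I := by gcongr
  linarith

end SphereTilt

/-! ### A small rate gap controls the coupling errors -/

section GoodRegion

variable {d : ℕ} (h : SpinConfig d)

theorem fieldTotal_nonneg (hd : 1 ≤ d) : 0 ≤ fieldTotal h :=
  mul_nonneg (one_div_nonneg.2 (spinTotal_pos hd).le)
    (tsum_nonneg fun p => mul_nonneg (abs_nonneg _) (spinWeight_pos p).le)

theorem gaussianAbs_nonneg : 0 ≤ gaussianAbs := integral_nonneg fun x => abs_nonneg x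

/-- The two sphere constraints give ‖ρw₁‖² − r² = (σ² − (ρw₂)²) + (c − ρ²). Each bracket is at most
2η in absolute value, and dividing by ‖ρw₁‖ + r ≥ r finishes. -/
theorem abs_norm_radialFactor_smul_sub_le {c σ r η : ℝ} (hr0 : 0 < r) (hr : r ^ 2 = 1 - c - σ ^ 2)
    (hc : 0 ≤ c) (hσ : 0 ≤ σ) (hσ1 : σ ≤ 1) {w : SpinVec d × ℝ}
    (hA : |radialFactor w * w.2 - σ| ≤ η) (hP : |radialFactor w - √c| ≤ η) :
    |‖radialFactor w • w.1‖ - r| ≤ η * (4 / r) := by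
  have hη0 : 0 ≤ η := (abs_nonneg _).trans hP
  have hc1 : √c ≤ 1 := Real.sqrt_le_iff.2 ⟨zero_le_one, by nlinarith⟩
  have hc2 : √c ^ 2 = c := Real.sq_sqrt hc
  have hy1 : |radialFactor w * w.2| ≤ 1 := abs_radialFactor_mul_le w
  have hsq := norm_sq_add_sq_add_sq w
  have hρ0 := radialFactor_pos w
  have hρle := radialFactor_le_one w
  set a := ‖radialFactor w • w.1‖
  set ρ := radialFactor w
  set y := ρ * w.2
  have ha : 0 ≤ a := norm_nonneg _
  have e : (a - r) * (a + r) = (σ - y) * (σ + y) + (√c - ρ) * (√c + ρ) := by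
    linear_combination hsq - hr - hc2
  have hb : |(a - r) * (a + r)| ≤ 4 * η := by
    rw [e]
    have h1 : |(σ - y) * (σ + y)| ≤ η * 2 := by
      rw [abs_mul, abs_sub_comm]
      refine mul_le_mul hA ?_ (abs_nonneg _) hη0
      exact (abs_add_le _ _).trans (by rw [abs_of_nonneg hσ]; linarith)
    have h2 : |(√c - ρ) * (√c + ρ)| ≤ η * 2 := by
      rw [abs_mul, abs_sub_comm]
      refine mul_le_mul hP ?_ (abs_nonneg _) hη0
      rw [abs_of_nonneg (by positivity)]
      linarith
    exact (abs_add_le _ _).trans (by linarith)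
  rw [abs_mul, abs_of_pos (by linarith : 0 < a + r)] at hb
  have h1 : |a - r| * r ≤ 4 * η :=
    (mul_le_mul_of_nonneg_left (by linarith) (abs_nonneg _)).trans hb
  rw [← mul_div_assoc, le_div_iff₀ hr0]
  linarith

theorem exists_rateGap_lt_imp {β σ r : ℝ} (hβ : 0 < β) (hd : 1 ≤ d) (hσ : 0 < σ) (hr0 : 0 < r)
    (hr : r ^ 2 = 1 - d / β - σ ^ 2)
    (hm : Tendsto (fun n => sampleMean h n) atTop (𝓝 0))
    (hs : Tendsto (fun n => ‖sampleStd h n‖) atTop (𝓝 σ))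
    (ht : Tendsto (transverseError h) atTop (𝓝 0)) {ε : ℝ} (hε : 0 < ε) :
    ∃ δ > 0, ∀ᶠ n in atTop, ∀ w, rateGap β σ w < δ →
      couplingError h β n w ≤ ε ∧ |‖radialFactor w • w.1‖ - r| ≤ ε := by
  have hd' : (0 : ℝ) < d := by exact_mod_cast hd
  have hH := fieldTotal_nonneg h hd
  have hG := gaussianAbs_nonneg
  set H := fieldTotal h
  set K := 2 / σ * H + gaussianAbs with hK
  have hK0 : 0 ≤ K := by positivity
  -- Chosen so that ηK ≤ ε/2 and η · 4/r ≤ ε; the other half of the coupling error is the remainder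
  -- that vanishes with n.
  set η := ε / (2 * K + 4 / r + 1) with hη
  have hη0 : 0 < η := by positivity
  have hη1 : 2 * (η * K) + η * (4 / r) + η = ε := by
    have : η * (2 * K + 4 / r + 1) = ε := div_mul_cancel₀ _ (by positivity)
    linarith
  have hKr : 0 ≤ η * K := by positivity
  have hKr2 : 0 ≤ η * (4 / r) := by positivity
  have hσ1 : σ ≤ 1 := by
    have : 0 < d / β := by positivity
    nlinarith
  have hrem : Tendsto (fun n => 2 / σ * |σ - ‖sampleStd h n‖| * H + 2 / σ * ‖sampleMean h n‖ +
      transverseError h n) atTop (𝓝 (2 / σ * |σ - σ| * H + 2 / σ * ‖(0 : SpinVec d)‖ + 0)) :=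
    (((((tendsto_const_nhds (x := σ)).sub hs).abs.const_mul _).mul_const H).add
      (hm.norm.const_mul _)).add ht
  simp only [sub_self, abs_zero, mul_zero, zero_mul, norm_zero, add_zero] at hrem
  refine ⟨β / 2 * η ^ 2, by positivity, ?_⟩
  filter_upwards [hrem.eventually_le_const (half_pos hε),
    hs.eventually_const_le (half_lt_self hσ)] with n hn hσn w hw
  have hgap := rateGap_ge hβ hd σ w
  set ρ := radialFactor w with hρ
  set y := ρ * w.2 with hy
  have hsum : (y - σ) ^ 2 + (ρ - √(d / β)) ^ 2 < η ^ 2 := by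
    have h2 : (0 : ℝ) < β / 2 := by positivity
    exact lt_of_mul_lt_mul_left (hgap.trans_lt hw) h2.le
  have hA : |y - σ| ≤ η := abs_le_of_sq_le_sq (by nlinarith [sq_nonneg (ρ - √(d / β))]) hη0.le
  have hP : |ρ - √(d / β)| ≤ η := abs_le_of_sq_le_sq (by nlinarith [sq_nonneg (y - σ)]) hη0.le
  have hy1 : |y| ≤ 1 := abs_radialFactor_mul_le w
  have hσn0 : 0 < ‖sampleStd h n‖ := by linarith
  have hinv : ‖sampleStd h n‖⁻¹ ≤ 2 / σ := by
    rw [inv_le_comm₀ hσn0 (by positivity), inv_div]; exact hσn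
  constructor
  · have h1 : |y / ‖sampleStd h n‖ - 1| ≤ 2 / σ * (η + |σ - ‖sampleStd h n‖|) := by
      have e : y / ‖sampleStd h n‖ - 1 = ‖sampleStd h n‖⁻¹ * ((y - σ) + (σ - ‖sampleStd h n‖)) := by
        field_simp; ring
      rw [e, abs_mul, abs_of_pos (inv_pos.2 hσn0)]
      have := abs_add_le (y - σ) (σ - ‖sampleStd h n‖)
      gcongr
      linarith
    have h2 : |y / ‖sampleStd h n‖| ≤ 2 / σ := by
      rw [div_eq_inv_mul, abs_mul, abs_of_pos (inv_pos.2 hσn0)]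
      exact (mul_le_of_le_one_right (inv_pos.2 hσn0).le hy1).trans hinv
    have h3 := mul_le_mul_of_nonneg_right h1 hH
    have h4 := mul_le_mul_of_nonneg_right h2 (norm_nonneg (sampleMean h n))
    have h5 := mul_le_mul_of_nonneg_right hP hG
    have h6 : couplingError h β n w = |y / ‖sampleStd h n‖ - 1| * H +
      |y / ‖sampleStd h n‖| * ‖sampleMean h n‖ + transverseError h n +
      |ρ - √(d / β)| * gaussianAbs := rfl
    have h7 : η * K = 2 / σ * η * H + η * gaussianAbs := by rw [hK]; ring
    have h8 : 2 / σ * (η + |σ - ‖sampleStd h n‖|) * H =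
      2 / σ * η * H + 2 / σ * |σ - ‖sampleStd h n‖| * H := by ring
    rw [h6]
    linarith
  · refine (abs_norm_radialFactor_smul_sub_le hr0 hr (by positivity) hσ.le hσ1 hA hP).trans ?_
    linarith

end GoodRegion

/-! ### The density on spheres of field coordinates -/

section PolarDensity

variable {d : ℕ} (h : SpinConfig d)

theorem radialFactor_polar (t y : ℝ) (Ω : Metric.sphere (0 : SpinVec d) 1) :
    radialFactor (t • (Ω : SpinVec d), y) = (√(1 + (t ^ 2 + y ^ 2)))⁻¹ := by
  simp [radialFactor, fieldSq, norm_smul]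

/-- By rotation invariance, each sphere lies entirely inside or entirely outside the region of small
gap, so the localization argument never cuts a sphere. -/
theorem rateGap_polar {β : ℝ} (hβ : 0 < β) (hd : 1 ≤ d) (σ t y : ℝ)
    (Ω Ω' : Metric.sphere (0 : SpinVec d) 1) :
    rateGap β σ (t • (Ω : SpinVec d), y) = rateGap β σ (t • (Ω' : SpinVec d), y) := by
  rw [rateGap_eq hβ hd, rateGap_eq hβ hd]
  simp only [radialFactor_polar]

/-- On a sphere `‖w₁‖ = t` the density of the field coordinates is an exponential tilt. -/
theorem exists_fieldDensity_polar (β : ℝ) (n : ℕ) (t y : ℝ) : ∃ D₀ : ℝ, 0 < D₀ ∧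
    ∀ Ω : Metric.sphere (0 : SpinVec d) 1, fieldDensity h β n (t • (Ω : SpinVec d), y) =
      D₀ * Real.exp (inner ℝ ((β * ((√(1 + (t ^ 2 + y ^ 2)))⁻¹ * t)) • ((n : ℝ) • sampleMean h n))
        (Ω : SpinVec d)) := by
  set ρ := (√(1 + (t ^ 2 + y ^ 2)))⁻¹ with hρ
  have hρ0 : 0 < ρ := by rw [hρ]; positivity
  refine ⟨ρ ^ (n * d) * Real.exp (n * (β * ((ρ * t) ^ 2 / 2 + ‖sampleStd h n‖ * (ρ * y)))),
    by positivity, fun Ω => ?_⟩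
  rw [fieldDensity, fieldEnergy]
  simp only [radialFactor_polar, ← hρ]
  rw [mul_assoc, ← Real.exp_add]
  congr 2
  simp only [norm_smul, inner_smul_left, inner_smul_right, mul_pow, Real.norm_eq_abs, sq_abs,
    norm_eq_of_mem_sphere, RCLike.conj_to_real]
  ring

theorem measurable_transverseMean (n : ℕ) {f : SpinConfig d → ℝ} (hf : Measurable f) :
    Measurable (transverseMean h n f) := by
  have h1 : Measurable fun p : (SpinVec d × ℝ) × (ℕ × Fin d → ℝ) =>
      f (scaledConfig n (sphereMap h n p)) :=
    hf.comp ((measurable_scaledConfig n).comp (measurable_sphereMap h n))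
  exact (h1.stronglyMeasurable.integral_prod_right (ν := gaussianField d)).measurable

theorem abs_integral_le_one {Ω : Type*} [MeasurableSpace Ω] (P : Measure Ω) [IsProbabilityMeasure P]
    {g : Ω → ℝ} (hg : ∀ x, |g x| ≤ 1) : |∫ x, g x ∂P| ≤ 1 := by
  have := norm_integral_le_of_norm_le_const (μ := P) (f := g) (C := 1)
    (Eventually.of_forall fun x => by rw [Real.norm_eq_abs]; exact hg x)
  simpa using this

theorem abs_transverseMean_le_one (n : ℕ) {f : SpinConfig d → ℝ} (hf : ∀ φ, |f φ| ≤ 1)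
    (w : SpinVec d × ℝ) : |transverseMean h n f w| ≤ 1 :=
  abs_integral_le_one _ fun _ => hf _

theorem measurable_pureMean (β : ℝ) {f : SpinConfig d → ℝ} (hf : Measurable f) :
    Measurable (pureMean h β f) := by
  have h1 : Measurable fun p : SpinVec d × (ℕ × Fin d → ℝ) => f (pureConfig h β p.1 p.2) :=
    hf.comp (measurable_pureConfig h β)
  exact (h1.stronglyMeasurable.integral_prod_right (ν := gaussianField d)).measurable

theorem abs_pureMean_le_one (β : ℝ) {f : SpinConfig d → ℝ} (hf : ∀ φ, |f φ| ≤ 1)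
    (x : SpinVec d) : |pureMean h β f x| ≤ 1 :=
  abs_integral_le_one _ fun _ => hf _

end PolarDensity

/-! ### From spheres to the Gibbs state -/

section Localization

variable {d : ℕ} (h : SpinConfig d)

/-- If the Gibbs averages over the spheres `‖w₁‖ = t` near the maximizers of the rate are close to
`T`, then so are the Gibbs averages. -/
theorem eventually_abs_gibbsState_sub_le {β σ r : ℝ} (hβ : 0 < β) (hd : 1 ≤ d) (hσ : 0 < σ)
    (hr : r ^ 2 = 1 - d / β - σ ^ 2)
    (hm : Tendsto (fun n => sampleMean h n) atTop (𝓝 0))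
    (hs : Tendsto (fun n => ‖sampleStd h n‖) atTop (𝓝 σ)) {F : Filter ℕ} (hF : F ≤ atTop)
    {T : ℕ → (SpinConfig d → ℝ) → ℝ} (hT : ∀ n, ∀ f ∈ boundedLipschitz d, |T n f| ≤ 1)
    (hloc : ∀ ε > 0, ∃ δ > 0, ∀ᶠ n in F, ∀ f ∈ boundedLipschitz d, ∀ t : ℝ, 0 < t → ∀ y : ℝ,
      (∀ Ω : Metric.sphere (0 : SpinVec d) 1, rateGap β σ (t • (Ω : SpinVec d), y) < δ) →
      |∫ Ω : Metric.sphere (0 : SpinVec d) 1, fieldDensity h β n (t • (Ω : SpinVec d), y) *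
          (transverseMean h n f (t • (Ω : SpinVec d), y) - T n f) ∂(volume : Measure (SpinVec d)).toSphere| ≤
        ε * ∫ Ω : Metric.sphere (0 : SpinVec d) 1, fieldDensity h β n (t • (Ω : SpinVec d), y)
          ∂(volume : Measure (SpinVec d)).toSphere)
    {ε : ℝ} (hε : 0 < ε) :
    ∀ᶠ n in F, ∀ f ∈ boundedLipschitz d, |∫ φ, f φ ∂gibbsState β h n - T n f| ≤ ε := by
  have : NeZero d := ⟨by omega⟩
  obtain ⟨δ, hδ, hev⟩ := hloc (ε / 2) (half_pos hε)
  have hlap := (tendsto_fieldDensity_rateGap h hβ hd hr hm hs hδ).eventually_lt_const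
    (show 0 < ε / 4 by positivity)
  filter_upwards [hev, hF hlap, hF (hs.eventually_const_lt hσ), hF (eventually_ge_atTop 3)]
    with n hn hlapn hσn hn3 f hf
  have hnd : d + 1 < n * d := by nlinarith
  have hn0 : n ≠ 0 := by omega
  have hfm := (continuous_of_mem_boundedLipschitz hf).measurable
  rw [integral_gibbsState h β hn0 hσn hnd (continuous_of_mem_boundedLipschitz hf) hf.1]
  have hDI := integrable_fieldDensity h β hnd
  have hDc := continuous_fieldDensity h β n
  have hDp := fieldDensity_pos h β n
  have hIp := integral_fieldDensity_pos h β hnd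
  have hTm := measurable_transverseMean h n hfm
  have hT1 := hT n f hf
  have hdiff : ∀ w, |transverseMean h n f w - T n f| ≤ 2 := fun w => by
    have := abs_sub (transverseMean h n f w) (T n f)
    linarith [abs_transverseMean_le_one h n hf.1 w]
  have hI0 : ∀ {k : SpinVec d × ℝ → ℝ} {C : ℝ}, Measurable k → (∀ w, |k w| ≤ C) →
      Integrable fun w => fieldDensity h β n w * k w := fun {k C} hk hC =>
    (hDI.mul_const C).mono' (by have := hDc.measurable; fun_prop) (Eventually.of_forall fun w => by
      rw [norm_mul, Real.norm_of_nonneg (hDp w).le]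
      exact mul_le_mul_of_nonneg_left (hC w) (hDp w).le)
  have hI1 := hI0 hTm (abs_transverseMean_le_one h n hf.1)
  have hI2 := hI0 (hTm.sub_const (T n f)) hdiff
  have hSm : MeasurableSet {w : SpinVec d × ℝ | δ ≤ rateGap β σ w} :=
    (isClosed_le continuous_const (continuous_rateGap β σ)).measurableSet
  set S := {w : SpinVec d × ℝ | δ ≤ rateGap β σ w} with hS
  -- The dominating function: ε/2 from `hloc` on good spheres, and the trivial bound 2 on S, whose
  -- share of the mass is below ε/4.
  have hgI : Integrable fun w => ε / 2 * fieldDensity h β n w +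
      2 * S.indicator (fieldDensity h β n) w :=
    (hDI.const_mul _).add ((hDI.indicator hSm).const_mul 2)
  have hcs : ∀ t y : ℝ, Continuous fun Ω : Metric.sphere (0 : SpinVec d) 1 =>
      fieldDensity h β n (t • (Ω : SpinVec d), y) := fun t y => hDc.comp (by fun_prop)
  have key := abs_integral_le_of_sphere hI2 hgI fun t ht y => by
    by_cases hall : ∀ Ω : Metric.sphere (0 : SpinVec d) 1, rateGap β σ (t • (Ω : SpinVec d), y) < δ
    · refine (hn f hf t ht y hall).trans (le_of_eq ?_)
      rw [← integral_const_mul]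
      refine integral_congr_ae (Eventually.of_forall fun Ω => ?_)
      have : ((t • (Ω : SpinVec d), y) : SpinVec d × ℝ) ∉ S := fun hmem =>
        absurd (hall Ω) (not_lt.2 hmem)
      simp only
      rw [Set.indicator_of_notMem this, mul_zero, add_zero]
    · push Not at hall
      obtain ⟨Ω₀, hΩ₀⟩ := hall
      have hmem : ∀ Ω : Metric.sphere (0 : SpinVec d) 1,
          ((t • (Ω : SpinVec d), y) : SpinVec d × ℝ) ∈ S := fun Ω => by
        rw [hS, Set.mem_ofPred_eq, rateGap_polar hβ hd σ t y Ω Ω₀]; exact hΩ₀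
      have e : ∀ Ω : Metric.sphere (0 : SpinVec d) 1,
          ε / 2 * fieldDensity h β n (t • (Ω : SpinVec d), y) +
          2 * S.indicator (fieldDensity h β n) (t • (Ω : SpinVec d), y) =
          (ε / 2 + 2) * fieldDensity h β n (t • (Ω : SpinVec d), y) := fun Ω => by
        rw [Set.indicator_of_mem (hmem Ω)]; ring
      simp_rw [e]
      refine abs_integral_le_integral_abs.trans (integral_mono_of_nonneg
        (Eventually.of_forall fun Ω => abs_nonneg _)
        (integrable_sphere_of_continuous ((hcs t y).const_mul _)) (Eventually.of_forall fun Ω => ?_))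
      simp only [abs_mul, abs_of_pos (hDp _)]
      have := hdiff (t • (Ω : SpinVec d), y)
      have hp := hDp (t • (Ω : SpinVec d), y)
      nlinarith
  have e1 : ∫ w, fieldDensity h β n w * (transverseMean h n f w - T n f) =
      (∫ w, fieldDensity h β n w * transverseMean h n f w) - T n f * ∫ w, fieldDensity h β n w := by
    simp_rw [mul_sub]
    rw [integral_sub hI1 (hDI.mul_const _), integral_mul_const, mul_comm (T n f)]
  rw [e1, integral_add (hDI.const_mul _) ((hDI.indicator hSm).const_mul 2), integral_const_mul,
    integral_const_mul, integral_indicator hSm] at key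
  rw [div_lt_iff₀ hIp] at hlapn
  rw [div_sub' hIp.ne', abs_div, abs_of_pos hIp, div_le_iff₀ hIp, mul_comm _ (T n f)]
  linarith

end Localization

/-! ### The two regimes of n m_n -/

section Cases

variable {d : ℕ} (h : SpinConfig d)

/-- The mean of `f` under the mixture of the pure states tilted by `b`. -/
def mixtureMean (β r : ℝ) (b : SpinVec d) (f : SpinConfig d → ℝ) : ℝ :=
  (∫ Ω : Metric.sphere (0 : SpinVec d) 1, Real.exp (inner ℝ b (Ω : SpinVec d)) *
    pureMean h β f (r • (Ω : SpinVec d)) ∂(volume : Measure (SpinVec d)).toSphere) /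
  ∫ Ω : Metric.sphere (0 : SpinVec d) 1, Real.exp (inner ℝ b (Ω : SpinVec d))
    ∂(volume : Measure (SpinVec d)).toSphere

theorem integral_exp_inner_pos [NeZero d] (b : SpinVec d) :
    0 < ∫ Ω : Metric.sphere (0 : SpinVec d) 1, Real.exp (inner ℝ b (Ω : SpinVec d))
      ∂(volume : Measure (SpinVec d)).toSphere := by
  have : NeZero ((volume : Measure (SpinVec d)).toSphere) := ⟨Measure.toSphere_ne_zero _⟩
  exact integral_exp_pos (integrable_exp_inner b)

theorem abs_mixtureMean_le_one [NeZero d] (β r : ℝ) (b : SpinVec d) {f : SpinConfig d → ℝ}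
    (hf : ∀ φ, |f φ| ≤ 1) : |mixtureMean h β r b f| ≤ 1 := by
  have hp := integral_exp_inner_pos (d := d) b
  rw [mixtureMean, abs_div, abs_of_pos hp, div_le_one hp]
  refine abs_integral_le_integral_abs.trans (integral_mono_of_nonneg
    (Eventually.of_forall fun Ω => abs_nonneg _) (integrable_exp_inner b)
    (Eventually.of_forall fun Ω => ?_))
  simp only [abs_mul, abs_of_pos (Real.exp_pos _)]
  exact mul_le_of_le_one_right (Real.exp_pos _).le (abs_pureMean_le_one h β hf _)

theorem norm_radialFactor_polar {t : ℝ} (ht : 0 < t) (y : ℝ) (Ω : Metric.sphere (0 : SpinVec d) 1) :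
    ‖radialFactor (t • (Ω : SpinVec d), y) • (t • (Ω : SpinVec d))‖ =
      (√(1 + (t ^ 2 + y ^ 2)))⁻¹ * t := by
  rw [radialFactor_polar, norm_smul, norm_smul, norm_eq_of_mem_sphere, Real.norm_of_nonneg
    (by positivity), Real.norm_of_nonneg ht.le, mul_one]

/-- Near the maximizers of the rate, the averages over the spheres `‖w₁‖ = t` are close to averages
of pure states with exponentially tilted weights. -/
theorem exists_abs_transverseMean_sub_le {β σ r : ℝ} (hβ : 0 < β) (hd : 1 ≤ d) (hσ : 0 < σ)
    (hr0 : 0 < r) (hr : r ^ 2 = 1 - d / β - σ ^ 2)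
    (hm : Tendsto (fun n => sampleMean h n) atTop (𝓝 0))
    (hs : Tendsto (fun n => ‖sampleStd h n‖) atTop (𝓝 σ))
    (ht : Tendsto (transverseError h) atTop (𝓝 0))
    (hh : Summable fun p : ℕ × Fin d => |h p.1 p.2| * spinWeight p) {ε : ℝ} (hε : 0 < ε) :
    ∃ δ > 0, ∀ᶠ n in atTop, ∀ t : ℝ, 0 < t → ∀ y : ℝ,
      (∀ Ω : Metric.sphere (0 : SpinVec d) 1, rateGap β σ (t • (Ω : SpinVec d), y) < δ) →
      ∃ D₀ a : ℝ, 0 < D₀ ∧ 0 ≤ a ∧ a ≤ 1 ∧ |a - r| ≤ ε ∧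
        (∀ Ω : Metric.sphere (0 : SpinVec d) 1, fieldDensity h β n (t • (Ω : SpinVec d), y) =
          D₀ * Real.exp (inner ℝ ((β * a) • ((n : ℝ) • sampleMean h n)) (Ω : SpinVec d))) ∧
        ∀ f ∈ boundedLipschitz d, ∀ Ω : Metric.sphere (0 : SpinVec d) 1, ∀ x : SpinVec d,
          |transverseMean h n f (t • (Ω : SpinVec d), y) - pureMean h β f x| ≤
            ‖r • (Ω : SpinVec d) - x‖ + 2 * ε := by
  have : NeZero d := ⟨by omega⟩
  obtain ⟨δ, hδ, hev⟩ := exists_rateGap_lt_imp h hβ hd hσ hr0 hr hm hs ht hε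
  refine ⟨δ, hδ, ?_⟩
  filter_upwards [hev, eventually_ne_atTop 0] with n hn hn0 t ht0 y hgap
  obtain ⟨D₀, hD₀, hD⟩ := exists_fieldDensity_polar h β n t y
  set a := (√(1 + (t ^ 2 + y ^ 2)))⁻¹ * t with ha
  have Ω₀ : Metric.sphere (0 : SpinVec d) 1 := ⟨EuclideanSpace.single ⟨0, hd⟩ 1, by simp⟩
  have hnorm := fun Ω : Metric.sphere (0 : SpinVec d) 1 => norm_radialFactor_polar (d := d) ht0 y Ω
  have ha1 : a ≤ 1 := by rw [ha, ← hnorm Ω₀]; exact norm_radialFactor_smul_le _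
  have har : |a - r| ≤ ε := by rw [ha, ← hnorm Ω₀]; exact (hn _ (hgap Ω₀)).2
  refine ⟨D₀, a, hD₀, by positivity, ha1, har, hD, fun f hf Ω x => ?_⟩
  refine (abs_transverseMean_sub_pureMean_le h hd hβ hn0 hh hf _ x).trans ?_
  have h1 := (hn _ (hgap Ω)).1
  have h2 : ‖radialFactor (t • (Ω : SpinVec d), y) • (t • (Ω : SpinVec d)) - x‖ ≤
      ε + ‖r • (Ω : SpinVec d) - x‖ := by
    rw [radialFactor_polar, smul_smul, ← ha]
    have e : a • (Ω : SpinVec d) - x = (a - r) • (Ω : SpinVec d) + (r • (Ω : SpinVec d) - x) := by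
      rw [sub_smul]; abel
    rw [e]
    refine (norm_add_le _ _).trans (add_le_add_left ?_ _)
    rw [norm_smul, norm_eq_of_mem_sphere, mul_one]
    exact har
  simp only
  linarith

/-- On a good sphere the weight is the tilt by βa n m_n, which is close to βrz. A general filter F ≤
atTop serves both the full sequence and the ultrafilters of the cluster argument. -/
theorem eventually_abs_gibbsState_sub_mixtureMean_le {β σ r : ℝ} (hβ : 0 < β) (hd : 1 ≤ d)
    (hσ : 0 < σ) (hr0 : 0 < r) (hr : r ^ 2 = 1 - d / β - σ ^ 2)
    (hm : Tendsto (fun n => sampleMean h n) atTop (𝓝 0))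
    (hs : Tendsto (fun n => ‖sampleStd h n‖) atTop (𝓝 σ))
    (ht : Tendsto (transverseError h) atTop (𝓝 0))
    (hh : Summable fun p : ℕ × Fin d => |h p.1 p.2| * spinWeight p)
    {F : Filter ℕ} (hF : F ≤ atTop) {z : SpinVec d}
    (hz : Tendsto (fun n : ℕ => (n : ℝ) • sampleMean h n) F (𝓝 z)) {ε : ℝ} (hε : 0 < ε) :
    ∀ᶠ n in F, ∀ f ∈ boundedLipschitz d,
      |∫ φ, f φ ∂gibbsState β h n - mixtureMean h β r ((β * r) • z) f| ≤ ε := by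
  have : NeZero d := ⟨by omega⟩
  refine eventually_abs_gibbsState_sub_le h hβ hd hσ hr hm hs hF
    (T := fun _ f => mixtureMean h β r ((β * r) • z) f)
    (fun n f hf => abs_mixtureMean_le_one h β r _ hf.1) (fun ε hε => ?_) hε
  -- The first term bounds the coupling error, the second the change of tilt: ‖b − b₀‖ ≤ β(η + η‖z‖)
  -- enters through `abs_integral_exp_inner_sub_le`.
  obtain ⟨η, hη0, hη⟩ : ∃ η > 0,
      2 * η + 2 * (Real.exp (β * (η + η * ‖z‖)) - 1) < ε := by
    have hc : Tendsto (fun η : ℝ => 2 * η + 2 * (Real.exp (β * (η + η * ‖z‖)) - 1)) (𝓝[>] 0)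
        (𝓝 (2 * 0 + 2 * (Real.exp (β * (0 + 0 * ‖z‖)) - 1))) :=
      ((by fun_prop : Continuous fun η : ℝ =>
        2 * η + 2 * (Real.exp (β * (η + η * ‖z‖)) - 1)).tendsto 0).mono_left nhdsWithin_le_nhds
    simp only [mul_zero, zero_mul, add_zero, Real.exp_zero, sub_self] at hc
    obtain ⟨η, h1, h2⟩ := ((hc.eventually_lt_const hε).and self_mem_nhdsWithin).exists
    exact ⟨η, h2, h1⟩
  obtain ⟨δ, hδ, hev⟩ := exists_abs_transverseMean_sub_le h hβ hd hσ hr0 hr hm hs ht hh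
    (half_pos hη0)
  refine ⟨δ, hδ, ?_⟩
  have hzn : ∀ᶠ n : ℕ in F, ‖(n : ℝ) • sampleMean h n - z‖ ≤ η :=
    (tendsto_iff_norm_sub_tendsto_zero.1 hz).eventually_le_const hη0
  filter_upwards [hF hev, hzn] with n hn hznn f hf t ht0 y hgap
  obtain ⟨D₀, a, hD₀, ha0, ha1, har, hD, hF⟩ := hn t ht0 y hgap
  have hfm := (continuous_of_mem_boundedLipschitz hf).measurable
  simp_rw [hD, mul_assoc, integral_const_mul]
  rw [abs_mul, abs_of_pos hD₀, mul_left_comm]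
  refine mul_le_mul_of_nonneg_left ?_ hD₀.le
  set b := (β * a) • ((n : ℝ) • sampleMean h n)
  set b₀ := (β * r) • z
  set T := mixtureMean h β r b₀ f
  have hbb : ‖b - b₀‖ ≤ β * (η + η * ‖z‖) := by
    have e : b - b₀ = (β * a) • ((n : ℝ) • sampleMean h n - z) + (β * (a - r)) • z := by
      simp only [b, b₀, smul_sub, mul_sub, sub_smul]; abel
    rw [e]
    refine (norm_add_le _ _).trans ?_
    rw [norm_smul, norm_smul, Real.norm_eq_abs, Real.norm_eq_abs, abs_mul, abs_mul, abs_of_pos hβ,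
      abs_of_nonneg ha0, mul_assoc, mul_assoc, mul_add]
    gcongr
    · exact (mul_le_of_le_one_left (norm_nonneg _) ha1).trans hznn
    · linarith
  have hpm : Measurable fun Ω : Metric.sphere (0 : SpinVec d) 1 =>
      pureMean h β f (r • (Ω : SpinVec d)) :=
    (measurable_pureMean h β hfm).comp (measurable_subtype_coe.const_smul r)
  have htm : Measurable fun Ω : Metric.sphere (0 : SpinVec d) 1 =>
      transverseMean h n f (t • (Ω : SpinVec d), y) :=
    (measurable_transverseMean h n hfm).comp
      ((measurable_subtype_coe.const_smul t).prodMk measurable_const)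
  have hT1 := abs_mixtureMean_le_one h β r b₀ hf.1
  have h2 := abs_integral_exp_inner_sub_le hpm (fun Ω => abs_pureMean_le_one h β hf.1 _) b b₀ (T := T)
    (div_mul_cancel₀ _ (integral_exp_inner_pos b₀).ne') hT1
  have hd1 : ∀ Ω : Metric.sphere (0 : SpinVec d) 1,
      |transverseMean h n f (t • (Ω : SpinVec d), y) - pureMean h β f (r • (Ω : SpinVec d))| ≤ η :=
    fun Ω => by
      have := hF f hf Ω (r • (Ω : SpinVec d))
      rw [sub_self, norm_zero] at this
      linarith
  have hd2 : ∀ Ω : Metric.sphere (0 : SpinVec d) 1,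
      |pureMean h β f (r • (Ω : SpinVec d)) - T| ≤ 2 := fun Ω => by
    have := abs_sub (pureMean h β f (r • (Ω : SpinVec d))) T
    linarith [abs_pureMean_le_one h β hf.1 (r • (Ω : SpinVec d))]
  have hi1 := integrable_exp_inner_mul (htm.sub hpm) hd1 b
  have hi2 := integrable_exp_inner_mul (hpm.sub_const T) hd2 b
  -- First replace the finite-volume mean by the pure state at rΩ, then compare the tilted average
  -- of pure states with the limiting tilt.
  have e : ∀ Ω : Metric.sphere (0 : SpinVec d) 1, Real.exp (inner ℝ b (Ω : SpinVec d)) *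
      (transverseMean h n f (t • (Ω : SpinVec d), y) - T) =
      Real.exp (inner ℝ b (Ω : SpinVec d)) * (transverseMean h n f (t • (Ω : SpinVec d), y) -
        pureMean h β f (r • (Ω : SpinVec d))) +
      Real.exp (inner ℝ b (Ω : SpinVec d)) * (pureMean h β f (r • (Ω : SpinVec d)) - T) :=
    fun Ω => by ring
  simp_rw [e]
  have hsplit := integral_add hi1 hi2
  simp only [Pi.sub_apply] at hsplit
  rw [hsplit]
  have h3 : |∫ Ω : Metric.sphere (0 : SpinVec d) 1, Real.exp (inner ℝ b (Ω : SpinVec d)) *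
      (transverseMean h n f (t • (Ω : SpinVec d), y) - pureMean h β f (r • (Ω : SpinVec d)))
        ∂(volume : Measure (SpinVec d)).toSphere| ≤
      η * ∫ Ω : Metric.sphere (0 : SpinVec d) 1, Real.exp (inner ℝ b (Ω : SpinVec d))
        ∂(volume : Measure (SpinVec d)).toSphere := by
    rw [← integral_const_mul]
    refine abs_integral_le_integral_abs.trans (integral_mono_of_nonneg
      (Eventually.of_forall fun Ω => abs_nonneg _) ((integrable_exp_inner b).const_mul η)
      (Eventually.of_forall fun Ω => ?_))
    simp only [abs_mul, abs_of_pos (Real.exp_pos _)]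
    rw [mul_comm]
    exact mul_le_mul_of_nonneg_right (hd1 Ω) (Real.exp_pos _).le
  refine (abs_add_le _ _).trans ((add_le_add h3 h2).trans ?_)
  rw [← add_mul]
  refine mul_le_mul_of_nonneg_right ?_ (integral_exp_inner_pos b).le
  have := Real.exp_le_exp.2 hbb
  linarith

/-- The strength βa n‖m_n‖ of the tilt diverges, so Ω concentrates at the direction of m_n. That
direction need not converge, which is why the concentration estimate is uniform in the direction. -/
theorem eventually_abs_gibbsState_sub_pureMean_le {β σ r : ℝ} (hβ : 0 < β) (hd : 1 ≤ d)
    (hσ : 0 < σ) (hr0 : 0 < r) (hr : r ^ 2 = 1 - d / β - σ ^ 2)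
    (hm : Tendsto (fun n => sampleMean h n) atTop (𝓝 0))
    (hs : Tendsto (fun n => ‖sampleStd h n‖) atTop (𝓝 σ))
    (ht : Tendsto (transverseError h) atTop (𝓝 0))
    (hh : Summable fun p : ℕ × Fin d => |h p.1 p.2| * spinWeight p)
    {F : Filter ℕ} (hF : F ≤ atTop)
    (hz : Tendsto (fun n : ℕ => (n : ℝ) * ‖sampleMean h n‖) F atTop) {ε : ℝ} (hε : 0 < ε) :
    ∀ᶠ n in F, ∀ f ∈ boundedLipschitz d, |∫ φ, f φ ∂gibbsState β h n -
      pureMean h β f (r • (‖sampleMean h n‖⁻¹ • sampleMean h n))| ≤ ε := by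
  have : NeZero d := ⟨by omega⟩
  refine eventually_abs_gibbsState_sub_le h hβ hd hσ hr hm hs hF
    (T := fun n f => pureMean h β f (r • (‖sampleMean h n‖⁻¹ • sampleMean h n)))
    (fun n f hf => abs_pureMean_le_one h β hf.1 _) (fun ε hε => ?_) hε
  -- The total error is rη from concentration plus 2η from the coupling; η ≤ r/2 keeps a ≥ r/2, so
  -- the strength of the tilt exceeds R.
  set η := min (ε / (2 + r)) (r / 2) with hη
  have hη0 : 0 < η := lt_min (by positivity) (by positivity)
  have hη1 : η * (2 + r) ≤ ε := by
    rw [← le_div_iff₀ (by positivity)]; exact min_le_left _ _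
  have hη2 : η ≤ r / 2 := min_le_right _ _
  obtain ⟨R, hR⟩ := exists_integral_exp_norm_sub_le (d := d) hη0
  obtain ⟨δ, hδ, hev⟩ := exists_abs_transverseMean_sub_le h hβ hd hσ hr0 hr hm hs ht hh hη0
  refine ⟨δ, hδ, ?_⟩
  filter_upwards [hF hev, hz.eventually_ge_atTop (R / (β * (r / 2))), hz.eventually_gt_atTop 0]
    with n hn hzn hzn0 f hf t ht0 y hgap
  obtain ⟨D₀, a, hD₀, ha0, ha1, har, hD, hF⟩ := hn t ht0 y hgap
  have hfm := (continuous_of_mem_boundedLipschitz hf).measurable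
  have hm0 : ‖sampleMean h n‖ ≠ 0 := fun h0 => by simp [h0] at hzn0
  set e := ‖sampleMean h n‖⁻¹ • sampleMean h n with he
  have he1 : ‖e‖ = 1 := by
    rw [he, norm_smul, norm_inv, norm_norm, inv_mul_cancel₀ hm0]
  have hb : (β * a) • ((n : ℝ) • sampleMean h n) = (β * a * (n * ‖sampleMean h n‖)) • e := by
    rw [he, smul_smul, smul_smul]
    congr 1
    field_simp
  have hl : R ≤ β * a * (n * ‖sampleMean h n‖) := by
    have h1 : R ≤ β * (r / 2) * (n * ‖sampleMean h n‖) := by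
      rw [div_le_iff₀ (by positivity)] at hzn; linarith
    have h2 : r / 2 ≤ a := by linarith [(abs_le.1 har).1]
    exact h1.trans (by gcongr)
  have hRl := hR _ hl e he1
  rw [← hb] at hRl
  generalize (β * a) • ((n : ℝ) • sampleMean h n) = b at hD hRl
  simp_rw [hD, mul_assoc, integral_const_mul]
  rw [abs_mul, abs_of_pos hD₀, mul_left_comm]
  refine mul_le_mul_of_nonneg_left ?_ hD₀.le
  have hI := integrable_exp_inner (d := d) b
  have hIn : Integrable (fun Ω : Metric.sphere (0 : SpinVec d) 1 =>
      Real.exp (inner ℝ b (Ω : SpinVec d)) * ‖(Ω : SpinVec d) - e‖)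
      (volume : Measure (SpinVec d)).toSphere := integrable_sphere_of_continuous (by fun_prop)
  calc _ ≤ ∫ Ω : Metric.sphere (0 : SpinVec d) 1, (r * (Real.exp (inner ℝ b (Ω : SpinVec d)) *
        ‖(Ω : SpinVec d) - e‖) + 2 * η * Real.exp (inner ℝ b (Ω : SpinVec d)))
        ∂(volume : Measure (SpinVec d)).toSphere := by
        refine abs_integral_le_integral_abs.trans (integral_mono_of_nonneg
          (Eventually.of_forall fun Ω => abs_nonneg _) ((hIn.const_mul r).add (hI.const_mul (2 * η)))
          (Eventually.of_forall fun Ω => ?_))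
        simp only [abs_mul, abs_of_pos (Real.exp_pos _)]
        have h1 := hF f hf Ω (r • e)
        rw [← smul_sub, norm_smul, Real.norm_of_nonneg hr0.le] at h1
        have h2 := mul_le_mul_of_nonneg_left h1 (Real.exp_pos (inner ℝ b (Ω : SpinVec d))).le
        linarith
    _ = r * ∫ Ω : Metric.sphere (0 : SpinVec d) 1, Real.exp (inner ℝ b (Ω : SpinVec d)) *
        ‖(Ω : SpinVec d) - e‖ ∂(volume : Measure (SpinVec d)).toSphere + 2 * η *
        ∫ Ω : Metric.sphere (0 : SpinVec d) 1, Real.exp (inner ℝ b (Ω : SpinVec d))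
        ∂(volume : Measure (SpinVec d)).toSphere := by
        rw [integral_add (hIn.const_mul r) (hI.const_mul (2 * η)), integral_const_mul,
          integral_const_mul]
    _ ≤ _ := by
        have h1 := mul_le_mul_of_nonneg_left hRl hr0.le
        have h2 := mul_le_mul_of_nonneg_right hη1 (integral_exp_inner_pos (d := d) b).le
        linarith

end Cases

/-! ### Integrals against the limit states -/

section Targets

variable {d : ℕ} (h : SpinConfig d)

/-- On ‖x‖ = r the variance (1 − r² − ‖s‖²)/d equals 1/β, and the factors s_j cancel. -/
theorem productConfig_eq_pureConfig {β r : ℝ} (hd : 1 ≤ d) (hβ : 0 < β) {s x : SpinVec d}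
    (hs : ∀ j, 0 < s j) (hr : r ^ 2 = 1 - d / β - ‖s‖ ^ 2) (hx : ‖x‖ = r) :
    productConfig 0 s h x s = pureConfig h β x := by
  have hd' : (0 : ℝ) < d := by exact_mod_cast hd
  have e : √((1 - ‖x‖ ^ 2 - ‖s‖ ^ 2) / d) = (√β)⁻¹ := by
    rw [hx, hr, ← Real.sqrt_inv]
    congr 1
    field_simp
    ring
  ext G i j
  simp only [productConfig, pureConfig, e]
  have := (hs j).ne'
  simp
  field_simp

theorem integral_productState {β r : ℝ} (hd : 1 ≤ d) (hβ : 0 < β) {s x : SpinVec d}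
    (hs : ∀ j, 0 < s j) (hr : r ^ 2 = 1 - d / β - ‖s‖ ^ 2) (hx : ‖x‖ = r)
    {f : SpinConfig d → ℝ} (hf : Measurable f) :
    ∫ φ, f φ ∂productState 0 s h x s = pureMean h β f x := by
  have hY : Measurable (pureConfig h β x) := (measurable_pureConfig h β).comp measurable_prodMk_left
  rw [productState, productConfig_eq_pureConfig h hd hβ hs hr hx,
    integral_map hY.aemeasurable hf.aestronglyMeasurable]
  rfl

theorem measurable_productConfig_sphere (m s : SpinVec d) (r : ℝ) (y : SpinVec d) :
    Measurable fun p : Metric.sphere (0 : SpinVec d) 1 × (ℕ × Fin d → ℝ) =>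
      productConfig m s h (r • p.1.1) y p.2 := by
  unfold productConfig
  fun_prop

/-- The bind is the image of the product measure under the joint map, so Fubini applies. -/
theorem integral_bind_map {A B C : Type*} [MeasurableSpace A] [MeasurableSpace B]
    [MeasurableSpace C] (P : Measure A) [IsProbabilityMeasure P] (Q : Measure B)
    [IsProbabilityMeasure Q] {T : A → B → C} (hT : Measurable fun p : A × B => T p.1 p.2)
    {f : C → ℝ} (hf : Measurable f) (hf1 : ∀ c, |f c| ≤ 1) :
    ∫ c, f c ∂P.bind (fun a => Q.map (T a)) = ∫ a, ∫ b, f (T a b) ∂Q ∂P := by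
  have e : P.bind (fun a => Q.map (T a)) = (P.prod Q).map fun p => T p.1 p.2 := by
    refine Measure.ext_of_lintegral _ fun F hF => ?_
    have h1 : Measurable fun p : A × B => F (T p.1 p.2) := hF.comp hT
    rw [Measure.lintegral_bind (measurable_map_prodMk Q hT).aemeasurable hF.aemeasurable,
      lintegral_map hF hT, lintegral_prod _ h1.aemeasurable]
    exact lintegral_congr fun a => lintegral_map hF (hT.comp measurable_prodMk_left)
  have h2 : Measurable fun p : A × B => f (T p.1 p.2) := hf.comp hT
  rw [e, integral_map hT.aemeasurable hf.aestronglyMeasurable,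
    integral_prod _ (Integrable.of_bound h2.aestronglyMeasurable 1
      (Eventually.of_forall fun p => hf1 _))]

theorem integral_tiltedMixture {β r : ℝ} (hd : 1 ≤ d) (hβ : 0 < β) (hr0 : 0 < r) {s : SpinVec d}
    (hs : ∀ j, 0 < s j) (hr : r ^ 2 = 1 - d / β - ‖s‖ ^ 2) (z : SpinVec d)
    {f : SpinConfig d → ℝ} (hf : Measurable f) (hf1 : ∀ φ, |f φ| ≤ 1) :
    ∫ φ, f φ ∂tiltedMixture β 0 s h z r s = mixtureMean h β r ((β * r) • z) f := by
  have : NeZero d := ⟨by omega⟩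
  have : IsProbabilityMeasure (((volume : Measure (SpinVec d)).toSphere).tilted
      (fun Ω => β * r * inner ℝ Ω.1 z)) := isProbabilityMeasure_tilted_toSphere (by fun_prop)
  rw [tiltedMixture]
  simp only [productState]
  rw [integral_bind_map _ _ (measurable_productConfig_sphere h 0 s r s) hf hf1, integral_tilted]
  have e : ∀ Ω : Metric.sphere (0 : SpinVec d) 1,
      β * r * inner ℝ (Ω : SpinVec d) z = inner ℝ ((β * r) • z) (Ω : SpinVec d) := fun Ω => by
    rw [inner_smul_left, real_inner_comm]; rfl
  simp_rw [e, smul_eq_mul, div_mul_eq_mul_div, integral_div]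
  rw [mixtureMean]
  congr 1
  refine integral_congr_ae (Eventually.of_forall fun Ω => ?_)
  simp only
  congr 1
  rw [productConfig_eq_pureConfig h hd hβ hs hr (by
    rw [norm_smul, norm_eq_of_mem_sphere, mul_one, Real.norm_of_nonneg hr0.le])]
  rfl

end Targets

/-! ### The bounded Lipschitz distance -/

section BoundedLipschitzDistance

variable {d : ℕ}

theorem distBL_nonneg (μ ν : Measure (SpinConfig d)) : 0 ≤ distBL μ ν :=
  Real.sSup_nonneg (by rintro _ ⟨f, -, rfl⟩; exact abs_nonneg _)

theorem zero_mem_boundedLipschitz (hd : 1 ≤ d) : (fun _ => 0) ∈ boundedLipschitz d :=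
  ⟨fun _ => by simp, fun φ φ' => by simpa using spinDist_nonneg hd φ φ'⟩

theorem tendsto_distBL (hd : 1 ≤ d) {F : Filter ℕ} {μ ν : ℕ → Measure (SpinConfig d)}
    (hμν : ∀ ε > 0, ∀ᶠ n in F, ∀ f ∈ boundedLipschitz d,
      |∫ φ, f φ ∂μ n - ∫ φ, f φ ∂ν n| ≤ ε) :
    Tendsto (fun n => distBL (μ n) (ν n)) F (𝓝 0) := by
  rw [Metric.tendsto_nhds]
  intro ε hε
  filter_upwards [hμν (ε / 2) (half_pos hε)] with n hn
  rw [Real.dist_eq, sub_zero, abs_of_nonneg (distBL_nonneg _ _)]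
  refine (csSup_le (Set.Nonempty.image _ ⟨_, zero_mem_boundedLipschitz hd⟩) ?_).trans_lt
    (half_lt_self hε)
  rintro _ ⟨f, hf, rfl⟩
  exact hn f hf

theorem abs_integral_sub_le_distBL (μ ν : Measure (SpinConfig d)) [IsProbabilityMeasure μ]
    [IsProbabilityMeasure ν] {f : SpinConfig d → ℝ} (hf : f ∈ boundedLipschitz d) :
    |∫ φ, f φ ∂μ - ∫ φ, f φ ∂ν| ≤ distBL μ ν := by
  -- The bound 2, available for probability measures, makes the real `sSup` a true supremum instead
  -- of the default value 0.
  refine le_csSup ⟨2, ?_⟩ ⟨f, hf, rfl⟩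
  rintro _ ⟨g, hg, rfl⟩
  have h1 := abs_integral_le_one μ hg.1
  have h2 := abs_integral_le_one ν hg.1
  have h3 := abs_sub (∫ φ, g φ ∂μ) (∫ φ, g φ ∂ν)
  simp only
  linarith

end BoundedLipschitzDistance

/-! ### Bounded Lipschitz functions determine the state -/

section ClusterStates

variable {d : ℕ}

theorem min_abs_sub_le_spinDist (hd : 1 ≤ d) (p : ℕ × Fin d) (φ φ' : SpinConfig d) :
    min |φ p.1 p.2 - φ' p.1 p.2| 1 ≤ spinTotal d / spinWeight p * spinDist φ φ' := by
  have hC := spinTotal_pos hd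
  have hw := spinWeight_pos p
  have h1 := (summable_mul_spinWeight (d := d) (fun q => min_abs_nonneg (φ q.1 q.2 - φ' q.1 q.2))
    fun q => min_le_right _ _).le_tsum p
      (fun q _ => mul_nonneg (min_abs_nonneg _) (spinWeight_pos q).le)
  rw [spinDist_eq, div_mul_eq_mul_div, le_div_iff₀ hw]
  refine h1.trans_eq ?_
  field_simp

/-- Bounded Lipschitz functions of finitely many spins are multiples of test functions of `distBL`,
up to constants. -/
theorem exists_mul_sub_mem_boundedLipschitz (hd : 1 ≤ d) {I : Finset ℕ}
    {g : (I → SpinVec d) → ℝ} {C : ℝ} (hC : ∀ x y, dist (g x) (g y) ≤ C) {L : ℝ≥0}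
    (hL : LipschitzWith L g) :
    ∃ c > 0, (fun φ : SpinConfig d => c * (g (fun i => φ i) - g 0)) ∈ boundedLipschitz d := by
  have hC0 : 0 ≤ C := dist_nonneg.trans (hC 0 0)
  set K : ℝ := C + L
  set S : ℝ := ∑ i : I, ∑ j : Fin d, spinTotal d / spinWeight ((i : ℕ), j)
  have hS : 0 ≤ S := Finset.sum_nonneg fun i _ => Finset.sum_nonneg fun j _ =>
    div_nonneg (spinTotal_pos hd).le (spinWeight_pos _).le
  have hK : 0 ≤ K := add_nonneg hC0 L.2
  have hkey : ∀ φ φ' : SpinConfig d, |g (fun i => φ i) - g (fun i => φ' i)| ≤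
      K * S * spinDist φ φ' := fun φ φ' => by
    have h1 : ‖(fun i : I => φ i) - (fun i : I => φ' i)‖ ≤
        ∑ i : I, ∑ j : Fin d, |φ i j - φ' i j| := by
      rw [pi_norm_le_iff_of_nonneg (by positivity)]
      intro i
      refine le_trans ?_ (Finset.single_le_sum (f := fun i : I => ∑ j : Fin d, |φ i j - φ' i j|)
        (fun i _ => by positivity) (Finset.mem_univ i))
      refine (EuclideanSpace.norm_eq _).trans_le (Real.sqrt_le_iff.2 ⟨by positivity, ?_⟩)
      exact Finset.sum_sq_le_sq_sum_of_nonneg fun j _ => norm_nonneg _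
    -- Truncating each component, as `spinDist` does, loses nothing against truncating the sum: if
    -- some component reaches 1, so does the right side.
    have h2 : min (∑ i : I, ∑ j : Fin d, |φ i j - φ' i j|) 1 ≤
        ∑ i : I, ∑ j : Fin d, min |φ i j - φ' i j| 1 := by
      by_cases h : ∃ i : I, ∃ j : Fin d, 1 ≤ |φ i j - φ' i j|
      · obtain ⟨i, j, hij⟩ := h
        refine (min_le_right _ _).trans ?_
        calc (1 : ℝ) = min |φ i j - φ' i j| 1 := (min_eq_right hij).symm
          _ ≤ ∑ j : Fin d, min |φ i j - φ' i j| 1 :=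
            Finset.single_le_sum (f := fun j : Fin d => min |φ i j - φ' i j| 1)
              (fun j _ => min_abs_nonneg _) (Finset.mem_univ j)
          _ ≤ _ := Finset.single_le_sum (f := fun i : I => ∑ j : Fin d, min |φ i j - φ' i j| 1)
              (fun i _ => Finset.sum_nonneg fun j _ => min_abs_nonneg _) (Finset.mem_univ i)
      · push Not at h
        refine (min_le_left _ _).trans (Finset.sum_le_sum fun i _ => Finset.sum_le_sum fun j _ => ?_)
        rw [min_eq_left (h i j).le]
    have h3 : ∑ i : I, ∑ j : Fin d, min |φ i j - φ' i j| 1 ≤ S * spinDist φ φ' := by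
      simp only [S, Finset.sum_mul]
      exact Finset.sum_le_sum fun i _ => Finset.sum_le_sum fun j _ =>
        min_abs_sub_le_spinDist hd ((i : ℕ), j) φ φ'
    have h4 : |g (fun i => φ i) - g (fun i => φ' i)| ≤
        K * min (∑ i : I, ∑ j : Fin d, |φ i j - φ' i j|) 1 := by
      have hl := hL.dist_le_mul (fun i => φ i) (fun i => φ' i)
      rw [dist_eq_norm, dist_eq_norm, Real.norm_eq_abs] at hl
      have hb := hC (fun i => φ i) (fun i => φ' i)
      rw [Real.dist_eq] at hb
      rcases min_cases (∑ i : I, ∑ j : Fin d, |φ i j - φ' i j|) 1 with ⟨e, -⟩ | ⟨e, -⟩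
      · rw [e]
        refine hl.trans (mul_le_mul ?_ h1 (norm_nonneg _) hK)
        simp only [K]; linarith
      · rw [e, mul_one]
        refine hb.trans ?_
        simp only [K]; linarith [L.2]
    rw [mul_assoc]
    exact h4.trans (mul_le_mul_of_nonneg_left (h2.trans h3) hK)
  -- C is needed for the sup bound, K * S for the Lipschitz bound, and 1 for positivity.
  refine ⟨(1 + C + K * S)⁻¹, by positivity, fun φ => ?_, fun φ φ' => ?_⟩
  · have := hC (fun i => φ i) 0
    rw [Real.dist_eq] at this
    rw [abs_mul, abs_of_pos (by positivity), inv_mul_le_one₀ (by positivity)]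
    nlinarith [mul_nonneg hK hS]
  · rw [← mul_sub, sub_sub_sub_cancel_right, abs_mul, abs_of_pos (by positivity),
      inv_mul_le_iff₀ (by positivity)]
    refine (hkey φ φ').trans (mul_le_mul_of_nonneg_right (by linarith) (spinDist_nonneg hd _ _))

/-- Finite-dimensional marginals are determined by bounded Lipschitz functions of finitely many
spins, and a measure on the product is the unique projective limit of its marginals. -/
theorem ext_of_boundedLipschitz (hd : 1 ≤ d) {μ ν : Measure (SpinConfig d)}
    [IsProbabilityMeasure μ] [IsProbabilityMeasure ν]
    (hμν : ∀ f ∈ boundedLipschitz d, ∫ φ, f φ ∂μ = ∫ φ, f φ ∂ν) : μ = ν := by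
  have hmI : ∀ I : Finset ℕ, Measurable (I.restrict : SpinConfig d → (I → SpinVec d)) :=
    fun I => Finset.measurable_restrict I
  have hI : ∀ I : Finset ℕ, μ.map I.restrict = ν.map I.restrict := fun I => by
    obtain ⟨P, hP⟩ : ∃ P : ProbabilityMeasure (I → SpinVec d),
        (P : Measure (I → SpinVec d)) = μ.map I.restrict :=
      ⟨⟨_, Measure.isProbabilityMeasure_map (hmI I).aemeasurable⟩, rfl⟩
    obtain ⟨Q, hQ⟩ : ∃ Q : ProbabilityMeasure (I → SpinVec d),
        (Q : Measure (I → SpinVec d)) = ν.map I.restrict :=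
      ⟨⟨_, Measure.isProbabilityMeasure_map (hmI I).aemeasurable⟩, rfl⟩
    -- Equality of the marginals is uniqueness of weak limits: the constant sequence P converges to
    -- Q by the Lipschitz test criterion.
    have ht : Tendsto (fun _ : ℕ => P) atTop (𝓝 Q) := by
      refine tendsto_iff_forall_lipschitz_integral_tendsto.2 fun g ⟨C, hC⟩ ⟨L, hL⟩ => ?_
      obtain ⟨c, hc, hcg⟩ := exists_mul_sub_mem_boundedLipschitz hd hC hL
      have key : ∀ P : Measure (SpinConfig d), IsProbabilityMeasure P →
          ∫ φ, c * (g (fun i => φ i) - g 0) ∂P = c * (∫ x, g x ∂P.map I.restrict - g 0) := by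
        intro P hP
        have hi : Integrable (fun φ : SpinConfig d => g (fun i : I => φ i)) P := by
          have hm : Measurable fun φ : SpinConfig d => g (fun i : I => φ i) :=
            hL.continuous.measurable.comp (hmI I)
          refine Integrable.of_bound hm.aestronglyMeasurable (C + |g 0|)
            (Eventually.of_forall fun φ => ?_)
          have := hC (fun i => φ i) 0
          rw [Real.dist_eq] at this
          rw [Real.norm_eq_abs]
          linarith [abs_sub_abs_le_abs_sub (g fun i => φ i) (g 0)]
        rw [integral_const_mul, integral_sub hi (integrable_const _), integral_const,
          integral_map (hmI I).aemeasurable hL.continuous.aestronglyMeasurable]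
        simp only [probReal_univ, smul_eq_mul, one_mul]
        rfl
      have e := hμν _ hcg
      rw [key μ inferInstance, key ν inferInstance] at e
      have e' := sub_left_injective (mul_left_cancel₀ hc.ne' e)
      rw [hP, hQ, e']
      exact tendsto_const_nhds
    rw [← hP, ← hQ, tendsto_nhds_unique ht tendsto_const_nhds]
  exact IsProjectiveLimit.unique (P := fun I => ν.map I.restrict) (fun I => hI I) fun I => rfl

theorem continuous_pureMean (h : SpinConfig d) (β : ℝ) {f : SpinConfig d → ℝ}
    (hf : f ∈ boundedLipschitz d) : Continuous (pureMean h β f) := by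
  have hc := continuous_of_mem_boundedLipschitz hf
  have hY : ∀ x, Measurable (pureConfig h β x) := fun x =>
    (measurable_pureConfig h β).comp measurable_prodMk_left
  refine continuous_of_dominated (bound := fun _ => 1)
    (fun x => (hc.measurable.comp (hY x)).aestronglyMeasurable)
    (fun x => Eventually.of_forall fun G => hf.1 _) (integrable_const _)
    (Eventually.of_forall fun G => hc.comp ?_)
  unfold pureConfig
  fun_prop

/-- Along F the Gibbs integrals converge to the integral under ν, and also follow T n to its limit
a. This identifies the integral of each test function under a cluster point. -/
theorem integral_eq_of_tendsto_distBL (hd : 1 ≤ d) {β : ℝ} {h : SpinConfig d} {F : Filter ℕ}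
    [F.NeBot] (hF : F ≤ atTop) {ν : Measure (SpinConfig d)} [IsProbabilityMeasure ν]
    (hν : Tendsto (fun n => distBL (gibbsState β h n) ν) F (𝓝 0)) {f : SpinConfig d → ℝ}
    (hf : f ∈ boundedLipschitz d) {T : ℕ → ℝ} {a : ℝ} (hT : Tendsto T F (𝓝 a))
    (hg : ∀ ε > 0, ∀ᶠ n in F, |∫ φ, f φ ∂gibbsState β h n - T n| ≤ ε) :
    ∫ φ, f φ ∂ν = a := by
  have : NeZero d := ⟨by omega⟩
  have h1 : Tendsto (fun n => ∫ φ, f φ ∂gibbsState β h n) F (𝓝 (∫ φ, f φ ∂ν)) := by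
    rw [tendsto_iff_norm_sub_tendsto_zero]
    refine squeeze_zero' (Eventually.of_forall fun n => norm_nonneg _) ?_ hν
    -- For n = 0 the sphere is empty and the Gibbs state is not a probability measure.
    filter_upwards [hF (eventually_ne_atTop 0)] with n hn
    have : NeZero n := ⟨hn⟩
    exact abs_integral_sub_le_distBL _ _ hf
  have h2 : Tendsto (fun n => ∫ φ, f φ ∂gibbsState β h n - T n) F (𝓝 0) := by
    rw [Metric.tendsto_nhds]
    intro ε hε
    filter_upwards [hg (ε / 2) (half_pos hε)] with n hn
    rw [Real.dist_eq, sub_zero]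
    linarith
  have h3 := h2.add hT
  simp only [sub_add_cancel, zero_add] at h3
  exact tendsto_nhds_unique h1 h3

end ClusterStates

/-! ### The limit theorem and the cluster points -/

theorem theorem3p9 (d : ℕ) (hd : 1 ≤ d) (β : ℝ) (h : SpinConfig d) (s : SpinVec d)
    (hm : Tendsto (fun n => sampleMean h n) atTop (𝓝 0))
    (hs : Tendsto (fun n => sampleStd h n) atTop (𝓝 s))
    (hs_pos : ∀ j, 0 < s j)
    (hh : Summable fun p : ℕ × Fin d => |h p.1 p.2| * spinWeight p)
    (hs_lt : ‖s‖ < 1)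
    (hβ : (d : ℝ) / (1 - ‖s‖ ^ 2) < β)
    (r : ℝ) (hr : r = √(1 - (d : ℝ) / β - ‖s‖ ^ 2)) :
    (∀ z : SpinVec d, Tendsto (fun n : ℕ => (n : ℝ) • sampleMean h n) atTop (𝓝 z) →
      Tendsto (fun n => distBL (gibbsState β h n) (tiltedMixture β 0 s h z r s)) atTop (𝓝 0)) ∧
    (Tendsto (fun n : ℕ => (n : ℝ) * ‖sampleMean h n‖) atTop atTop →
      Tendsto (fun n => distBL (gibbsState β h n)
        (productState 0 s h (r • (‖sampleMean h n‖⁻¹ • sampleMean h n)) s)) atTop (𝓝 0)) ∧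
    clusterStates (gibbsState β h) ⊆
      Set.range (fun z : SpinVec d => tiltedMixture β 0 s h z r s) ∪
      Set.range (fun Ω : Metric.sphere (0 : SpinVec d) 1 =>
        productState 0 s h (r • Ω.1) s) := by
  have : NeZero d := ⟨by omega⟩
  have hd0 : (0 : ℝ) < d := by exact_mod_cast hd
  have hσ : 0 < ‖s‖ := norm_pos_iff.2 fun h0 => by
    have := hs_pos ⟨0, hd⟩
    simp [h0] at this
  have h1s : 0 < 1 - ‖s‖ ^ 2 := by nlinarith
  have hβ0 : 0 < β := (div_pos hd0 h1s).trans hβ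
  have hrad : 0 < 1 - (d : ℝ) / β - ‖s‖ ^ 2 := by
    have : (d : ℝ) / β < 1 - ‖s‖ ^ 2 := by
      rw [div_lt_iff₀ hβ0]
      rw [div_lt_iff₀ h1s] at hβ
      linarith
    linarith
  have hr0 : 0 < r := hr ▸ Real.sqrt_pos.2 hrad
  have hr2 : r ^ 2 = 1 - d / β - ‖s‖ ^ 2 := by rw [hr, Real.sq_sqrt hrad.le]
  have ht := tendsto_transverseError h hd hm hs.norm hσ
  have hmix := fun {F : Filter ℕ} (hF : F ≤ atTop) {z : SpinVec d} hz {ε : ℝ} (hε : 0 < ε) =>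
    eventually_abs_gibbsState_sub_mixtureMean_le h hβ0 hd hσ hr0 hr2 hm hs.norm ht hh hF
      (z := z) hz hε
  have hpure := fun {F : Filter ℕ} (hF : F ≤ atTop) hz {ε : ℝ} (hε : 0 < ε) =>
    eventually_abs_gibbsState_sub_pureMean_le h hβ0 hd hσ hr0 hr2 hm hs.norm ht hh hF hz hε
  have hunit : ∀ m : SpinVec d, m ≠ 0 → ‖‖m‖⁻¹ • m‖ = 1 := fun m hm0 => by
    rw [norm_smul, norm_inv, norm_norm, inv_mul_cancel₀ (norm_ne_zero_iff.2 hm0)]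
  refine ⟨fun z hz => tendsto_distBL hd fun ε hε => ?_,
    fun hz => tendsto_distBL hd fun ε hε => ?_, ?_⟩
  · filter_upwards [hmix le_rfl hz hε] with n hn f hf
    rw [integral_tiltedMixture h hd hβ0 hr0 hs_pos hr2 z
      (continuous_of_mem_boundedLipschitz hf).measurable hf.1]
    exact hn f hf
  · filter_upwards [hpure le_rfl hz hε, hz.eventually_gt_atTop 0] with n hn hn0 f hf
    have hm0 : sampleMean h n ≠ 0 := fun h0 => by simp [h0] at hn0
    rw [integral_productState h hd hβ0 hs_pos hr2
      (by rw [norm_smul, hunit _ hm0, mul_one, Real.norm_of_nonneg hr0.le])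
      (continuous_of_mem_boundedLipschitz hf).measurable]
    exact hn f hf
  · rintro ν ⟨hν, k, hk, hlim⟩
    -- An ultrafilter finer than the subsequence replaces further extraction: compactness then gives
    -- convergence along U itself.
    obtain ⟨U, hU⟩ : ∃ U : Ultrafilter ℕ, (U : Filter ℕ) ≤ map k atTop :=
      ⟨Ultrafilter.of _, Ultrafilter.of_le _⟩
    have hUt : (U : Filter ℕ) ≤ atTop := hU.trans hk.tendsto_atTop
    have hν0 : Tendsto (fun n => distBL (gibbsState β h n) ν) (map k atTop) (𝓝 0) :=
      tendsto_map'_iff.2 hlim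
    have hUν := hν0.mono_left hU
    by_cases hz : Tendsto (fun n : ℕ => (n : ℝ) * ‖sampleMean h n‖) U atTop
    · right
      have hmem : Metric.sphere (0 : SpinVec d) 1 ∈
          U.map fun n => ‖sampleMean h n‖⁻¹ • sampleMean h n := by
        rw [Ultrafilter.mem_map]
        filter_upwards [hz.eventually_gt_atTop 0] with n hn0
        have hm0 : sampleMean h n ≠ 0 := fun h0 => by simp [h0] at hn0
        simpa using hunit _ hm0
      obtain ⟨Ω, hΩ, hUΩ⟩ := (isCompact_sphere (0 : SpinVec d) 1).ultrafilter_le_nhds' _ hmem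
      refine ⟨⟨Ω, hΩ⟩, (ext_of_boundedLipschitz hd fun f hf => ?_).symm⟩
      rw [integral_productState h hd hβ0 hs_pos hr2
        (by rw [norm_smul, norm_eq_of_mem_sphere, mul_one, Real.norm_of_nonneg hr0.le])
        (continuous_of_mem_boundedLipschitz hf).measurable]
      have hΩt : Tendsto (fun n => ‖sampleMean h n‖⁻¹ • sampleMean h n) U (𝓝 Ω) := hUΩ
      refine integral_eq_of_tendsto_distBL hd hUt hUν hf
        (((continuous_pureMean h β hf).tendsto _).comp (hΩt.const_smul r)) fun ε hε => ?_
      filter_upwards [hpure hUt hz hε] with n hn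
      exact hn f hf
    · left
      -- Along an ultrafilter, a bound R that is not eventually exceeded is eventually respected, so
      -- n m_n stays in a compact ball.
      rw [tendsto_atTop] at hz
      push Not at hz
      obtain ⟨R, hR⟩ := hz
      have hmem : Metric.closedBall (0 : SpinVec d) R ∈
          U.map fun n : ℕ => (n : ℝ) • sampleMean h n := by
        rw [Ultrafilter.mem_map]
        filter_upwards [hR] with n hn
        simpa [norm_smul] using hn.le
      obtain ⟨z, -, hUz⟩ := (isCompact_closedBall (0 : SpinVec d) R).ultrafilter_le_nhds' _ hmem
      refine ⟨z, (ext_of_boundedLipschitz hd fun f hf => ?_).symm⟩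
      rw [integral_tiltedMixture h hd hβ0 hr0 hs_pos hr2 z
        (continuous_of_mem_boundedLipschitz hf).measurable hf.1]
      have hzt : Tendsto (fun n : ℕ => (n : ℝ) • sampleMean h n) U (𝓝 z) := hUz
      refine integral_eq_of_tendsto_distBL hd hUt hUν hf tendsto_const_nhds fun ε hε => ?_
      filter_upwards [hmix hUt hzt hε] with n hn
      exact hn f hf

end
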